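/- Conventions. Let $A$ be a finite alphabet. On $A^{\mathbb Z}$ let $d_C(x,y)=2^{-\min\{|i|\,:\,x_i\neq y_i\}}$ (and $d_C(x,x)=0$) and let $\sigma(x)_i=x_{i+1}$ be the shift. A cellular automaton (CA) is a map $F:A^{\mathbb Z}\to A^{\mathbb Z}$ for which there are a finite set $U\subset\mathbb Z$ and a map $f:A^U\to A$ with $F(x)_m=f((x_{m+u})_{u\in U})$ for all $x$ and $m$. A curve is a map $h:\mathbb N\to\mathbb Z$, and $\mathcal F$ is the set of curves $h$ such that $|h(n+1)-h(n)|$ is bounded. For a curve $h$, $x\in A^{\mathbb Z}$ and $\varepsilon>0$ put $B(x,\varepsilon)=\{y: d_C(x,y)<\varepsilon\}$ and $$D^h(x,\varepsilon)=\{y:\ d_C(\sigma^{h(n)}F^n(x),\sigma^{h(n)}F^n(y))<\varepsilon\ \text{ for all } n\in\mathbb N\}.$$ A point $x$ is equicontinuous along $h$ if for every $\varepsilon>0$ there is $\delta>0$ with $B(x,\delta)\subseteq D^h(x,\varepsilon)$. The CA is sensitive along $h$ if there is $\varepsilon>0$ such that for all $\delta>0$ and all $x$ the set $B(x,\delta)\setminus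 D^h(x,\varepsilon)$ is non-empty. Let $\mathbf A_{\mathbb N}(A^{\mathbb Z},F)$ be the set of $h\in\mathcal F$ along which $F$ has at least one equicontinuous point. Write $h\precsim k$ if $h\le k+M$ for some constant $M>0$, and $h\sim k$ if $|h-k|\le M$ for some constant $M>0$. For $\alpha\in\mathbb R$ let $h_\alpha(n)=\lfloor \alpha n\rfloor$, and let $$p(n)=\left\lfloor\frac{\sqrt{1+4(n+1)}-1}{2}\right\rfloor .$$ Statement. There are cellular automata $(A_P^{\mathbb Z},F_P)$ and $(A_C^{\mathbb Z},F_C)$ over finite alphabets such that $$\mathbf A_{\mathbb N}(A_P^{\mathbb Z},F_P)=\{h\in\mathcal F: p\precsim h\precsim \mathrm{id}\},\qquad \mathbf A_{\mathbb N}(A_C^{\mathbb Z},F_C)=\{h\in\mathcal F: 0\precsim h\precsim p\},$$ and such that the product $F=F_P\times F_C$, acting on $(A_P\times A_C)^{\mathbb Z}$, is a cellular automaton with $$\mathbf A_{\mathbb N}\big((A_P\times A_C)^{\mathbb Z},F\big)=\{h\in\mathcal F: h\sim p\}.$$ Moreover $p\in\mathcal F$, the curve $p$ is not linear, that is, $p\not\sim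 h_\alpha$ for every $\alpha\in\mathbb R$, and $F$ is sensitive along $h_\alpha$ for every $\alpha\in\mathbb R$. -/

import Mathlib

noncomputable section

namespace DirectionalCA

/-- Configurations over the alphabet `A`: bi-infinite sequences of letters. -/
abbrev Config (A : Type) : Type := ℤ → A

/-- The distance `2 ^ (- min {|i| : x i ≠ y i})`, equal to `0` when `x = y`. -/
def dC {A : Type} (x y : Config A) : ℝ :=
  open Classical in
  if x = y then 0 else (1 / 2 : ℝ) ^ sInf {k : ℕ | ∃ i : ℤ, i.natAbs = k ∧ x i ≠ y i}

/-- The `m`-th power of the shift, `m ∈ ℤ`. -/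
def shift {A : Type} (m : ℤ) (x : Config A) : Config A := fun i => x (i + m)

/-- `F` is (the global map of) a cellular automaton: there are a finite neighborhood `U` and a
local rule `f` with `F x m = f ((x (m + u))_{u ∈ U})`. (The alphabet is required to be finite
where the notion is used.) -/
def IsCellularAutomaton {A : Type} (F : Config A → Config A) : Prop :=
  ∃ (U : Finset ℤ) (f : (U → A) → A),
    ∀ (x : Config A) (m : ℤ), F x m = f (fun u => x (m + (u : ℤ)))

/-- The product of two maps on configurations, acting on configurations over `A × B`. -/
def prodMap {A B : Type} (F : Config A → Config A) (G : Config B → Config B) :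
    Config (A × B) → Config (A × B) :=
  fun x i => (F (fun j => (x j).1) i, G (fun j => (x j).2) i)

/-- The open ball of radius `δ` centered at `x`. -/
def ball {A : Type} (x : Config A) (δ : ℝ) : Set (Config A) := {y | dC x y < δ}

/-- The tube along the curve `h` of radius `ε` centered at `x`. -/
def tube {A : Type} (F : Config A → Config A) (h : ℕ → ℤ) (x : Config A) (ε : ℝ) :
    Set (Config A) :=
  {y | ∀ n : ℕ, dC (shift (h n) (F^[n] x)) (shift (h n) (F^[n] y)) < ε}

/-- The set of equicontinuous points along `h`. -/
def equicontinuousPoints {A : Type} (F : Config A → Config A) (h : ℕ → ℤ) : Set (Config A) :=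
  {x | ∀ ε : ℝ, 0 < ε → ∃ δ : ℝ, 0 < δ ∧ ball x δ ⊆ tube F h x ε}

/-- Sensitivity along `h`. -/
def SensitiveAlong {A : Type} (F : Config A → Config A) (h : ℕ → ℤ) : Prop :=
  ∃ ε : ℝ, 0 < ε ∧ ∀ δ : ℝ, 0 < δ → ∀ x : Config A, ∃ y, y ∈ ball x δ \ tube F h x ε

/-- The set of curves with bounded variation. -/
def curves : Set (ℕ → ℤ) := {h | ∃ M : ℤ, 0 < M ∧ ∀ n : ℕ, |h (n + 1) - h n| ≤ M}

/-- The set of curves with bounded variation along which there are equicontinuous points. -/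
def equicontinuousCurves {A : Type} (F : Config A → Config A) : Set (ℕ → ℤ) :=
  {h | h ∈ curves ∧ (equicontinuousPoints F h).Nonempty}

/-- `h ≾ k`: `h` is below `k` up to a constant. -/
def Below (h k : ℕ → ℤ) : Prop := ∃ M : ℤ, 0 < M ∧ ∀ n : ℕ, h n ≤ k n + M

/-- `h ∼ k`: `h` and `k` are at bounded distance. -/
def Equivalent (h k : ℕ → ℤ) : Prop :=
  ∃ M : ℤ, 0 < M ∧ ∀ n : ℕ, k n - M ≤ h n ∧ h n ≤ k n + M

/-- The linear curve of slope `α`. -/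
def linearCurve (α : ℝ) : ℕ → ℤ := fun n => ⌊α * (n : ℝ)⌋

/-- The parabola `n ↦ ⌊(√(1 + 4 (n + 1)) - 1) / 2⌋`. -/
def parabola : ℕ → ℤ := fun n => ⌊(Real.sqrt (1 + 4 * ((n : ℝ) + 1)) - 1) / 2⌋

end DirectionalCA

end

/-! Both automata carry the factor `andMap`, which is equicontinuous exactly along the curves
between `0` and the identity, the cone of its rule. It remains to find `parMap`, which excludes the
curves that fail to stay above `parabola`, and `openMap`, which excludes those that fail to stay
below it. In a product, equicontinuous points of the factors combine, while perturbing one factor is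
enough for sensitivity, so products intersect the conditions. The product of the two automata
therefore keeps only `h ∼ parabola`, which no line satisfies because a square root is not linear.
Each excluded curve is shown to be `UniformlySensitive`, which gives both the absence of
equicontinuous points and sensitivity.

The square root comes from a bouncing signal. A counter of width `V` needs `2 V - 2` steps for its
signal to cross it and return; then the width grows by one. After `n` steps a fresh counter has
width at least `parabola n` (`parabola_le_cV`), and no counter grows by more than `parabola n + 2`
(`IsPhase.growth`).

In `parMap`, up to a reflection, guards are such counters with a fixed root, and blanks erase
everything at speed one except that the end of a guard advances into them. Hence a blank interval is
invaded at most as fast as the parabola (`pushMap_iterate_blank`), and a complete guard attains this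
speed (`pushMap_iterate_guard`).

In `openMap` a colour is forgotten only in open space. Open space is left behind by trains, whose
heads advance one cell per period, so it spreads no faster than the parabola (`Evolution.not_open`)
and colours beyond it give sensitivity. Conversely, every active seed emits a train to the right and
a guard to the left, and from a lattice of seeds open space has to fill the gaps and then spread
like the parabola, whatever lies outside. The outside may contain trains and guards of any shape,
but they are strictly older than those of the seeds, and the rule lets the younger object win. The
tip of a train runs ahead of its head by about one width, notices the root of a guard, and sends
back a signal that remembers the distance. If this signal meets the end of the guard early, the
guard is younger and the train dies. If the signal reaches the head first, the head destroys an end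
in its way. If both happen at once, with head and end about to move, the ages agree: this is the
meeting of neighbouring seeds, where guard and train dissolve and the space opens up to the root.
The structure `Inv` records this picture; `Evolution.inv` proves it by induction on time and
`Evolution.open_right` draws the conclusion. -/

namespace DirectionalCA

/-! ### Equicontinuity and sensitivity in combinatorial form. -/

/-- The configurations `x` and `y` agree on `[-m, m]`. -/
def AgreeOn {A : Type} (x y : Config A) (m : ℕ) : Prop := ∀ i : ℤ, |i| ≤ m → x i = y i

/-- Combinatorial form of equicontinuity of the point `x` along `h`. -/
def EquicontinuousAt {A : Type} (F : Config A → Config A) (h : ℕ → ℤ) (x : Config A) : Prop :=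
  ∀ k : ℕ, ∃ m : ℕ, ∀ y, AgreeOn x y m →
    ∀ (n : ℕ) (i : ℤ), |i| ≤ k → F^[n] x (i + h n) = F^[n] y (i + h n)

/-- Every configuration can be modified far from the origin so that the cell on the curve
`h` is different at some time. -/
def UniformlySensitive {A : Type} (F : Config A → Config A) (h : ℕ → ℤ) : Prop :=
  ∀ (x : Config A) (m : ℕ), ∃ y, AgreeOn x y m ∧ ∃ n, F^[n] x (h n) ≠ F^[n] y (h n)

/-- The strict inequality makes the radius inclusive: a first difference at distance `k` from the
origin gives exactly `(1 / 2) ^ k`. -/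
theorem dC_lt_pow_iff {A : Type} (x y : Config A) (k : ℕ) :
    dC x y < (1 / 2 : ℝ) ^ k ↔ AgreeOn x y k := by
  classical
  unfold dC AgreeOn
  split_ifs with h
  · subst h; simp
  · have hne : {k : ℕ | ∃ i : ℤ, i.natAbs = k ∧ x i ≠ y i}.Nonempty := by
      by_contra hc
      apply h
      funext i
      by_contra hi
      exact hc ⟨i.natAbs, i, rfl, hi⟩
    rw [pow_lt_pow_iff_right_of_lt_one₀ (by norm_num) (by norm_num)]
    constructor
    · intro hk i hi
      by_contra hxy
      have := Nat.sInf_le (show i.natAbs ∈ {k : ℕ | ∃ i : ℤ, i.natAbs = k ∧ x i ≠ y i} from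
        ⟨i, rfl, hxy⟩)
      rw [Int.abs_eq_natAbs] at hi
      omega
    · intro hk
      obtain ⟨i, hi, hxy⟩ := Nat.sInf_mem hne
      by_contra hlt
      exact hxy (hk i (by rw [Int.abs_eq_natAbs]; omega))

theorem EquicontinuousAt.mem {A : Type} {F : Config A → Config A} {h : ℕ → ℤ} {x : Config A}
    (hx : EquicontinuousAt F h x) : x ∈ equicontinuousPoints F h := by
  intro ε hε
  obtain ⟨k, hk⟩ := exists_pow_lt_of_lt_one hε (show (1 / 2 : ℝ) < 1 by norm_num)
  obtain ⟨m, hm⟩ := hx k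
  refine ⟨(1 / 2) ^ m, by positivity, fun y hy n => lt_trans ?_ hk⟩
  rw [dC_lt_pow_iff]
  intro i hi
  exact hm y ((dC_lt_pow_iff x y m).1 hy) n i hi

theorem UniformlySensitive.sensitiveAlong {A : Type} {F : Config A → Config A} {h : ℕ → ℤ}
    (hF : UniformlySensitive F h) : SensitiveAlong F h := by
  -- Distance below `1 = (1 / 2) ^ 0` means agreement at the origin, so one difference on the curve
  -- leaves the tube of radius `1`.
  refine ⟨1, one_pos, fun δ hδ x => ?_⟩
  obtain ⟨k, hk⟩ := exists_pow_lt_of_lt_one hδ (show (1 / 2 : ℝ) < 1 by norm_num)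
  obtain ⟨y, hy, n, hn⟩ := hF x k
  refine ⟨y, lt_trans ((dC_lt_pow_iff x y k).2 hy) hk, fun hc => hn ?_⟩
  have := (dC_lt_pow_iff _ _ 0).1 (by simpa using hc n) 0 (by simp)
  simpa [shift] using this

theorem UniformlySensitive.not_nonempty {A : Type} {F : Config A → Config A} {h : ℕ → ℤ}
    (hF : UniformlySensitive F h) : ¬ (equicontinuousPoints F h).Nonempty := by
  rintro ⟨x, hx⟩
  obtain ⟨ε, hε, hs⟩ := hF.sensitiveAlong
  obtain ⟨δ, hδ, hsub⟩ := hx ε hε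
  obtain ⟨y, hy, hy'⟩ := hs δ hδ x
  exact hy' (hsub hy)

/-! ### Products of automata. -/

section product
variable {A B : Type} {F : Config A → Config A} {G : Config B → Config B}

theorem prodMap_iterate (n : ℕ) (z : Config (A × B)) (i : ℤ) :
    (prodMap F G)^[n] z i = (F^[n] (fun j => (z j).1) i, G^[n] (fun j => (z j).2) i) := by
  induction n generalizing z with
  | zero => rfl
  | succ n ih => rw [Function.iterate_succ_apply, ih]; rfl

theorem EquicontinuousAt.prodMap {h : ℕ → ℤ} {x : Config A} {y : Config B}
    (hx : EquicontinuousAt F h x) (hy : EquicontinuousAt G h y) :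
    EquicontinuousAt (prodMap F G) h (fun i => (x i, y i)) := by
  intro k
  obtain ⟨m₁, h₁⟩ := hx k
  obtain ⟨m₂, h₂⟩ := hy k
  refine ⟨max m₁ m₂, fun z hz n i hi => ?_⟩
  rw [prodMap_iterate, prodMap_iterate]
  refine Prod.ext (h₁ _ (fun j hj => ?_) n i hi) (h₂ _ (fun j hj => ?_) n i hi)
  · exact congrArg Prod.fst (hz j (hj.trans (by exact_mod_cast le_max_left _ _)))
  · exact congrArg Prod.snd (hz j (hj.trans (by exact_mod_cast le_max_right _ _)))

theorem UniformlySensitive.prodMap_left {h : ℕ → ℤ} (hF : UniformlySensitive F h) :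
    UniformlySensitive (prodMap F G) h := by
  intro z m
  obtain ⟨y, hy, n, hn⟩ := hF (fun j => (z j).1) m
  refine ⟨fun j => (y j, (z j).2), fun i hi => Prod.ext (hy i hi) rfl, n, fun hc => hn ?_⟩
  rw [prodMap_iterate, prodMap_iterate] at hc
  exact congrArg Prod.fst hc

theorem UniformlySensitive.prodMap_right {h : ℕ → ℤ} (hG : UniformlySensitive G h) :
    UniformlySensitive (prodMap F G) h := by
  intro z m
  obtain ⟨y, hy, n, hn⟩ := hG (fun j => (z j).2) m
  refine ⟨fun j => ((z j).1, y j), fun i hi => Prod.ext rfl (hy i hi), n, fun hc => hn ?_⟩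
  rw [prodMap_iterate, prodMap_iterate] at hc
  exact congrArg Prod.snd hc

end product

/-- A map that commutes with shifts and whose value at `0` depends on finitely many cells is
a cellular automaton. -/
theorem isCellularAutomaton_of_local {A : Type} [Nonempty A] {F : Config A → Config A} (r : ℕ)
    (hF : ∀ (x y : Config A) (m k : ℤ), (∀ i : ℤ, |i| ≤ r → x (m + i) = y (k + i)) →
      F x m = F y k) : IsCellularAutomaton F := by
  classical
  refine ⟨Finset.Icc (-(r : ℤ)) r,
    fun p => F (fun j => if hj : j ∈ Finset.Icc (-(r : ℤ)) r then p ⟨j, hj⟩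
      else Classical.arbitrary A) 0, fun x m => ?_⟩
  apply hF
  intro i hi
  have : i ∈ Finset.Icc (-(r : ℤ)) r := by
    rw [Finset.mem_Icc]; exact abs_le.1 hi
  simp [this]

theorem isCellularAutomaton_prodMap {A B : Type} {F : Config A → Config A}
    {G : Config B → Config B} (hF : IsCellularAutomaton F) (hG : IsCellularAutomaton G) :
    IsCellularAutomaton (prodMap F G) := by
  obtain ⟨U, f, hf⟩ := hF
  obtain ⟨V, g, hg⟩ := hG
  classical
  refine ⟨U ∪ V, fun p => (f fun u => (p ⟨u, Finset.mem_union_left _ u.2⟩).1,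
    g fun v => (p ⟨v, Finset.mem_union_right _ v.2⟩).2), fun x m => ?_⟩
  simp [prodMap, hf, hg]

/-! ### The parabola -/

/-- Solving a quadratic inequality gives the square root. This integer form replaces the real
definition in the later estimates. -/
theorem le_parabola_iff (n k : ℕ) : (k : ℤ) ≤ parabola n ↔ k * (k + 1) ≤ n + 1 := by
  unfold parabola
  rw [Int.le_floor, le_div_iff₀ (by norm_num), le_sub_iff_add_le, Real.le_sqrt' (by positivity)]
  rw [← Nat.cast_le (α := ℝ)]
  push_cast
  constructor <;> intro h <;> nlinarith

theorem parabola_nonneg (n : ℕ) : 0 ≤ parabola n := by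
  exact_mod_cast (le_parabola_iff n 0).2 (by omega)

theorem exists_parabola (n : ℕ) : ∃ k : ℕ, parabola n = k ∧ k * (k + 1) ≤ n + 1 ∧
    n + 1 < (k + 1) * (k + 2) := by
  obtain ⟨k, hk⟩ := Int.eq_ofNat_of_zero_le (parabola_nonneg n)
  refine ⟨k, hk, (le_parabola_iff n k).1 hk.ge, ?_⟩
  by_contra hc
  have := (le_parabola_iff n (k + 1)).2 (by push Not at hc; exact hc)
  push_cast at this
  omega

theorem parabola_le (n : ℕ) : parabola n ≤ n := by
  obtain ⟨k, hk, h1, -⟩ := exists_parabola n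
  rw [hk]
  have : k ≤ n := by
    rcases Nat.eq_zero_or_pos k with h | h
    · omega
    · nlinarith
  exact_mod_cast this

theorem parabola_mono {m n : ℕ} (h : m ≤ n) : parabola m ≤ parabola n := by
  obtain ⟨k, hk, h1, -⟩ := exists_parabola m
  rw [hk]
  exact (le_parabola_iff n k).2 (by omega)

theorem parabola_succ_le (n : ℕ) : parabola (n + 1) ≤ parabola n + 1 := by
  obtain ⟨k, hk, -, h2⟩ := exists_parabola n
  obtain ⟨l, hl, h3, -⟩ := exists_parabola (n + 1)
  rw [hk, hl]
  have : l ≤ k + 1 := by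
    by_contra hc
    push Not at hc
    have : (k + 2) * (k + 3) ≤ l * (l + 1) := by apply Nat.mul_le_mul <;> omega
    nlinarith
  exact_mod_cast this

theorem parabola_mem_curves : parabola ∈ curves := by
  refine ⟨1, one_pos, fun n => ?_⟩
  have h1 := parabola_mono (Nat.le_succ n)
  have h2 := parabola_succ_le n
  rw [Nat.succ_eq_add_one] at h1
  rw [abs_le]; constructor <;> linarith

theorem below_zero_parabola : Below (fun _ => 0) parabola :=
  ⟨1, one_pos, fun n => by have := parabola_nonneg n; simp only; linarith⟩

theorem below_parabola_id : Below parabola (fun n => (n : ℤ)) :=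
  ⟨1, one_pos, fun n => by have := parabola_le n; simp only; linarith⟩

theorem Below.trans {h k l : ℕ → ℤ} (h₁ : Below h k) (h₂ : Below k l) : Below h l := by
  obtain ⟨M, hM, H⟩ := h₁
  obtain ⟨N, hN, K⟩ := h₂
  exact ⟨M + N, by linarith, fun n => by linarith [H n, K n]⟩

theorem equivalent_iff {h k : ℕ → ℤ} : Equivalent h k ↔ Below k h ∧ Below h k := by
  constructor
  · rintro ⟨M, hM, H⟩
    exact ⟨⟨M, hM, fun n => by linarith [(H n).1]⟩, ⟨M, hM, fun n => (H n).2⟩⟩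
  · rintro ⟨⟨M, hM, H⟩, ⟨N, hN, K⟩⟩
    exact ⟨M + N, by linarith, fun n => ⟨by linarith [H n], by linarith [K n]⟩⟩

/-- The parabola is unbounded, unlike a line of slope `α ≤ 0` from above, and a line of positive
slope outgrows a square root. -/
theorem not_equivalent_parabola_linearCurve (α : ℝ) :
    ¬ Equivalent parabola (linearCurve α) := by
  rintro ⟨M, hM, H⟩
  unfold linearCurve at H
  obtain ⟨m, hm⟩ := Int.eq_ofNat_of_zero_le hM.le
  rcases le_or_gt α 0 with hα | hα
  · have h1 := (H ((m + 2) * (m + 3))).2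
    have h2 := (le_parabola_iff ((m + 2) * (m + 3)) (m + 2)).2 (by nlinarith)
    have h3 : ⌊α * (((m + 2) * (m + 3) : ℕ) : ℝ)⌋ ≤ 0 := by
      apply Int.floor_nonpos
      exact mul_nonpos_of_nonpos_of_nonneg hα (by positivity)
    push_cast at h2 h3 h1
    omega
  · obtain ⟨q, hq⟩ := exists_nat_gt (1 / α)
    have hq1 : 1 < α * q := by rw [div_lt_iff₀ hα] at hq; linarith
    -- At the time `n = q (k + m + 1)` the line is at least `k + m + 1`, while the parabola is at
    -- most `k`, because this `k` is large enough for `(k + 1) (k + 2) > n + 1`.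
    set k := q + m + 3 with hk
    set n := q * (k + m + 1) with hn
    have h1 := (H n).1
    have h3 : ((k + m + 1 : ℕ) : ℤ) ≤ ⌊α * (n : ℝ)⌋ := by
      rw [Int.le_floor, hn]
      push_cast
      have : (0 : ℝ) ≤ k + m + 1 := by positivity
      nlinarith
    have h2 := (le_parabola_iff n (k + 1)).not.2 (by rw [hn, hk]; push Not; nlinarith)
    push_cast at h2 h3
    omega

/-! ### The conjunction automaton -/

/-- Each cell takes the conjunction of its own state and that of its left neighbour. -/
def andMap (x : Config Bool) : Config Bool := fun m => x (m - 1) && x m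

theorem isCellularAutomaton_andMap : IsCellularAutomaton andMap := by
  apply isCellularAutomaton_of_local 1
  intro x y m k h
  have h0 := h 0 (by simp)
  have h1 := h (-1) (by simp)
  simp only [add_zero] at h0
  simp only [andMap, sub_eq_add_neg, h0, h1]

theorem andMap_iterate_eq_false {x : Config Bool} {n : ℕ} {i : ℤ} :
    andMap^[n] x i = false ↔ ∃ j : ℤ, i - n ≤ j ∧ j ≤ i ∧ x j = false := by
  induction n generalizing i with
  | zero =>
    simp only [Function.iterate_zero, id, Nat.cast_zero, sub_zero]
    exact ⟨fun h => ⟨i, le_rfl, le_rfl, h⟩, fun ⟨j, h1, h2, h3⟩ => by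
      rwa [show i = j by omega]⟩
  | succ n ih =>
    rw [Function.iterate_succ_apply', andMap, Bool.and_eq_false_iff, ih, ih]
    push_cast
    constructor
    · rintro (⟨j, h1, h2, h3⟩ | ⟨j, h1, h2, h3⟩) <;> exact ⟨j, by omega, by omega, h3⟩
    · rintro ⟨j, h1, h2, h3⟩
      rcases eq_or_ne j i with h | h
      · exact Or.inr ⟨j, by omega, by omega, h3⟩
      · exact Or.inl ⟨j, by omega, by omega, h3⟩

/-- The window that determines the cell always meets a fixed interval around the origin, because `h`
stays in the cone, and a single `false` in it decides the conjunction. -/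
theorem andMap_equicontinuousAt {h : ℕ → ℤ} (h₀ : Below (fun _ => 0) h)
    (h₁ : Below h (fun n => (n : ℤ))) : EquicontinuousAt andMap h (fun _ => false) := by
  obtain ⟨M, hM, H⟩ := h₀
  obtain ⟨N, hN, K⟩ := h₁
  intro k
  refine ⟨(M + N + k).toNat, fun y hy n i hi => ?_⟩
  have a : andMap^[n] (fun _ => false) (i + h n) = false :=
    andMap_iterate_eq_false.2 ⟨i + h n, by omega, le_rfl, rfl⟩
  rw [a, eq_comm, andMap_iterate_eq_false]
  have hn := H n
  have kn := K n
  simp only at hn kn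
  rw [abs_le] at hi
  rcases le_total (i + h n) 0 with hc | hc
  · refine ⟨i + h n, by omega, le_rfl, (hy _ ?_).symm⟩
    rw [abs_le]; constructor <;> omega
  · refine ⟨max 0 (i + h n - n), by omega, by omega, (hy _ ?_).symm⟩
    rw [abs_le]; constructor <;> omega

/-- If `h` leaves the cone, the window avoids `[-m, m]` at some time. Its content is then free:
filling with `false` or with `true` gives different results, and one of them differs from that of
`x`. -/
theorem andMap_uniformlySensitive {h : ℕ → ℤ}
    (hh : ¬ (Below (fun _ => 0) h ∧ Below h (fun n => (n : ℤ)))) :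
    UniformlySensitive andMap h := by
  intro x m
  have key : ∃ n, ∃ y z : Config Bool, AgreeOn x y m ∧ AgreeOn x z m ∧
      andMap^[n] y (h n) ≠ andMap^[n] z (h n) := by
    have : ∃ n : ℕ, h n < -m ∨ m < h n - n := by
      by_contra hc
      push Not at hc
      exact hh ⟨⟨m + 1, by omega, fun n => by have := hc n; simp only; omega⟩,
        ⟨m + 1, by omega, fun n => by have := hc n; simp only; omega⟩⟩
    obtain ⟨n, hn⟩ := this
    refine ⟨n, fun i => if |i| ≤ m then x i else false, fun i => if |i| ≤ m then x i else true,
      fun i hi => by simp [hi], fun i hi => by simp [hi], ?_⟩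
    have hn' : ∀ j, h n - n ≤ j → j ≤ h n → ¬ |j| ≤ m := by
      intro j h1 h2 h3
      rw [abs_le] at h3
      omega
    rw [andMap_iterate_eq_false.2 ⟨h n, by omega, le_rfl, if_neg (hn' _ (by omega) le_rfl)⟩]
    intro hc
    obtain ⟨j, h1, h2, h3⟩ := andMap_iterate_eq_false.1 hc.symm
    simp [hn' j h1 h2] at h3
  obtain ⟨n, y, z, hy, hz, hne⟩ := key
  by_cases hc : andMap^[n] x (h n) = andMap^[n] y (h n)
  · exact ⟨z, hz, n, by rwa [hc]⟩
  · exact ⟨y, hy, n, hc⟩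


/-! ### Counters

A counter of width `V ≥ 2` is in one of the phases `0 ≤ φ ≤ 2 V - 3`; after the last phase the
width grows by one. -/

/-- `(V, φ)` is the state of a counter. -/
def IsPhase (V φ : ℤ) : Prop := 2 ≤ V ∧ 0 ≤ φ ∧ φ ≤ 2 * V - 3

/-- The number of steps from the state `(2, 0)` to the state `(V, φ)`. -/
def age (V φ : ℤ) : ℤ := (V - 1) * (V - 2) + φ

/-- The width after one step. -/
def nextV (V φ : ℤ) : ℤ := if φ = 2 * V - 3 then V + 1 else V

/-- The phase after one step. -/
def nextφ (V φ : ℤ) : ℤ := if φ = 2 * V - 3 then 0 else φ + 1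

/-- The position of the signal in a counter. -/
def sig (V φ : ℤ) : ℤ := if φ + 2 ≤ V then φ + 1 else 2 * V - 2 - φ

theorem IsPhase.next {V φ : ℤ} (h : IsPhase V φ) : IsPhase (nextV V φ) (nextφ V φ) := by
  obtain ⟨h1, h2, h3⟩ := h
  unfold nextV nextφ IsPhase
  split_ifs <;> omega

/-- The width `V` lasts `2 V - 2` steps, and `(V - 1) (V - 2)` is the sum of these durations over
the smaller widths. -/
theorem age_next (V φ : ℤ) : age (nextV V φ) (nextφ V φ) = age V φ + 1 := by
  unfold age nextV nextφ
  split_ifs with h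
  · rw [h]; ring
  · ring

theorem IsPhase.age_nonneg {V φ : ℤ} (h : IsPhase V φ) : 0 ≤ age V φ := by
  obtain ⟨h1, h2, h3⟩ := h
  unfold age
  nlinarith

/-- Ages order the states lexicographically. -/
theorem IsPhase.le_of_age_le {V φ W ψ : ℤ} (h : IsPhase V φ) (h' : IsPhase W ψ)
    (hle : age V φ ≤ age W ψ) : V < W ∨ V = W ∧ φ ≤ ψ := by
  obtain ⟨h1, h2, h3⟩ := h
  obtain ⟨k1, k2, k3⟩ := h'
  unfold age at hle
  rcases lt_trichotomy V W with h | h | h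
  · exact Or.inl h
  · subst h; exact Or.inr ⟨rfl, by linarith⟩
  · exfalso
    have : W + 1 ≤ V := h
    nlinarith

theorem IsPhase.eq_of_age_eq {V φ W ψ : ℤ} (h : IsPhase V φ) (h' : IsPhase W ψ)
    (he : age V φ = age W ψ) : V = W ∧ φ = ψ := by
  have h1 := h.le_of_age_le h' he.le
  have h2 := h'.le_of_age_le h he.ge
  omega

/-- The width of a counter of age `n`. -/
def canonV : ℕ → ℤ × ℤ
  | 0 => (2, 0)
  | n + 1 => (nextV (canonV n).1 (canonV n).2, nextφ (canonV n).1 (canonV n).2)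

/-- The width of the counter of age `n`. -/
def cV (n : ℕ) : ℤ := (canonV n).1

/-- The phase of the counter of age `n`. -/
def cφ (n : ℕ) : ℤ := (canonV n).2

theorem cV_zero : cV 0 = 2 := rfl
theorem cφ_zero : cφ 0 = 0 := rfl
theorem cV_succ (n : ℕ) : cV (n + 1) = nextV (cV n) (cφ n) := rfl
theorem cφ_succ (n : ℕ) : cφ (n + 1) = nextφ (cV n) (cφ n) := rfl

theorem isPhase_canon (n : ℕ) : IsPhase (cV n) (cφ n) := by
  induction n with
  | zero => rw [cV_zero, cφ_zero]; unfold IsPhase; omega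
  | succ n ih => rw [cV_succ, cφ_succ]; exact ih.next

theorem age_canon (n : ℕ) : age (cV n) (cφ n) = n := by
  induction n with
  | zero => rw [cV_zero, cφ_zero]; rfl
  | succ n ih => rw [cV_succ, cφ_succ, age_next, ih]; push_cast; rfl

/-- The width grows like the parabola. -/
theorem parabola_le_cV (n : ℕ) : parabola n ≤ cV n := by
  obtain ⟨k, hk, h1, -⟩ := exists_parabola n
  have h2 := isPhase_canon n
  have h3 := age_canon n
  obtain ⟨a, b, c⟩ := h2
  unfold age at h3
  rw [hk]
  by_contra hc
  have h4 : cV n + 1 ≤ k := by omega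
  have h5 : ((k * (k + 1) : ℕ) : ℤ) ≤ ((n + 1 : ℕ) : ℤ) := by exact_mod_cast h1
  push_cast at h5
  nlinarith

/-- The growth of the width of a counter is bounded by the parabola. -/
theorem IsPhase.growth {V φ V₀ φ₀ : ℤ} {n : ℕ} (h : IsPhase V φ) (h₀ : IsPhase V₀ φ₀)
    (ha : age V φ = age V₀ φ₀ + n) : V - V₀ ≤ parabola n + 2 := by
  obtain ⟨k, hk, -, h1⟩ := exists_parabola n
  have h5 : ((n + 1 : ℕ) : ℤ) < (((k + 1) * (k + 2) : ℕ) : ℤ) := by exact_mod_cast h1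
  obtain ⟨a, b, c⟩ := h
  obtain ⟨a₀, b₀, c₀⟩ := h₀
  unfold age at ha
  push_cast at h5
  rw [hk]
  by_contra hc
  have h6 : V₀ + k + 3 ≤ V := by omega
  nlinarith

/-! ### Guards -/

/-- The states of the guard layer: blank, end, a cell left of the signal, signal to the right,
signal to the left, a cell right of the signal, root. -/
inductive Guard | n | e | a | r | l | b | g
  deriving DecidableEq

instance : Finite Guard :=
  Finite.of_injective (fun x : Guard => (x.ctorIdx : ℕ) |> fun k => (Fin.ofNat 7 k)) (by
    intro x y h; cases x <;> cases y <;> first | rfl | (revert h; decide))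

open Guard in
/-- The rule for a cell of a guard, in terms of its left neighbour, its state and its right
neighbour. -/
def guardLocal : Guard → Guard → Guard → Guard
  | _, e, l => r
  | _, e, a => e
  | _, e, r => e
  | _, a, l => l
  | _, a, a => a
  | _, a, r => a
  | _, r, g => l
  | _, r, b => a
  | _, l, b => b
  | _, l, g => b
  | r, b, b => r
  | r, b, g => r
  | _, b, b => b
  | _, b, g => b
  | _, g, _ => g
  | _, _, _ => n

/-- The end of a guard moves to the cell `i`. -/
def Landing (Y : ℤ → Guard) (i : ℤ) : Prop := Y (i + 1) = .e ∧ Y (i + 2) = .l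

open Classical in
/-- The rule of the guard layer. -/
noncomputable def guardRule (Y : ℤ → Guard) (i : ℤ) : Guard :=
  if Landing Y i then .e else guardLocal (Y (i - 1)) (Y i) (Y (i + 1))

/-- The right neighbours with which a cell of a guard survives. -/
def Guard.Accepts (c d : Guard) : Prop := ∀ x, guardLocal x c d ≠ .n

/-- The shape of the guard in the state `(V, φ)`; the offset `j` is counted from the end. -/
def gpat (V φ j : ℤ) : Guard :=
  if j = 0 then .e else if j = V then .g else if j < sig V φ then .a else
  if j = sig V φ then (if φ + 2 ≤ V then .r else .l) else .b

theorem gpat_zero (V φ : ℤ) : gpat V φ 0 = .e := if_pos rfl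

theorem gpat_root {V φ : ℤ} (h : 2 ≤ V) : gpat V φ V = .g := by
  rw [gpat, if_neg (by omega), if_pos rfl]

theorem gpat_a {V φ j : ℤ} (h : IsPhase V φ) (h0 : 0 < j) (hj : j < sig V φ) :
    gpat V φ j = .a := by
  obtain ⟨h1, h2, h3⟩ := h
  rw [gpat, if_neg (by omega), if_neg (by unfold sig at hj; split_ifs at hj <;> omega), if_pos hj]

theorem gpat_r {V φ j : ℤ} (h : IsPhase V φ) (hφ : φ + 2 ≤ V) (hj : j = φ + 1) :
    gpat V φ j = .r := by
  obtain ⟨h1, h2, h3⟩ := h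
  rw [gpat, sig, if_pos hφ, if_neg (by omega), if_neg (by omega), if_neg (by omega), if_pos hj,
    if_pos hφ]

theorem gpat_l {V φ j : ℤ} (h : IsPhase V φ) (hφ : V < φ + 2) (hj : j = 2 * V - 2 - φ) :
    gpat V φ j = .l := by
  obtain ⟨h1, h2, h3⟩ := h
  have e : sig V φ = 2 * V - 2 - φ := if_neg (by omega)
  rw [gpat, e, if_neg (by omega), if_neg (by omega), if_neg (by omega), if_pos hj,
    if_neg (by omega)]

theorem gpat_b {V φ j : ℤ} (h : IsPhase V φ) (h0 : sig V φ < j) (hj : j < V) :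
    gpat V φ j = .b := by
  obtain ⟨h1, h2, h3⟩ := h
  have : 0 < j := by unfold sig at h0; split_ifs at h0 <;> omega
  rw [gpat, if_neg (by omega), if_neg (by omega), if_neg (by omega), if_neg (by omega)]

theorem sig_of_le {V φ : ℤ} (h : φ + 2 ≤ V) : sig V φ = φ + 1 := if_pos h

theorem sig_of_lt {V φ : ℤ} (h : V < φ + 2) : sig V φ = 2 * V - 2 - φ := if_neg (by omega)

theorem IsPhase.sig_pos {V φ : ℤ} (h : IsPhase V φ) : 0 < sig V φ := by
  obtain ⟨h1, h2, h3⟩ := h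
  unfold sig; split_ifs <;> omega

theorem IsPhase.sig_lt {V φ : ℤ} (h : IsPhase V φ) : sig V φ < V := by
  obtain ⟨h1, h2, h3⟩ := h
  unfold sig; split_ifs <;> omega

theorem next_of_lt {V φ : ℤ} (h : φ < 2 * V - 3) : nextV V φ = V ∧ nextφ V φ = φ + 1 :=
  ⟨if_neg (by omega), if_neg (by omega)⟩

theorem next_of_eq {V φ : ℤ} (h : φ = 2 * V - 3) : nextV V φ = V + 1 ∧ nextφ V φ = 0 :=
  ⟨if_pos h, if_pos h⟩

/-- The offset is shifted by the growth of the width because the root stays while the end moves. The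
left neighbour `x` is prescribed only for `0 < j`, since an end does not look at what lies in front
of it. -/
theorem gpat_step {V φ j : ℤ} (h : IsPhase V φ) (h0 : 0 ≤ j) (hV : j < V) (x : Guard)
    (hx : 0 < j → x = gpat V φ (j - 1)) :
    guardLocal x (gpat V φ j) (gpat V φ (j + 1)) =
      gpat (nextV V φ) (nextφ V φ) (j + (nextV V φ - V)) := by
  have hn := h.next
  have hs := h.sig_pos
  have hs' := h.sig_lt
  obtain ⟨h1, h2, h3⟩ := id h
  have hroot := gpat_root (φ := φ) h1
  have hz := gpat_zero V φ
  rcases lt_or_ge φ (2 * V - 3) with h4 | h4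
  · obtain ⟨e1, e2⟩ := next_of_lt h4
    rw [e1, e2] at hn ⊢
    rw [sub_self, add_zero]
    rcases h0.eq_or_lt with rfl | h0
    · rw [hz, gpat_zero]
      rcases eq_or_ne (sig V φ) 1 with h5 | h5
      · rw [gpat_r h (by unfold sig at h5; split_ifs at h5 <;> omega)
          (by unfold sig at h5; split_ifs at h5 <;> omega)]; rfl
      · rw [gpat_a h (by omega) (by omega)]; rfl
    · rw [hx h0]
      -- The signal moves right while `φ + 2 ≤ V`, turns at the cell before the root, and then moves
      -- left.
      rcases le_or_gt (φ + 2) V with h5 | h5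
      · have e := sig_of_le h5
        rcases lt_trichotomy j (φ + 1) with h6 | h6 | h6
        · rw [gpat_a h h0 (by omega), gpat_a (j := j) hn (by omega)
            (by unfold sig; split_ifs <;> omega)]
          rcases eq_or_ne (j + 1) (φ + 1) with h7 | h7
          · rw [gpat_r h h5 h7]; rfl
          · rw [gpat_a (j := j + 1) h (by omega) (by omega)]; rfl
        · rw [gpat_r h h5 h6]
          rcases eq_or_ne (j + 1) V with h7 | h7
          · rw [h7, hroot, gpat_l hn (by omega) (by omega)]; rfl
          · rw [gpat_b (j := j + 1) h (by omega) (by omega), gpat_a (j := j) hn (by omega)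
              (by unfold sig; split_ifs <;> omega)]; rfl
        · have e7 : gpat V φ (j + 1) = .b ∨ gpat V φ (j + 1) = .g := by
            rcases eq_or_ne (j + 1) V with h7 | h7
            · rw [h7]; exact Or.inr hroot
            · exact Or.inl (gpat_b h (by omega) (by omega))
          rw [gpat_b h (by omega) hV]
          rcases eq_or_ne j (φ + 2) with h8 | h8
          · rw [gpat_r h h5 (by omega), gpat_r (j := j) hn (by omega) (by omega)]
            rcases e7 with e7 | e7 <;> rw [e7] <;> rfl
          · rw [gpat_b h (by omega) (by omega), gpat_b (j := j) hn
              (by unfold sig; split_ifs <;> omega) (by omega)]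
            rcases e7 with e7 | e7 <;> rw [e7] <;> rfl
      · have e := sig_of_lt h5
        have e' := sig_of_lt (V := V) (φ := φ + 1) (by omega)
        have e7 : sig V φ ≤ j → gpat V φ (j + 1) = .b ∨ gpat V φ (j + 1) = .g := by
          intro h6
          rcases eq_or_ne (j + 1) V with h7 | h7
          · rw [h7]; exact Or.inr hroot
          · exact Or.inl (gpat_b h (by omega) (by omega))
        rcases lt_trichotomy j (sig V φ) with h6 | h6 | h6
        · rw [gpat_a h h0 (by omega)]
          rcases eq_or_ne (j + 1) (sig V φ) with h7 | h7
          · rw [gpat_l (j := j + 1) h h5 (by omega), gpat_l (j := j) hn (by omega) (by omega)]; rfl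
          · rw [gpat_a (j := j + 1) h (by omega) (by omega), gpat_a (j := j) hn (by omega) (by omega)]; rfl
        · rw [gpat_l (j := j) h h5 (by omega), gpat_b (j := j) hn (by omega) (by omega)]
          rcases e7 (by omega) with e7 | e7 <;> rw [e7] <;> rfl
        · rw [gpat_b h h6 hV, gpat_b (j := j) hn (by omega) (by omega)]
          rcases eq_or_ne (j - 1) (sig V φ) with h8 | h8
          · rw [gpat_l h h5 (by omega)]
            rcases e7 (by omega) with e7 | e7 <;> rw [e7] <;> rfl
          · rw [gpat_b h (by omega) (by omega)]
            rcases e7 (by omega) with e7 | e7 <;> rw [e7] <;> rfl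
  -- Last phase: the signal is at the offset `1`, the end is about to move, and all offsets grow by
  -- one.
  · have h4 : φ = 2 * V - 3 := by omega
    obtain ⟨e1, e2⟩ := next_of_eq h4
    have e : sig V φ = 1 := by rw [sig_of_lt (by omega)]; omega
    have e' : sig (V + 1) 0 = 1 := by rw [sig_of_le (by omega)]; omega
    rw [e1, e2] at hn ⊢
    rw [add_sub_cancel_left]
    have e7 : 1 ≤ j → gpat V φ (j + 1) = .b ∨ gpat V φ (j + 1) = .g := by
      intro h6
      rcases eq_or_ne (j + 1) V with h7 | h7
      · rw [h7]; exact Or.inr hroot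
      · exact Or.inl (gpat_b h (by omega) (by omega))
    rcases h0.eq_or_lt with rfl | h0
    · rw [hz, gpat_l h (by omega) (by omega), gpat_r hn (by omega) (by omega)]; rfl
    · rw [hx h0, gpat_b (j := j + 1) hn (by omega) (by omega)]
      rcases eq_or_ne j 1 with h6 | h6
      · rw [gpat_l (j := j) h (by omega) (by omega)]
        rcases e7 (by omega) with e7 | e7 <;> rw [e7] <;> rfl
      · rw [gpat_b (j := j) h (by omega) hV]
        rcases eq_or_ne j 2 with h8 | h8
        · rw [gpat_l h (by omega) (by omega)]
          rcases e7 (by omega) with e7 | e7 <;> rw [e7] <;> rfl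
        · rw [gpat_b h (by omega) (by omega)]
          rcases e7 (by omega) with e7 | e7 <;> rw [e7] <;> rfl


/-- The left neighbour decides only what a surviving cell becomes, not whether it survives. Hence
damage to a guard travels towards its end. -/
theorem guardLocal_eq_n_iff (x c d : Guard) : guardLocal x c d = .n ↔ guardLocal .n c d = .n := by
  cases x <;> cases c <;> cases d <;> decide

theorem Guard.accepts_iff (c d : Guard) (x : Guard) : c.Accepts d ↔ guardLocal x c d ≠ .n := by
  refine ⟨fun h => h x, fun h y hy => h ?_⟩
  rw [guardLocal_eq_n_iff] at hy ⊢
  exact hy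

theorem Guard.not_accepts_n {c : Guard} (h : c ≠ .g) : ¬ c.Accepts .n := by
  rw [Guard.accepts_iff c _ .n]; revert h; cases c <;> decide

theorem Guard.not_accepts_e {c : Guard} (h : c ≠ .g) : ¬ c.Accepts .e := by
  rw [Guard.accepts_iff c _ .n]; revert h; cases c <;> decide

theorem Guard.accepts_left {c d : Guard} (h : c = .e ∨ c = .a) :
    c.Accepts d ↔ d = .a ∨ d = .r ∨ d = .l := by
  rw [Guard.accepts_iff c _ .n]
  rcases h with rfl | rfl <;> cases d <;> decide

theorem Guard.accepts_right {c d : Guard} (h : c = .r ∨ c = .l ∨ c = .b) :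
    c.Accepts d ↔ d = .b ∨ d = .g := by
  rw [Guard.accepts_iff c _ .n]
  rcases h with rfl | rfl | rfl <;> cases d <;> decide

theorem gpat_ne_e {V φ j : ℤ} (hj : 0 < j) : gpat V φ j ≠ .e := by
  unfold gpat; rw [if_neg (by omega)]; split_ifs <;> decide

theorem gpat_ne_g {V φ j : ℤ} (hj : j < V) : gpat V φ j ≠ .g := by
  unfold gpat; split_ifs <;> first | omega | decide

theorem gpat_one {V φ : ℤ} (h : IsPhase V φ) :
    (φ = 2 * V - 3 ∧ gpat V φ 1 = .l) ∨
      (φ < 2 * V - 3 ∧ (gpat V φ 1 = .a ∨ gpat V φ 1 = .r)) := by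
  obtain ⟨h1, h2, h3⟩ := id h
  rcases h3.eq_or_lt with h4 | h4
  · exact Or.inl ⟨h4, gpat_l h (by omega) (by omega)⟩
  · refine Or.inr ⟨h4, ?_⟩
    rcases eq_or_ne φ 0 with rfl | h5
    · exact Or.inr (gpat_r h (by omega) rfl)
    · exact Or.inl (gpat_a h one_pos (by unfold sig; split_ifs <;> omega))

/-- An initial segment on which a property holds either has full length or ends at a defect. -/
theorem exists_defect {P Q : ℤ → Prop} {m : ℤ} (hm : 0 ≤ m) (h0 : P 0)
    (h : ∀ k, 0 ≤ k → k ≤ m → P k ∨ Q k) :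
    ∃ e, 0 ≤ e ∧ e ≤ m ∧ (∀ k, 0 ≤ k → k ≤ e → P k) ∧ (e = m ∨ Q (e + 1)) := by
  induction m, hm using Int.leInduction with
  | base => exact ⟨0, le_rfl, le_rfl, fun k h1 h2 => by rwa [le_antisymm h2 h1], Or.inl rfl⟩
  | succ m hm ih =>
    obtain ⟨e, h1, h2, h3, h4⟩ := ih fun k hk hk' => h k hk (by omega)
    rcases h4 with rfl | h4
    · rcases h (e + 1) (by omega) le_rfl with h5 | h5
      · refine ⟨e + 1, by omega, le_rfl, fun k hk hk' => ?_, Or.inl rfl⟩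
        rcases hk'.eq_or_lt with rfl | hk'
        · exact h5
        · exact h3 k hk (by omega)
      · exact ⟨e, h1, by omega, h3, Or.inr h5⟩
    · exact ⟨e, h1, by omega, h3, Or.inr h4⟩

/-- The cells of `Y` from `u` to `u + e` look like a guard in the state `(V, φ)`; the guard is
complete, or the cell after that is a defect, or at least `K` cells are known. -/
structure GuardAt (Y : ℤ → Guard) (u V φ e K : ℤ) : Prop where
  phase : IsPhase V φ
  nonneg : 0 ≤ e
  le : e ≤ V
  pat : ∀ j, 0 ≤ j → j ≤ e → Y (u + j) = gpat V φ j
  brk : e = V ∨ ¬ (Y (u + e)).Accepts (Y (u + e + 1)) ∨ K ≤ e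

/-- No cell after the first looks like an end, so no landing interferes inside the known part. -/
theorem guardRule_of_pat {Y : ℤ → Guard} {u V φ e j : ℤ} (h : IsPhase V φ) (he : e ≤ V)
    (hp : ∀ j, 0 ≤ j → j ≤ e → Y (u + j) = gpat V φ j) (h0 : 0 ≤ j) (hj : j < e) :
    guardRule Y (u + j) = gpat (nextV V φ) (nextφ V φ) (j + (nextV V φ - V)) := by
  have e1 : Y (u + j + 1) = gpat V φ (j + 1) := by rw [add_assoc, hp _ (by omega) (by omega)]
  rw [guardRule, if_neg, e1, hp j h0 hj.le]
  · apply gpat_step h h0 (by omega)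
    intro hj0
    rw [add_sub_assoc, hp _ (by omega) (by omega)]
  · rintro ⟨h1, -⟩
    rw [e1] at h1
    exact gpat_ne_e (by omega) h1

theorem guardRule_eq_e {Y : ℤ → Guard} {u : ℤ} (h : guardRule Y u = .e) :
    Landing Y u ∨ (¬ Landing Y u ∧ Y u = .e ∧ (Y (u + 1) = .a ∨ Y (u + 1) = .r)) := by
  unfold guardRule at h
  split_ifs at h with h1
  · exact Or.inl h1
  · refine Or.inr ⟨h1, ?_⟩
    revert h
    generalize Y (u - 1) = x
    cases x <;> cases Y u <;> cases Y (u + 1) <;> decide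

theorem guardRule_of_not_accepts {Y : ℤ → Guard} {u : ℤ} (h : ¬ (Y u).Accepts (Y (u + 1))) :
    guardRule Y u = .n ∨ guardRule Y u = .e := by
  unfold guardRule
  split_ifs
  · exact Or.inr rfl
  · rw [Guard.accepts_iff _ _ (Y (u - 1)), not_not] at h
    exact Or.inl h

theorem guardRule_of_g {Y : ℤ → Guard} {u : ℤ} (h : Y u = .g) :
    guardRule Y u = .g ∨ guardRule Y u = .e := by
  unfold guardRule
  split_ifs
  · exact Or.inr rfl
  · rw [h]; left; cases Y (u - 1) <;> cases Y (u + 1) <;> rfl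

/-- The end of a guard after one step comes from an end before this step, and the guard has
evolved like a counter. -/
theorem GuardAt.step {Y Y' : ℤ → Guard} (hY : ∀ i, Y' i = guardRule Y i ∨ Y' i = .n)
    {K u : ℤ} (hK : 1 ≤ K) (hu : Y' u = .e) :
    ∃ v, Y v = .e ∧ ((v = u ∧ ¬ Landing Y u ∧ (Y (u + 1) = .a ∨ Y (u + 1) = .r)) ∨
      (v = u + 1 ∧ Landing Y u)) ∧ ∀ V φ e, GuardAt Y v V φ e K →
      u + nextV V φ = v + V ∧ ∃ e', GuardAt Y' u (nextV V φ) (nextφ V φ) e' (K - 1) := by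
  have hr : guardRule Y u = .e := by
    rcases hY u with h | h
    · rw [← h, hu]
    · rw [hu] at h; cases h
  have main : ∀ v V φ e, GuardAt Y v V φ e K → 1 ≤ e → u + nextV V φ = v + V →
      ∃ e', GuardAt Y' u (nextV V φ) (nextφ V φ) e' (K - 1) := by
    intro v V φ e h he hv
    obtain ⟨h1, h2, h3⟩ := id h.phase
    -- `s` is `1` if the end moves and `0` otherwise.
    set s := nextV V φ - V with hs
    have hs01 : s = 0 ∨ s = 1 := by unfold nextV at hs; split_ifs at hs <;> omega
    have bad : ∀ k, k < nextV V φ → (Y' (u + k) = gpat (nextV V φ) (nextφ V φ) k) →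
        (Y' (u + (k + 1)) = .n ∨ Y' (u + (k + 1)) = .e) →
        ¬ (Y' (u + k)).Accepts (Y' (u + k + 1)) := by
      intro k hk hk1 hk2
      rw [hk1, add_assoc]
      rcases hk2 with hk2 | hk2 <;> rw [hk2]
      · exact Guard.not_accepts_n (gpat_ne_g hk)
      · exact Guard.not_accepts_e (gpat_ne_g hk)
    have inside : ∀ k, s ≤ k → k - s < e → Y' (u + k) = gpat (nextV V φ) (nextφ V φ) k ∨
        (Y' (u + k) = .n ∨ Y' (u + k) = .e) := by
      intro k hk hk'
      rcases hY (u + k) with h5 | h5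
      · left
        rw [h5, show u + k = v + (k - s) by omega,
          guardRule_of_pat h.phase h.le h.pat (by omega) hk', ← hs, sub_add_cancel]
      · exact Or.inr (Or.inl h5)
    have h0 : Y' (u + 0) = gpat (nextV V φ) (nextφ V φ) 0 := by
      rw [add_zero, hu, gpat_zero]
    have hlt : ∀ k, 0 ≤ k → k < s → k = 0 := by omega
    rcases h.le.eq_or_lt with heV | heV
    · obtain ⟨e', a1, a2, a3, a4⟩ := exists_defect
        (P := fun k => Y' (u + k) = gpat (nextV V φ) (nextφ V φ) k)
        (Q := fun k => Y' (u + k) = .n ∨ Y' (u + k) = .e) (m := nextV V φ) (by omega) h0 (by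
          intro k hk hk'
          rcases lt_or_ge k s with h5 | h5
          · rw [hlt k hk h5]; exact Or.inl h0
          rcases hk'.eq_or_lt with rfl | hk'
          · rcases hY (u + nextV V φ) with h6 | h6
            · rcases guardRule_of_g (Y := Y) (u := u + nextV V φ)
                (by rw [hv, h.pat V (by omega) (by omega), gpat_root h1]) with h7 | h7
              · left; rw [h6, h7, gpat_root (by omega)]
              · right; right; rw [h6, h7]
            · right; left; exact h6
          · exact inside k h5 (by omega))
      refine ⟨e', h.phase.next, a1, a2, a3, ?_⟩
      rcases a4 with a4 | a4
      · exact Or.inl a4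
      · rcases a2.eq_or_lt with a2 | a2
        · exact Or.inl a2
        · exact Or.inr (Or.inl (bad e' a2 (a3 e' a1 le_rfl) a4))
    -- An incomplete guard: the last known cell dies if a defect follows it, and is given up
    -- otherwise. One cell is lost on this side and `s` are gained at the end.
    · obtain ⟨e', a1, a2, a3, a4⟩ := exists_defect
        (P := fun k => Y' (u + k) = gpat (nextV V φ) (nextφ V φ) k)
        (Q := fun k => Y' (u + k) = .n ∨ Y' (u + k) = .e) (m := e - 1 + s) (by omega) h0 (by
          intro k hk hk'
          rcases lt_or_ge k s with h5 | h5
          · rw [hlt k hk h5]; exact Or.inl h0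
          · exact inside k h5 (by omega))
      refine ⟨e', h.phase.next, a1, by omega, a3, ?_⟩
      right
      rcases a4 with a4 | a4
      · rcases h.brk with h5 | h5 | h5
        · omega
        · left
          apply bad e' (by omega) (a3 e' a1 le_rfl)
          have e6 : u + (e' + 1) = v + e := by omega
          rw [e6]
          rcases hY (v + e) with h6 | h6
          · rw [h6]; exact guardRule_of_not_accepts h5
          · exact Or.inl h6
        · right; omega
      · exact Or.inl (bad e' (by omega) (a3 e' a1 le_rfl) a4)
  have one : ∀ v V φ e, GuardAt Y v V φ e K → (Y v).Accepts (Y (v + 1)) →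
      1 ≤ e ∧ Y (v + 1) = gpat V φ 1 := by
    intro v V φ e h hacc
    have he : 1 ≤ e := by
      by_contra hc
      have h0 : e = 0 := by have := h.nonneg; omega
      rcases h.brk with h5 | h5 | h5
      · have := h.phase.1; omega
      · rw [h0, add_zero] at h5; exact h5 hacc
      · omega
    exact ⟨he, h.pat 1 (by omega) he⟩
  rcases guardRule_eq_e hr with hL | ⟨hL, h1, h2⟩
  · refine ⟨u + 1, hL.1, Or.inr ⟨rfl, hL⟩, fun V φ e h => ?_⟩
    have hl : Y (u + 1 + 1) = .l := by rw [add_assoc]; exact hL.2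
    obtain ⟨he, h3⟩ := one _ _ _ _ h (by
      rw [Guard.accepts_left (Or.inl hL.1)]; exact Or.inr (Or.inr hl))
    have h4 : u + nextV V φ = u + 1 + V := by
      rcases gpat_one h.phase with ⟨h5, -⟩ | ⟨-, h5 | h5⟩
      · rw [(next_of_eq h5).1]; ring
      · rw [hl, h5] at h3; cases h3
      · rw [hl, h5] at h3; cases h3
    exact ⟨h4, main _ _ _ _ h he h4⟩
  · refine ⟨u, h1, Or.inl ⟨rfl, hL, h2⟩, fun V φ e h => ?_⟩
    obtain ⟨he, h3⟩ := one _ _ _ _ h (by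
      rw [Guard.accepts_left (Or.inl h1)]; tauto)
    have h4 : u + nextV V φ = u + V := by
      rcases gpat_one h.phase with ⟨-, h5⟩ | ⟨h5, -⟩
      · rw [h3, h5] at h2; rcases h2 with h2 | h2 <;> cases h2
      · rw [(next_of_lt h5).1]
    exact ⟨h4, main _ _ _ _ h he h4⟩


/-- Reading a guard from its end. -/
theorem guard_walk (Y : ℤ → Guard) (u : ℤ) (hu : Y u = .e) (k : ℤ) (hk : 0 ≤ k) :
    ∃ e, 0 ≤ e ∧ e ≤ k ∧
      ((((∀ j, 0 < j → j ≤ e → Y (u + j) = .a) ∨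
        ∃ d, 0 < d ∧ d ≤ e ∧ (∀ j, 0 < j → j < d → Y (u + j) = .a) ∧
          (Y (u + d) = .r ∨ Y (u + d) = .l) ∧ ∀ j, d < j → j ≤ e → Y (u + j) = .b) ∧
        (e = k ∨ ¬ (Y (u + e)).Accepts (Y (u + e + 1)))) ∨
      ∃ d, 0 < d ∧ d < e ∧ (∀ j, 0 < j → j < d → Y (u + j) = .a) ∧
          (Y (u + d) = .r ∨ Y (u + d) = .l) ∧ (∀ j, d < j → j < e → Y (u + j) = .b) ∧
          Y (u + e) = .g) := by
  induction k, hk using Int.leInduction with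
  | base => exact ⟨0, le_rfl, le_rfl, Or.inl ⟨Or.inl fun j h1 h2 => by omega, Or.inl rfl⟩⟩
  | succ k hk ih =>
    obtain ⟨e, h0, he, h⟩ := ih
    rcases h with ⟨h1, h2⟩ | h1
    swap
    · exact ⟨e, h0, by omega, Or.inr h1⟩
    by_cases hacc : (Y (u + e)).Accepts (Y (u + e + 1))
    swap
    · exact ⟨e, h0, by omega, Or.inl ⟨h1, Or.inr hacc⟩⟩
    rcases h2 with rfl | h2
    swap
    · exact absurd hacc h2
    rw [add_assoc] at hacc
    refine ⟨e + 1, by omega, le_rfl, ?_⟩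
    rcases h1 with h1 | ⟨d, hd, hd', h1, h2, h3⟩
    · have hl : Y (u + e) = .e ∨ Y (u + e) = .a := by
        rcases h0.eq_or_lt with rfl | h0
        · rw [add_zero]; exact Or.inl hu
        · exact Or.inr (h1 e h0 le_rfl)
      left
      refine ⟨?_, Or.inl rfl⟩
      rw [Guard.accepts_left hl] at hacc
      rcases hacc with h4 | h4
      · left
        intro j hj hj'
        rcases hj'.eq_or_lt with rfl | hj'
        · exact h4
        · exact h1 j hj (by omega)
      · exact Or.inr ⟨e + 1, by omega, le_rfl, fun j h5 h6 => h1 j h5 (by omega), h4,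
          fun j h5 h6 => by omega⟩
    · have hl : Y (u + e) = .r ∨ Y (u + e) = .l ∨ Y (u + e) = .b := by
        rcases hd'.eq_or_lt with rfl | hd'
        · tauto
        · exact Or.inr (Or.inr (h3 e hd' le_rfl))
      rw [Guard.accepts_right hl] at hacc
      rcases hacc with h4 | h4
      · left
        refine ⟨Or.inr ⟨d, hd, by omega, h1, h2, fun j h5 h6 => ?_⟩, Or.inl rfl⟩
        rcases h6.eq_or_lt with rfl | h6
        · exact h4
        · exact h3 j h5 (by omega)
      · right
        exact ⟨d, hd, by omega, h1, h2, fun j h5 h6 => h3 j h5 (by omega), h4⟩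

/-- Every end belongs to a guard; either the guard is complete, or its alleged root lies two
cells after the known ones and its age is positive. -/
theorem exists_guardAt (Y : ℤ → Guard) (u : ℤ) (hu : Y u = .e) (K : ℤ) (hK : 0 ≤ K) :
    ∃ V φ e, GuardAt Y u V φ e K ∧
      (e = V ∨ V = e + 2 ∧ 1 ≤ age V φ ∧ Y (u + e) ≠ .g ∧
        (¬ (Y (u + e)).Accepts (Y (u + e + 1)) ∨ Y (u + e + 1) ≠ .g)) := by
  obtain ⟨e, h0, he, h⟩ := guard_walk Y u hu (K + 1) (by omega)
  rcases h with ⟨h1, h2⟩ | ⟨d, hd, hd', h1, h2, h3, h4⟩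
  · -- the guard is not complete
    have key : ∀ e, 0 ≤ e → ((∀ j, 0 < j → j ≤ e → Y (u + j) = .a) ∨
        ∃ d, 0 < d ∧ d ≤ e ∧ (∀ j, 0 < j → j < d → Y (u + j) = .a) ∧
          (Y (u + d) = .r ∨ Y (u + d) = .l) ∧ ∀ j, d < j → j ≤ e → Y (u + j) = .b) →
        ∃ φ, IsPhase (e + 2) φ ∧ 1 ≤ age (e + 2) φ ∧ Y (u + e) ≠ .g ∧
          ∀ j, 0 ≤ j → j ≤ e → Y (u + j) = gpat (e + 2) φ j := by
      intro e h0 h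
      rcases h with h | ⟨d, hd, hd', h1, h2, h3⟩
      -- No signal has been read; it is placed at the offset `e + 1`, just beyond the known cells.
      -- The width `e + 2` leaves room for it and makes the age positive even for `e = 0`.
      · have hp : IsPhase (e + 2) (e + 1) := by unfold IsPhase; omega
        refine ⟨e + 1, hp, by unfold age; nlinarith, ?_, fun j hj hj' => ?_⟩
        · rcases h0.eq_or_lt with rfl | h0
          · rw [add_zero, hu]; decide
          · rw [h e h0 le_rfl]; decide
        · rcases hj.eq_or_lt with rfl | hj
          · rw [add_zero, hu, gpat_zero]
          · rw [h j hj hj', gpat_a hp hj (by rw [sig_of_lt (by omega)]; omega)]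
      · have hg : Y (u + e) ≠ .g := by
          rcases hd'.eq_or_lt with rfl | hd'
          · rcases h2 with h2 | h2 <;> rw [h2] <;> decide
          · rw [h3 e hd' le_rfl]; decide
        rcases h2 with h2 | h2
        · have hp : IsPhase (e + 2) (d - 1) := by unfold IsPhase; omega
          have hs := sig_of_le (V := e + 2) (φ := d - 1) (by omega)
          refine ⟨d - 1, hp, by unfold age; nlinarith, hg, fun j hj hj' => ?_⟩
          rcases hj.eq_or_lt with rfl | hj
          · rw [add_zero, hu, gpat_zero]
          rcases lt_trichotomy j d with h5 | rfl | h5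
          · rw [h1 j hj h5, gpat_a hp hj (by omega)]
          · rw [h2, gpat_r hp (by omega) (by omega)]
          · rw [h3 j h5 hj', gpat_b hp (by omega) (by omega)]
        · have hp : IsPhase (e + 2) (2 * e + 2 - d) := by unfold IsPhase; omega
          have hs := sig_of_lt (V := e + 2) (φ := 2 * e + 2 - d) (by omega)
          refine ⟨2 * e + 2 - d, hp, by unfold age; nlinarith, hg, fun j hj hj' => ?_⟩
          rcases hj.eq_or_lt with rfl | hj
          · rw [add_zero, hu, gpat_zero]
          rcases lt_trichotomy j d with h5 | rfl | h5
          · rw [h1 j hj h5, gpat_a hp hj (by omega)]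
          · rw [h2, gpat_l hp (by omega) (by omega)]
          · rw [h3 j h5 hj', gpat_b hp (by omega) (by omega)]
    rcases lt_or_ge K e with h5 | h5
    -- The guard was read up to `K + 1`. Cutting back to `K` leaves one more known cell, which is
    -- not a root.
    · obtain ⟨φ, k1, k2, k3, k4⟩ := key K hK (by
        rcases h1 with h1 | ⟨d, hd, hd', h1, h2, h3⟩
        · exact Or.inl fun j hj hj' => h1 j hj (by omega)
        · rcases lt_or_ge K d with h6 | h6
          · exact Or.inl fun j hj hj' => h1 j hj (by omega)
          · exact Or.inr ⟨d, hd, h6, h1, h2, fun j hj hj' => h3 j hj (by omega)⟩)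
      refine ⟨K + 2, φ, K, ⟨k1, hK, by omega, k4, Or.inr (Or.inr le_rfl)⟩,
        Or.inr ⟨rfl, k2, k3, Or.inr ?_⟩⟩
      rw [show e = K + 1 by omega] at h1
      rw [add_assoc]
      rcases h1 with h1 | ⟨d, hd, hd', h1, h2, h3⟩
      · rw [h1 _ (by omega) le_rfl]; decide
      · rcases hd'.eq_or_lt with rfl | hd'
        · rcases h2 with h2 | h2 <;> rw [h2] <;> decide
        · rw [h3 _ hd' le_rfl]; decide
    · obtain ⟨φ, k1, k2, k3, k4⟩ := key e h0 h1
      have h2 : ¬ (Y (u + e)).Accepts (Y (u + e + 1)) := by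
        rcases h2 with h2 | h2
        · omega
        · exact h2
      exact ⟨e + 2, φ, e, ⟨k1, h0, by omega, k4, Or.inr (Or.inl h2)⟩,
        Or.inr ⟨rfl, k2, k3, Or.inl h2⟩⟩
  · have : ∃ φ, IsPhase e φ ∧ sig e φ = d ∧ gpat e φ d = Y (u + d) := by
      rcases h2 with h2 | h2
      · refine ⟨d - 1, by unfold IsPhase; omega, by rw [sig_of_le (by omega)]; omega, ?_⟩
        rw [h2, gpat_r (by unfold IsPhase; omega) (by omega) (by omega)]
      · refine ⟨2 * e - 2 - d, by unfold IsPhase; omega, by rw [sig_of_lt (by omega)]; omega, ?_⟩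
        rw [h2, gpat_l (by unfold IsPhase; omega) (by omega) (by omega)]
    obtain ⟨φ, hp, hs, hd0⟩ := this
    refine ⟨e, φ, e, ⟨hp, h0, le_rfl, fun j hj hj' => ?_, Or.inl rfl⟩, Or.inl rfl⟩
    rcases hj.eq_or_lt with rfl | hj
    · rw [add_zero, hu, gpat_zero]
    rcases hj'.eq_or_lt with rfl | hj'
    · rw [h4, gpat_root (by omega)]
    rcases lt_trichotomy j d with h5 | rfl | h5
    · rw [h1 j hj h5, gpat_a hp hj (by omega)]
    · exact hd0.symm
    · rw [h3 j h5 hj', gpat_b hp (by omega) (by omega)]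

/-- If no end and no cell left of a signal is directly followed by a root, then an alleged root is
not beyond a root of the configuration. -/
theorem GuardAt.add_le {Y : ℤ → Guard} {u V φ e K : ℤ} (h : GuardAt Y u V φ e K)
    (h' : e = V ∨ V = e + 2 ∧ 1 ≤ age V φ ∧ Y (u + e) ≠ .g ∧
        (¬ (Y (u + e)).Accepts (Y (u + e + 1)) ∨ Y (u + e + 1) ≠ .g))
    (hY : ∀ i, Y (i + 1) = .g → Y i ≠ .e ∧ Y i ≠ .a) {g : ℤ} (hg : Y g = .g) (hu : u < g) :
    u + V ≤ g := by
  have h1 : ∀ j, 0 ≤ j → j ≤ e → j < V → g ≠ u + j := by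
    rintro j h1 h2 h3 rfl
    rw [h.pat j h1 h2] at hg
    exact gpat_ne_g h3 hg
  by_contra hc
  have h2 := h1 (g - u) (by omega)
  rcases h' with h' | ⟨h3, -, h4, h5⟩
  · omega
  · have h6 : g = u + e + 1 := by omega
    rw [h6] at hg
    rcases h5 with h5 | h5
    · obtain ⟨h7, h8⟩ := hY _ hg
      apply h5
      rw [hg]
      have : Y (u + e) ≠ .n := by
        rw [h.pat e h.nonneg le_rfl]
        unfold gpat; split_ifs <;> decide
      rw [Guard.accepts_iff _ _ .n]
      revert h4 h7 h8 this
      cases Y (u + e) <;> decide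
    · exact h5 hg


/-! ### An automaton whose equicontinuous curves lie above the parabola -/

open Classical in
/-- The rule of the guard layer where moreover roots vanish unless followed by a root. -/
noncomputable def pushMap (Y : Config Guard) : Config Guard := fun i =>
  if Y i = .g ∧ Y (i + 1) ≠ .g ∧ ¬ Landing Y i then .n else guardRule Y i

/-- The mirror image of `pushMap`. -/
noncomputable def parMap (x : Config Guard) : Config Guard := fun i => pushMap (fun j => x (-j)) (-i)

theorem guardRule_congr {X Y : ℤ → Guard} {i j : ℤ}
    (h : ∀ k : ℤ, |k| ≤ 2 → X (i + k) = Y (j + k)) :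
    guardRule X i = guardRule Y j ∧ (Landing X i ↔ Landing Y j) := by
  have h0 := h 0 (by norm_num)
  have h1 := h 1 (by norm_num)
  have h2 := h 2 (by norm_num)
  have h3 := h (-1) (by norm_num)
  simp only [add_zero, ← sub_eq_add_neg] at h0 h3
  have hL : Landing X i ↔ Landing Y j := by unfold Landing; rw [h1, h2]
  refine ⟨?_, hL⟩
  unfold guardRule
  rw [h0, h1, h3, propext hL]

theorem isCellularAutomaton_parMap : IsCellularAutomaton parMap := by
  have : Nonempty Guard := ⟨.n⟩
  apply isCellularAutomaton_of_local 2
  intro x y m k h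
  have h' : ∀ q : ℤ, |q| ≤ 2 → (fun j => x (-j)) (-m + q) = (fun j => y (-j)) (-k + q) := by
    intro q hq
    have := h (-q) (by rwa [abs_neg])
    simp only [neg_add, neg_neg]
    exact this
  obtain ⟨h1, h2⟩ := guardRule_congr (X := fun j => x (-j)) (Y := fun j => y (-j)) h'
  have e0 := h' 0 (by norm_num)
  have e1 := h' 1 (by norm_num)
  rw [add_zero, add_zero] at e0
  unfold parMap pushMap
  rw [h1, e0, e1, propext h2]

theorem parMap_iterate (n : ℕ) (x : Config Guard) (i : ℤ) :
    parMap^[n] x i = pushMap^[n] (fun j => x (-j)) (-i) := by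
  induction n generalizing x i with
  | zero => simp
  | succ n ih =>
    rw [Function.iterate_succ_apply, ih, Function.iterate_succ_apply]
    have : (fun j => parMap x (-j)) = pushMap fun j => x (-j) := by
      funext j; simp [parMap]
    rw [this]

theorem pushMap_eq_or (Y : Config Guard) (i : ℤ) :
    pushMap Y i = guardRule Y i ∨ pushMap Y i = .n := by
  unfold pushMap; split_ifs <;> simp

theorem guardLocal_right_n {x c : Guard} (h : c ≠ .g) : guardLocal x c .n = .n := by
  revert h; cases x <;> cases c <;> decide

/-- Letting unsupported roots vanish gives this without exception, so blanks spread to the left at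
speed one. A blank region can lose cells only to ends that land on it. -/
theorem pushMap_of_right {Y : Config Guard} {i : ℤ} (h : Y (i + 1) = .n) :
    pushMap Y i = .n := by
  have hL : ¬ Landing Y i := by rintro ⟨h1, -⟩; rw [h] at h1; cases h1
  unfold pushMap
  split_ifs with h1
  · rfl
  · rw [guardRule, if_neg hL, h]
    apply guardLocal_right_n
    intro h2
    exact h1 ⟨h2, by rw [h]; decide, hL⟩

theorem pushMap_of_n {Y : Config Guard} {i : ℤ} (h : Y i = .n) :
    pushMap Y i = .n ∨ pushMap Y i = .e := by
  rw [pushMap, if_neg (by rw [h]; simp), guardRule, h]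
  split_ifs
  · exact Or.inr rfl
  · left; cases Y (i - 1) <;> cases Y (i + 1) <;> rfl

theorem pushMap_iterate_n {Y : Config Guard} {b : ℤ} (h : ∀ i, b ≤ i → Y i = .n) (n : ℕ) :
    ∀ i, b - n ≤ i → pushMap^[n] Y i = .n := by
  induction n with
  | zero => intro i hi; exact h i (by simpa using hi)
  | succ n ih =>
    intro i hi
    rw [Function.iterate_succ_apply']
    exact pushMap_of_right (ih _ (by push_cast at hi; omega))

theorem gpat_ne_n (V φ j : ℤ) : gpat V φ j ≠ .n := by
  unfold gpat; split_ifs <;> decide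

/-- A complete guard evolves like a counter. -/
theorem pushMap_iterate_guard {Y : Config Guard} {z : ℤ}
    (h : ∀ j, 0 ≤ j → j ≤ 2 → Y (z - 2 + j) = gpat 2 0 j) (hg : ∀ i, z ≤ i → Y i = .g) (n : ℕ) :
    (∀ j, 0 ≤ j → j ≤ cV n → pushMap^[n] Y (z - cV n + j) = gpat (cV n) (cφ n) j) ∧
      ∀ i, z ≤ i → pushMap^[n] Y i = .g := by
  induction n with
  | zero => exact ⟨h, hg⟩
  | succ n ih =>
    obtain ⟨ih1, ih2⟩ := ih
    have hp := isPhase_canon n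
    have hV := hp.1
    set X := pushMap^[n] Y with hX
    rw [Function.iterate_succ_apply', ← hX, cV_succ, cφ_succ]
    have hroot : ∀ i, z ≤ i → pushMap X i = .g := by
      intro i hi
      have hL : ¬ Landing X i := by
        rintro ⟨h1, -⟩
        rw [ih2 _ (by omega)] at h1; cases h1
      rw [pushMap, if_neg (by rw [ih2 (i + 1) (by omega)]; simp), guardRule, if_neg hL, ih2 i hi]
      cases X (i - 1) <;> cases X (i + 1) <;> rfl
    refine ⟨fun j hj hj' => ?_, hroot⟩
    set s := nextV (cV n) (cφ n) - cV n with hs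
    have hs01 : s = 0 ∨ s = 1 := by unfold nextV at hs; split_ifs at hs <;> omega
    rcases lt_or_ge j s with h5 | h5
    · have hφ : cφ n = 2 * cV n - 3 := by
        by_contra hc
        have := (next_of_lt (V := cV n) (φ := cφ n) (by have := hp.2.2; omega)).1
        omega
      have e1 := ih1 0 le_rfl (by omega)
      have e2 := ih1 1 (by omega) (by omega)
      rw [gpat_zero] at e1
      rw [gpat_l hp (by omega) (by omega)] at e2
      have hL : Landing X (z - nextV (cV n) (cφ n) + j) := by
        constructor
        · rw [← e1]; congr 1; omega
        · rw [← e2]; congr 1; omega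
      rw [pushMap, if_neg (by tauto), guardRule, if_pos hL, show j = 0 by omega, gpat_zero]
    · rcases hj'.eq_or_lt with rfl | hj'
      · rw [hroot _ (by omega), gpat_root (by omega)]
      · have e1 : z - nextV (cV n) (cφ n) + j = z - cV n + (j - s) := by omega
        have e2 := guardRule_of_pat hp le_rfl ih1 (j := j - s) (by omega) (by omega)
        rw [e1, pushMap, if_neg, e2, ← hs, sub_add_cancel]
        rintro ⟨h6, -⟩
        rw [ih1 (j - s) (by omega) (by omega)] at h6
        exact gpat_ne_g (by omega) h6

/-- Left of `-m` one may put blanks, or a fresh guard (mirrored) backed by infinitely many roots,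
which never vanish. Blanks move at speed one and the guard follows the parabola, so the cell on the
curve is blank in one case and not in the other once `h n` is far enough below `parabola n`. -/
theorem parMap_uniformlySensitive {h : ℕ → ℤ} (hh : ¬ Below parabola h) :
    UniformlySensitive parMap h := by
  intro x m
  obtain ⟨n, hn⟩ : ∃ n : ℕ, h n + (m + 3) < parabola n := by
    by_contra hc
    push Not at hc
    exact hh ⟨m + 3, by omega, hc⟩
  set y : Config Guard := fun i => if -i ≤ m then x i else .n with hy
  set w : Config Guard := fun i => if -i ≤ m then x i else gpat 2 0 (min 2 (-i - m - 1)) with hw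
  have hym : AgreeOn x y m := fun i hi => by
    rw [abs_le] at hi; rw [hy]; simp only; rw [if_pos (by omega)]
  have hwm : AgreeOn x w m := fun i hi => by
    rw [abs_le] at hi; rw [hw]; simp only; rw [if_pos (by omega)]
  have h1 : parMap^[n] y (h n) = .n := by
    rw [parMap_iterate]
    apply pushMap_iterate_n (b := m + 1)
    · intro i hi
      rw [hy]; simp only; rw [if_neg (by omega)]
    · have := parabola_le n
      omega
  have h2 : parMap^[n] w (h n) ≠ .n := by
    rw [parMap_iterate]
    have hw' : ∀ j : ℤ, 0 ≤ j → w (-(m + 1 + j)) = gpat 2 0 (min 2 j) := by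
      intro j hj
      rw [hw]; simp only; rw [if_neg (by omega)]; congr 2; omega
    obtain ⟨k1, k2⟩ := pushMap_iterate_guard (Y := fun j => w (-j)) (z := m + 3)
      (by
        intro j hj hj'
        rw [show ((m : ℤ) + 3 - 2 + j) = m + 1 + j by ring, hw' j hj, min_eq_right hj'])
      (by
        intro i hi
        rw [show i = m + 1 + (i - m - 1) by ring, hw' _ (by omega), min_eq_left (by omega)]
        exact gpat_root le_rfl) n
    have := parabola_le_cV n
    rcases le_or_gt (m + 3 : ℤ) (-h n) with h3 | h3
    · rw [k2 _ h3]; decide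
    · rw [show -h n = m + 3 - cV n + (-h n - (m + 3 - cV n)) by ring,
        k1 _ (by omega) (by omega)]
      exact gpat_ne_n _ _ _
  by_cases hc : parMap^[n] x (h n) = .n
  · exact ⟨w, hwm, n, by rw [hc]; exact h2.symm⟩
  · exact ⟨y, hym, n, by rw [h1]; exact hc⟩

/-- The blank cells of a blank interval are only invaded from the right, and slowly. -/
theorem pushMap_iterate_blank {Y : Config Guard} {m : ℕ} (hm : 2 ≤ m)
    (h : ∀ i : ℤ, |i| ≤ m → Y i = .n) (N t : ℕ) (ht : t ≤ N) :
    (∀ u, pushMap^[t] Y u = .e → ∃ V φ e V₀ φ₀,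
      GuardAt (pushMap^[t] Y) u V φ e ((N : ℤ) - t + 1) ∧ IsPhase V₀ φ₀ ∧
      age V φ = age V₀ φ₀ + t ∧ (m < u + V - V₀ ∨ u < -m - t)) ∧
    ∀ i : ℤ, -m - t ≤ i → i ≤ m - 3 - parabola t → pushMap^[t] Y i = .n := by
  induction t with
  | zero =>
    refine ⟨fun u hu => ?_, fun i h1 h2 => h i ?_⟩
    · obtain ⟨V, φ, e, hG, -⟩ := exists_guardAt Y u hu (N + 1) (by positivity)
      refine ⟨V, φ, e, V, φ, by simpa using hG, hG.phase, by simp, ?_⟩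
      by_contra hc
      push Not at hc
      have := h u (by rw [abs_le]; simp only [Nat.cast_zero] at hc; omega)
      simp only [Function.iterate_zero, id] at hu
      rw [hu] at this; cases this
    · have := parabola_nonneg 0
      rw [abs_le]; simp only [Nat.cast_zero] at h1; omega
  | succ t ih =>
    obtain ⟨ih1, ih2⟩ := ih (by omega)
    set X := pushMap^[t] Y with hX
    rw [Function.iterate_succ_apply', ← hX]
    have hpt := parabola_le t
    have hp1 := parabola_mono (Nat.le_succ t)
    rw [Nat.succ_eq_add_one] at hp1
    have b1 : ∀ u, pushMap X u = .e → ∃ V φ e V₀ φ₀,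
        GuardAt (pushMap X) u V φ e ((N : ℤ) - (t + 1 : ℕ) + 1) ∧ IsPhase V₀ φ₀ ∧
        age V φ = age V₀ φ₀ + (t + 1 : ℕ) ∧ (m < u + V - V₀ ∨ u < -m - (t + 1 : ℕ)) := by
      intro u hu
      obtain ⟨v, hv, hvu, hstep⟩ := GuardAt.step (pushMap_eq_or X)
        (K := (N : ℤ) - t + 1) (by omega) hu
      replace hvu : v = u ∨ v = u + 1 := by tauto
      obtain ⟨V, φ, e, V₀, φ₀, k1, k2, k3, k4⟩ := ih1 v hv
      obtain ⟨s1, e', s2⟩ := hstep V φ e k1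
      refine ⟨nextV V φ, nextφ V φ, e', V₀, φ₀, ?_, k2, ?_, ?_⟩
      · convert s2 using 1; push_cast; ring
      · rw [age_next, k3]; push_cast; ring
      · rcases k4 with k4 | k4
        · left; omega
        · right
          push_cast
          by_contra hc
          -- The end has not moved, so its right neighbour is the leftmost known blank, which erases
          -- it.
          have : u + 1 = -m - t := by omega
          have h3 := pushMap_of_right (ih2 (u + 1) (by omega) (by omega))
          rw [hu] at h3; cases h3
    refine ⟨b1, fun i h1 h2 => ?_⟩
    rcases le_or_gt (i + 1) (m - 3 - parabola t) with h3 | h3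
    · push_cast at h1
      exact pushMap_of_right (ih2 _ (by omega) h3)
    · rcases pushMap_of_n (ih2 i (by omega) (by omega)) with h4 | h4
      · exact h4
      · obtain ⟨V, φ, e, V₀, φ₀, k1, k2, k3, k4⟩ := b1 i h4
        have := k1.phase.growth k2 k3
        omega

theorem parMap_equicontinuousAt {h : ℕ → ℤ} (h₀ : Below parabola h)
    (h₁ : Below h (fun n => (n : ℤ))) : EquicontinuousAt parMap h (fun _ => .n) := by
  obtain ⟨M, hM, H⟩ := h₀
  obtain ⟨N, hN, K⟩ := h₁
  intro k
  have key : ∀ y : Config Guard, AgreeOn (fun _ => .n) y (M + N + k + 3).toNat →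
      ∀ (n : ℕ) (i : ℤ), |i| ≤ k → parMap^[n] y (i + h n) = .n := by
    intro y hy n i hi
    have hn := H n
    have kn := K n
    simp only at hn kn
    rw [abs_le] at hi
    rw [parMap_iterate]
    -- The horizon is the time `n` itself, as each step costs one known cell. The `3` in the radius
    -- pays for the `3` in `m - 3 - parabola t`.
    refine (pushMap_iterate_blank (m := (M + N + k + 3).toNat) (by omega) ?_ n n le_rfl).2 _
      (by omega) (by omega)
    intro j hj
    exact (hy (-j) (by rwa [abs_neg])).symm
  refine ⟨(M + N + k + 3).toNat, fun y hy n i hi => ?_⟩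
  rw [key y hy n i hi, key _ (fun _ _ => rfl) n i hi]


/-! ### The automaton whose equicontinuous curves lie below the parabola

A second layer carries trains, which look like `h a … a σ b … b t` and move to the right, leaving
open space `o` behind them. Both the head `h` and the tip `t` of a train only move when the signal
`σ` arrives. Guards and trains of the same age that meet annihilate each other. -/

/-- The states of the train layer: open space, dead cell, seed, head, a cell left of the signal,
signals to the right (ordinary, or announcing a tie), signals to the left (ordinary, or carrying
the distance between the tip and a root), a cell right of the signal, tip. -/
inductive Train | o | d | s | h | a | r | rt | ln | l1 | l2 | b | t
  deriving DecidableEq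

instance : Finite Train :=
  Finite.of_injective (fun x : Train => (x.ctorIdx : ℕ) |> fun k => (Fin.ofNat 12 k)) (by
    intro x y h; cases x <;> cases y <;> first | rfl | (revert h; decide))

/-- `c` is a signal to the right. -/
def Train.IsR (c : Train) : Prop := c = .r ∨ c = .rt

/-- `c` is a signal to the left. -/
def Train.IsL (c : Train) : Prop := c = .ln ∨ c = .l1 ∨ c = .l2

section rule
variable (X : ℤ → Train) (Y : ℤ → Guard)

/-- The signal at `i` sees the end of a guard. -/
def Seen (i : ℤ) : Prop := (X i = .l1 ∧ Y (i + 2) = .e) ∨ (X i = .l2 ∧ Y (i + 3) = .e)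

/-- The signal at `i` sees the end of a guard when both the head and the end are about to move. -/
def TieHit (i : ℤ) : Prop := X (i - 1) = .h ∧
  ((X i = .l1 ∧ Y (i + 2) = .e ∧ Y (i + 3) = .l) ∨ (X i = .l2 ∧ Y (i + 3) = .e ∧ Y (i + 4) = .l))

/-- The signal at `i` dies. -/
def Dead (i : ℤ) : Prop := Seen X Y i ∧ ¬ TieHit X Y i

/-- The signal at `i` reaches the head. -/
def Hit (i : ℤ) : Prop := X (i - 1) = .h ∧ (X i).IsL ∧ ¬ Dead X Y i

/-- A signal reaches the tip at `i`. -/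
def Tick (i : ℤ) : Prop := X i = .t ∧ (X (i - 1)).IsR

/-- The tip at `i` opens the guard in front of it. -/
def Tie (i : ℤ) : Prop := X i = .t ∧ X (i - 1) = .rt ∧ (Y (i + 1) = .g ∨ Y (i + 2) = .g)

/-- The tip at `i` moves. -/
def Push (i : ℤ) : Prop := Tick X i ∧ ¬ Tie X Y i

/-- The end at `i` is destroyed by a train. -/
def Killed (i : ℤ) : Prop := Y i = .e ∧ (Hit X Y i ∨ Hit X Y (i - 1) ∨
  (TieHit X Y (i - 2) ∧ X (i - 2) = .l1) ∨ (TieHit X Y (i - 3) ∧ X (i - 3) = .l2))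

/-- The cell `i` is overwritten because of the moving or opening tip of a train. -/
def Overwritten (i : ℤ) : Prop := Push X Y (i - 2) ∨ Push X Y (i - 1) ∨ Push X Y i ∨
  Tie X Y i ∨ Tie X Y (i - 1) ∨ (Tie X Y (i - 2) ∧ Y (i - 1) ≠ .g)

open Classical in
/-- The rule of the train layer for cells that are not overwritten. -/
noncomputable def trainLocal (i : ℤ) : Train :=
  match X i with
  | .t => if X (i - 1) = .b ∧ ((X (i - 2)).IsR ∨ X (i - 2) = .b) then .t else .d
  | .b => if (X (i - 1)).IsR then X (i - 1) else if X (i - 1) = .b then .b else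
      if (X (i - 1)).IsL ∧ ¬ Dead X Y (i - 1) then
        (if X (i - 2) = .h then (if TieHit X Y (i - 1) then .rt else .r) else
          if X (i - 2) = .a then .b else .d) else .d
  | .r | .rt => if X (i - 1) = .h ∨ X (i - 1) = .a then
      (if Push X Y (i + 1) then
        (if Y (i + 4) = .g then .l1 else if Y (i + 5) = .g then .l2 else .ln) else .a) else .d
  | .ln | .l1 | .l2 => if Dead X Y i then .d else if X (i - 1) = .h then .h else
      if X (i - 1) = .a then .b else .d
  | .a => if X (i - 1) = .h ∨ X (i - 1) = .a then
      (if (X (i + 1)).IsL then (if Dead X Y (i + 1) then .d else X (i + 1)) else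
        if X (i + 1) = .o then .o else .a) else .d
  | .h => if Hit X Y (i + 1) ∨ X (i + 1) = .o then .o else .h
  | .o => .o
  | .d => .d
  | .s => .d

open Classical in
/-- The rule of the train layer, up to the influence of moving guards. -/
noncomputable def trainPre (i : ℤ) : Train :=
  if Push X Y (i - 2) then .t else if Push X Y (i - 1) ∨ Push X Y i then .b else
  if Overwritten X Y i then .o else trainLocal X Y i

open Classical in
/-- The rule of the train layer. -/
noncomputable def trainRule (i : ℤ) : Train :=
  if Landing Y i ∧ ¬ Killed X Y (i + 1) ∧ trainPre X Y i = .o then .d else trainPre X Y i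

open Classical in
/-- The rule of the guard layer in the presence of trains. -/
noncomputable def wallRule (i : ℤ) : Guard :=
  if trainRule X Y i = .o ∨ (Landing Y i ∧ Killed X Y (i + 1)) ∨ (¬ Landing Y i ∧ Killed X Y i)
  then .n else guardRule Y i

/-- The seed at `i` is active: no other seed is near. -/
def Active (i : ℤ) : Prop := X i = .s ∧ ∀ k, k ≠ 0 → |k| ≤ 16 → X (i + k) ≠ .s

/-- The cell `i` is near an active seed. -/
def NearActive (i : ℤ) : Prop := ∃ k : ℤ, |k| ≤ 8 ∧ Active X (i + k)

open Classical in
/-- The train layer after one step, including the effect of seeds. -/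
noncomputable def trainNext (i : ℤ) : Train :=
  if Active X (i - 1) then .h else if Active X (i - 2) then .r else if Active X (i - 3) then .t else
  if NearActive X i then .d else trainRule X Y i

open Classical in
/-- The guard layer after one step, including the effect of seeds. -/
noncomputable def wallNext (i : ℤ) : Guard :=
  if Active X (i + 2) then .e else if Active X (i + 1) then .r else if Active X i then .g else
  if NearActive X i then .n else wallRule X Y i

end rule

open Classical in
/-- The automaton on both layers, and a layer of colours that are reset in open space. -/
noncomputable def openMap (x : Config (Train × Guard × Bool)) : Config (Train × Guard × Bool) := fun i =>
  (trainNext (fun j => (x j).1) (fun j => (x j).2.1) i,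
    wallNext (fun j => (x j).1) (fun j => (x j).2.1) i,
    if trainNext (fun j => (x j).1) (fun j => (x j).2.1) i = .o then false else (x i).2.2)

/-! ### Locality of the rule with trains. -/

section congr
variable {X X' : ℤ → Train} {Y Y' : ℤ → Guard} {i j : ℤ}

/-- Two pairs of layers agree near `i` and `j`, respectively. -/
def Window (r : ℤ) (X X' : ℤ → Train) (Y Y' : ℤ → Guard) (i j : ℤ) : Prop :=
  ∀ q, |q| ≤ r → X (i + q) = X' (j + q) ∧ Y (i + q) = Y' (j + q)

theorem Window.subwindow {r : ℤ} (h : Window r X X' Y Y' i j) (k r' : ℤ) (hr : |k| + r' ≤ r) :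
    Window r' X X' Y Y' (i + k) (j + k) := by
  intro q hq
  rw [add_assoc, add_assoc]
  exact h _ (by have := abs_add_le k q; linarith)

theorem Window.sub {r : ℤ} (h : Window r X X' Y Y' i j) (k r' : ℤ) (hr : |k| + r' ≤ r) :
    Window r' X X' Y Y' (i - k) (j - k) := by
  rw [sub_eq_add_neg, sub_eq_add_neg]; exact h.subwindow _ _ (by rwa [abs_neg])

theorem Window.self {r : ℤ} (h : Window r X X' Y Y' i j) (hr : 0 ≤ r) :
    X i = X' j ∧ Y i = Y' j := by simpa using h 0 (by simpa using hr)

theorem Window.seen (h : Window 4 X X' Y Y' i j) : Seen X Y i ↔ Seen X' Y' j := by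
  unfold Seen
  rw [(h.self (by norm_num)).1, (h 2 (by norm_num)).2, (h 3 (by norm_num)).2]

theorem Window.tieHit (h : Window 4 X X' Y Y' i j) : TieHit X Y i ↔ TieHit X' Y' j := by
  unfold TieHit
  rw [(h.self (by norm_num)).1, ((h.sub 1 0 (by norm_num)).self le_rfl).1,
    (h 2 (by norm_num)).2, (h 3 (by norm_num)).2, (h 4 (by norm_num)).2]

theorem Window.dead (h : Window 4 X X' Y Y' i j) : Dead X Y i ↔ Dead X' Y' j := by
  unfold Dead; rw [h.seen, h.tieHit]

theorem Window.hit (h : Window 4 X X' Y Y' i j) : Hit X Y i ↔ Hit X' Y' j := by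
  unfold Hit
  rw [(h.self (by norm_num)).1, ((h.sub 1 0 (by norm_num)).self le_rfl).1, h.dead]

theorem Window.tie (h : Window 4 X X' Y Y' i j) : Tie X Y i ↔ Tie X' Y' j := by
  unfold Tie
  rw [(h.self (by norm_num)).1, ((h.sub 1 0 (by norm_num)).self le_rfl).1,
    (h 1 (by norm_num)).2, (h 2 (by norm_num)).2]

theorem Window.push (h : Window 4 X X' Y Y' i j) : Push X Y i ↔ Push X' Y' j := by
  unfold Push Tick
  rw [(h.self (by norm_num)).1, ((h.sub 1 0 (by norm_num)).self le_rfl).1, h.tie]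

theorem Window.mono {r : ℤ} (h : Window r X X' Y Y' i j) (r' : ℤ) (hr : r' ≤ r) :
    Window r' X X' Y Y' i j := fun q hq => h q (hq.trans hr)

theorem Window.killed (h : Window 7 X X' Y Y' i j) : Killed X Y i ↔ Killed X' Y' j := by
  unfold Killed
  rw [(h.self (by norm_num)).2, ((h.sub 2 0 (by norm_num)).self le_rfl).1,
    ((h.sub 3 0 (by norm_num)).self le_rfl).1, (h.mono 4 (by norm_num)).hit,
    (h.sub 1 4 (by norm_num)).hit, (h.sub 2 4 (by norm_num)).tieHit,
    (h.sub 3 4 (by norm_num)).tieHit]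

theorem Window.overwritten (h : Window 6 X X' Y Y' i j) :
    Overwritten X Y i ↔ Overwritten X' Y' j := by
  unfold Overwritten
  rw [(h.sub 2 4 (by norm_num)).push, (h.sub 1 4 (by norm_num)).push,
    (h.mono 4 (by norm_num)).push, (h.sub 2 4 (by norm_num)).tie, (h.sub 1 4 (by norm_num)).tie,
    (h.mono 4 (by norm_num)).tie, ((h.sub 1 0 (by norm_num)).self le_rfl).2]

theorem Window.trainLocal (h : Window 6 X X' Y Y' i j) :
    trainLocal X Y i = trainLocal X' Y' j := by
  unfold DirectionalCA.trainLocal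
  rw [(h.self (by norm_num)).1, ((h.sub 1 0 (by norm_num)).self le_rfl).1,
    ((h.sub 2 0 (by norm_num)).self le_rfl).1, (h 1 (by norm_num)).1, (h 4 (by norm_num)).2,
    (h 5 (by norm_num)).2]
  rw [propext ((h.sub 1 4 (by norm_num)).dead),
    propext ((h.sub 1 4 (by norm_num)).tieHit),
    propext ((h.subwindow 1 4 (by norm_num)).push),
    propext ((h.mono 4 (by norm_num)).dead),
    propext ((h.subwindow 1 4 (by norm_num)).dead),
    propext ((h.subwindow 1 4 (by norm_num)).hit)]

theorem Window.landing (h : Window 2 X X' Y Y' i j) : Landing Y i ↔ Landing Y' j := by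
  unfold Landing
  rw [(h 1 (by norm_num)).2, (h 2 (by norm_num)).2]

theorem Window.trainRule (h : Window 8 X X' Y Y' i j) :
    trainRule X Y i = trainRule X' Y' j := by
  unfold DirectionalCA.trainRule trainPre
  rw [(h.mono 6 (by norm_num)).trainLocal,
    propext ((h.mono 2 (by norm_num)).landing),
    propext ((h.subwindow 1 7 (by norm_num)).killed),
    propext ((h.mono 6 (by norm_num)).overwritten),
    propext ((h.sub 2 4 (by norm_num)).push),
    propext ((h.sub 1 4 (by norm_num)).push),
    propext ((h.mono 4 (by norm_num)).push)]

theorem Window.wallRule (h : Window 8 X X' Y Y' i j) :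
    wallRule X Y i = wallRule X' Y' j := by
  unfold DirectionalCA.wallRule
  rw [h.trainRule,
    propext ((h.mono 2 (by norm_num)).landing),
    propext ((h.subwindow 1 7 (by norm_num)).killed),
    propext ((h.mono 7 (by norm_num)).killed),
    (guardRule_congr fun k hk => (h k (by omega)).2).1]

theorem Window.active (h : Window 16 X X' Y Y' i j) : Active X i ↔ Active X' j := by
  unfold Active
  rw [(h.self (by norm_num)).1]
  refine and_congr Iff.rfl (forall_congr' fun k => imp_congr Iff.rfl ?_)
  exact ⟨fun H hk => by rw [← (h k hk).1]; exact H hk, fun H hk => by rw [(h k hk).1]; exact H hk⟩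

theorem Window.nearActive (h : Window 24 X X' Y Y' i j) : NearActive X i ↔ NearActive X' j := by
  unfold NearActive
  constructor
  · rintro ⟨k, hk, h1⟩; exact ⟨k, hk, (h.subwindow k 16 (by linarith)).active.1 h1⟩
  · rintro ⟨k, hk, h1⟩; exact ⟨k, hk, (h.subwindow k 16 (by linarith)).active.2 h1⟩

theorem isCellularAutomaton_openMap : IsCellularAutomaton openMap := by
  have : Nonempty (Train × Guard × Bool) := ⟨.d, .n, false⟩
  apply isCellularAutomaton_of_local 24
  intro x y m k hxy
  have h : Window 24 (fun j => (x j).1) (fun j => (y j).1) (fun j => (x j).2.1)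
      (fun j => (y j).2.1) m k := fun q hq => by simp only [hxy q hq, and_self]
  have h0 := hxy 0 (by norm_num)
  rw [add_zero, add_zero] at h0
  unfold openMap
  have h1 : trainNext (fun j => (x j).1) (fun j => (x j).2.1) m =
      trainNext (fun j => (y j).1) (fun j => (y j).2.1) k := by
    unfold trainNext
    rw [propext ((h.sub 1 16 (by norm_num)).active),
    propext ((h.sub 2 16 (by norm_num)).active),
    propext ((h.sub 3 16 (by norm_num)).active),
    propext (h.nearActive),
    (h.mono 8 (by norm_num)).trainRule]
  have h2 : wallNext (fun j => (x j).1) (fun j => (x j).2.1) m =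
      wallNext (fun j => (y j).1) (fun j => (y j).2.1) k := by
    unfold wallNext
    rw [propext ((h.subwindow 1 16 (by norm_num)).active),
    propext ((h.subwindow 2 16 (by norm_num)).active),
    propext ((h.mono 16 (by norm_num)).active),
    propext (h.nearActive),
    (h.mono 8 (by norm_num)).wallRule]
  rw [h1, h2, h0]

end congr


/-! ### Trains as counters. -/

/-- The length of the train in the state `(V, φ)`. -/
def tW (V φ : ℤ) : ℤ := if φ + 2 ≤ V then V else V + 2

/-- The distance between the signal and the tip of the train in the state `(V, φ)`. -/
def tso (V φ : ℤ) : ℤ := if φ + 2 ≤ V then V - φ - 1 else φ + 4 - V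

/-- The shape of the train in the state `(V, φ)` with signal `σ`; the offset `j` is counted
leftwards from the tip. -/
def tpat (V φ : ℤ) (σ : Train) (j : ℤ) : Train :=
  if j = 0 then .t else if j = tW V φ then .h else if j < tso V φ then .b else
  if j = tso V φ then σ else .a

/-- The signal `σ` has the direction required by the state `(V, φ)`. -/
def KindOk (V φ : ℤ) (σ : Train) : Prop := (φ + 2 ≤ V → σ.IsR) ∧ (V < φ + 2 → σ.IsL)

theorem tW_of_le {V φ : ℤ} (h : φ + 2 ≤ V) : tW V φ = V := if_pos h
theorem tW_of_lt {V φ : ℤ} (h : V < φ + 2) : tW V φ = V + 2 := if_neg (by omega)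
theorem tso_of_le {V φ : ℤ} (h : φ + 2 ≤ V) : tso V φ = V - φ - 1 := if_pos h
theorem tso_of_lt {V φ : ℤ} (h : V < φ + 2) : tso V φ = φ + 4 - V := if_neg (by omega)

theorem IsPhase.tso_pos {V φ : ℤ} (h : IsPhase V φ) : 0 < tso V φ := by
  obtain ⟨h1, h2, h3⟩ := h
  unfold tso; split_ifs <;> omega

theorem IsPhase.tso_lt {V φ : ℤ} (h : IsPhase V φ) : tso V φ < tW V φ := by
  obtain ⟨h1, h2, h3⟩ := h
  unfold tso tW; split_ifs <;> omega

theorem tpat_t (V φ : ℤ) (σ : Train) : tpat V φ σ 0 = .t := if_pos rfl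

theorem tpat_h {V φ j : ℤ} (σ : Train) (h : IsPhase V φ) (hj : j = tW V φ) :
    tpat V φ σ j = .h := by
  have h1 := h.tso_pos
  have h2 := h.tso_lt
  rw [tpat, if_neg (by omega), if_pos hj]

theorem tpat_b {V φ j : ℤ} (σ : Train) (h : IsPhase V φ) (h0 : 0 < j) (hj : j < tso V φ) :
    tpat V φ σ j = .b := by
  have h2 := h.tso_lt
  rw [tpat, if_neg (by omega), if_neg (by omega), if_pos hj]

theorem tpat_s {V φ j : ℤ} (σ : Train) (h : IsPhase V φ) (hj : j = tso V φ) :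
    tpat V φ σ j = σ := by
  have h1 := h.tso_pos
  have h2 := h.tso_lt
  rw [tpat, if_neg (by omega), if_neg (by omega), if_neg (by omega), if_pos hj]

theorem tpat_a {V φ j : ℤ} (σ : Train) (h : IsPhase V φ) (h0 : tso V φ < j) (hj : j < tW V φ) :
    tpat V φ σ j = .a := by
  have h1 := h.tso_pos
  rw [tpat, if_neg (by omega), if_neg (by omega), if_neg (by omega), if_neg (by omega)]

/-- The left neighbours with which a cell of a train survives. -/
def Train.Accepts (c x : Train) : Prop :=
  (c = .t → x = .b ∨ x.IsR) ∧ (c = .b → x = .b ∨ x.IsR ∨ x.IsL) ∧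
  (c = .a ∨ c.IsR ∨ c.IsL → x = .h ∨ x = .a)

theorem Train.IsR.ne {c : Train} (h : c.IsR) : c ≠ .o ∧ c ≠ .d ∧ c ≠ .s ∧ c ≠ .h ∧ c ≠ .a ∧
    c ≠ .b ∧ c ≠ .t ∧ ¬ c.IsL := by
  rcases h with rfl | rfl <;> simp [Train.IsL]

theorem Train.IsL.ne {c : Train} (h : c.IsL) : c ≠ .o ∧ c ≠ .d ∧ c ≠ .s ∧ c ≠ .h ∧ c ≠ .a ∧
    c ≠ .b ∧ c ≠ .t ∧ ¬ c.IsR := by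
  rcases h with rfl | rfl | rfl <;> simp [Train.IsR]

/-- A state that does not support a train on its right. -/
def Train.Stop (c : Train) : Prop := c = .o ∨ c = .d ∨ c = .t

/-- Trains are supported from the head, guards from the root: such a cell inside a train is a defect
that travels towards the tip. -/
theorem tpat_not_accepts {V φ j : ℤ} {σ x : Train} (hp : IsPhase V φ) (hk : KindOk V φ σ)
    (hj : 0 ≤ j) (hj' : j < tW V φ) (hx : x.Stop) : ¬ (tpat V φ σ j).Accepts x := by
  intro ⟨h1, h2, h3⟩
  have hx1 : x ≠ .b ∧ ¬ x.IsR ∧ ¬ x.IsL ∧ x ≠ .h ∧ x ≠ .a := by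
    rcases hx with rfl | rfl | rfl <;> simp [Train.IsR, Train.IsL]
  rcases hj.eq_or_lt with rfl | hj
  · have := h1 (tpat_t V φ σ); tauto
  rcases lt_trichotomy j (tso V φ) with h | h | h
  · have := h2 (tpat_b σ hp hj h); tauto
  · rw [tpat_s σ hp h] at h3
    have : σ.IsR ∨ σ.IsL := by
      rcases le_or_gt (φ + 2) V with h4 | h4
      · exact Or.inl (hk.1 h4)
      · exact Or.inr (hk.2 h4)
    have := h3 (Or.inr this)
    tauto
  · have := h3 (Or.inl (tpat_a σ hp h hj')); tauto

theorem tpat_ne_t {V φ j : ℤ} {σ : Train} (hk : KindOk V φ σ) (hj : j ≠ 0) :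
    tpat V φ σ j ≠ .t := by
  have : σ ≠ .t := by
    rcases le_or_gt (φ + 2) V with h4 | h4
    · exact (hk.1 h4).ne.2.2.2.2.2.2.1
    · exact (hk.2 h4).ne.2.2.2.2.2.2.1
  unfold tpat
  rw [if_neg hj]
  split_ifs <;> first | assumption | decide

section local_rule
variable {X : ℤ → Train} {Y : ℤ → Guard} {i : ℤ}

theorem trainLocal_b (h : X i = .b) (h' : X (i - 1) = .b) : trainLocal X Y i = .b := by
  simp [trainLocal, h, h', Train.IsR]

theorem trainLocal_b_r (h : X i = .b) (h' : (X (i - 1)).IsR) : trainLocal X Y i = X (i - 1) := by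
  simp [trainLocal, h, h']

theorem trainLocal_b_l (h : X i = .b) (h' : (X (i - 1)).IsL) (hd : ¬ Dead X Y (i - 1))
    (ha : X (i - 2) = .a) : trainLocal X Y i = .b := by
  simp [trainLocal, h, h', h'.ne, hd, ha]

open Classical in
theorem trainLocal_b_h (h : X i = .b) (h' : (X (i - 1)).IsL) (hd : ¬ Dead X Y (i - 1))
    (ha : X (i - 2) = .h) : trainLocal X Y i = if TieHit X Y (i - 1) then .rt else .r := by
  simp [trainLocal, h, h', h'.ne, hd, ha]

theorem trainLocal_b_dead (h : X i = .b) (h' : (X (i - 1)).IsL)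
    (hd : Dead X Y (i - 1) ∨ (X (i - 2) ≠ .h ∧ X (i - 2) ≠ .a)) : trainLocal X Y i = .d := by
  by_cases hd' : Dead X Y (i - 1)
  · simp [trainLocal, h, h'.ne, hd']
  · have := hd.resolve_left hd'
    simp [trainLocal, h, h'.ne, hd', this]

theorem trainLocal_r (h : (X i).IsR) (h' : X (i - 1) = .h ∨ X (i - 1) = .a)
    (hp : ¬ Push X Y (i + 1)) : trainLocal X Y i = .a := by
  rcases h with h | h <;> simp [trainLocal, h, h', hp]

theorem trainLocal_r_push (h : (X i).IsR) (h' : X (i - 1) = .h ∨ X (i - 1) = .a)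
    (hp : Push X Y (i + 1)) : trainLocal X Y i =
      if Y (i + 4) = .g then .l1 else if Y (i + 5) = .g then .l2 else .ln := by
  rcases h with h | h <;> simp [trainLocal, h, h', hp]

theorem trainLocal_l (h : (X i).IsL) (h' : X (i - 1) = .a) (hd : ¬ Dead X Y i) :
    trainLocal X Y i = .b := by
  rcases h with h | h | h <;> simp [trainLocal, h, h', hd]

theorem trainLocal_l_h (h : (X i).IsL) (h' : X (i - 1) = .h) (hd : ¬ Dead X Y i) :
    trainLocal X Y i = .h := by
  rcases h with h | h | h <;> simp [trainLocal, h, h', hd]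

theorem trainLocal_l_dead (h : (X i).IsL) (hd : Dead X Y i) : trainLocal X Y i = .d := by
  rcases h with h | h | h <;> simp [trainLocal, h, hd]

theorem trainLocal_a (h : X i = .a) (h' : X (i - 1) = .h ∨ X (i - 1) = .a)
    (hr : ¬ (X (i + 1)).IsL) (ho : X (i + 1) ≠ .o) : trainLocal X Y i = .a := by
  simp [trainLocal, h, h', hr, ho]

theorem trainLocal_a_l (h : X i = .a) (h' : X (i - 1) = .h ∨ X (i - 1) = .a)
    (hr : (X (i + 1)).IsL) (hd : ¬ Dead X Y (i + 1)) : trainLocal X Y i = X (i + 1) := by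
  simp [trainLocal, h, h', hr, hd]

theorem trainLocal_a_dead (h : X i = .a) (hr : (X (i + 1)).IsL) (hd : Dead X Y (i + 1)) :
    trainLocal X Y i = .d := by
  simp [trainLocal, h, hr, hd]

theorem trainLocal_h (h : X i = .h) (hr : ¬ (X (i + 1)).IsL) (ho : X (i + 1) ≠ .o) :
    trainLocal X Y i = .h := by
  have : ¬ Hit X Y (i + 1) := fun h => hr h.2.1
  simp [trainLocal, h, this, ho]

theorem trainLocal_of_not_accepts (ht : X i ≠ .t) (hc : ¬ (X i).Accepts (X (i - 1))) :
    trainLocal X Y i = .d := by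
  unfold Train.Accepts at hc
  generalize hx : X (i - 1) = x at hc
  unfold trainLocal
  rw [hx]
  cases hc' : X i <;> rw [hc'] at hc ht <;> simp_all [Train.IsL, Train.IsR]

end local_rule


open Classical in
/-- The signal of the train with tip at `τ` after one step. -/
noncomputable def nextσ (X : ℤ → Train) (Y : ℤ → Guard) (τ V φ : ℤ) (σ : Train) : Train :=
  if φ + 2 = V then (if Y (τ + 3) = .g then .l1 else if Y (τ + 4) = .g then .l2 else .ln)
  else if φ = 2 * V - 3 then (if TieHit X Y (τ - tso V φ) then .rt else .r) else σ

/-- The movement of the tip in one step. -/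
def tshift (V φ : ℤ) : ℤ := if φ + 2 = V then 2 else 0

theorem kindOk_next {X : ℤ → Train} {Y : ℤ → Guard} {τ V φ : ℤ} {σ : Train} (hp : IsPhase V φ)
    (hk : KindOk V φ σ) : KindOk (nextV V φ) (nextφ V φ) (nextσ X Y τ V φ σ) := by
  obtain ⟨h1, h2, h3⟩ := hp
  obtain ⟨k1, k2⟩ := hk
  unfold KindOk nextσ
  rcases h3.eq_or_lt with h4 | h4
  · rw [(next_of_eq h4).1, (next_of_eq h4).2, if_neg (by omega), if_pos h4]
    refine ⟨fun _ => ?_, fun _ => by omega⟩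
    split_ifs <;> simp [Train.IsR]
  · rw [(next_of_lt h4).1, (next_of_lt h4).2, if_neg (by omega : ¬ φ = 2 * V - 3)]
    split_ifs with h5 h6 h7
    · exact ⟨fun _ => by omega, fun _ => by simp [Train.IsL]⟩
    · exact ⟨fun _ => by omega, fun _ => by simp [Train.IsL]⟩
    · exact ⟨fun _ => by omega, fun _ => by simp [Train.IsL]⟩
    · exact ⟨fun h => k1 (by omega), fun h => k2 (by omega)⟩

/-- The counter step inside a train. The exceptional outcome is the death of cells around a signal
that sees the end of a guard or lies at the edge of the known part. Hypothesis `hb` is for the cell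
right of the signal, whose new state depends on two cells to its left. -/
theorem trainLocal_of_pat {X : ℤ → Train} {Y : ℤ → Guard} {τ V φ e j : ℤ} {σ : Train}
    (hp : IsPhase V φ) (hk : KindOk V φ σ) (he : e ≤ tW V φ)
    (hpat : ∀ j, 0 ≤ j → j ≤ e → X (τ - j) = tpat V φ σ j) (h0 : 0 < j)
    (hj : j < e ∨ (j = e ∧ e = tW V φ ∧ φ ≠ 2 * V - 3))
    (hb : j + 2 ≤ e ∨ e = tW V φ ∨ ¬ (X (τ - e)).Accepts (X (τ - e - 1)))
    (ht : φ + 2 = V → Push X Y τ) :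
    trainLocal X Y (τ - j) =
      tpat (nextV V φ) (nextφ V φ) (nextσ X Y τ V φ σ) (j + tshift V φ) ∨
    (trainLocal X Y (τ - j) = .d ∧ (Dead X Y (τ - tso V φ) ∨ e < tW V φ)) := by
  have hp' := hp.next
  have hk' := kindOk_next (X := X) (Y := Y) (τ := τ) hp hk
  have hso := hp.tso_pos
  have hsW := hp.tso_lt
  obtain ⟨h1, h2, h3⟩ := id hp
  have hl : ∀ j, 0 ≤ j + 1 → j + 1 ≤ e → X (τ - j - 1) = tpat V φ σ (j + 1) := by
    intro j a b; rw [← hpat _ a b]; congr 1; ring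
  have hl2 : ∀ j, 0 ≤ j + 2 → j + 2 ≤ e → X (τ - j - 2) = tpat V φ σ (j + 2) := by
    intro j a b; rw [← hpat _ a b]; congr 1; ring
  have hr : ∀ j, 0 ≤ j - 1 → j - 1 ≤ e → X (τ - j + 1) = tpat V φ σ (j - 1) := by
    intro j a b; rw [← hpat _ a b]; congr 1; ring
  have hje : j ≤ e := by omega
  have hjW : j ≤ tW V φ := by omega
  -- the left neighbour of the signal and of the cells left of it
  have hleft : tso V φ ≤ j → j < tW V φ → X (τ - j - 1) = .h ∨ X (τ - j - 1) = .a := by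
    intro a b
    have : j < e := by omega
    rw [hl j (by omega) (by omega)]
    rcases (by omega : j + 1 = tW V φ ∨ j + 1 < tW V φ) with c | c
    · exact Or.inl (tpat_h σ hp c)
    · exact Or.inr (tpat_a σ hp (by omega) c)
  unfold nextσ at hk' ⊢
  rcases le_or_gt (φ + 2) V with hφ | hφ
  · -- the signal moves to the right
    obtain ⟨e1, e2⟩ := next_of_lt (V := V) (φ := φ) (by omega)
    rw [e1, e2] at hp' hk' ⊢
    have w := tW_of_le hφ
    have s := tso_of_le hφ
    have hσ := hk.1 hφ
    left
    rcases eq_or_ne (φ + 2) V with hV | hV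
    · have w' := tW_of_lt (V := V) (φ := φ + 1) (by omega)
      have s' := tso_of_lt (V := V) (φ := φ + 1) (by omega)
      rw [if_pos hV] at hk' ⊢
      rw [tshift, if_pos hV]
      rcases (by omega : j = 1 ∨ (1 < j ∧ j < V) ∨ j = V) with rfl | hj1 | hj1
      · rw [trainLocal_r_push (by rw [hpat 1 (by omega) hje, tpat_s σ hp (by omega)]; exact hσ)
          (hleft (by omega) (by omega)) (by rw [sub_add_cancel]; exact ht hV),
          tpat_s _ hp' (by omega)]
        rw [show τ - 1 + 4 = τ + 3 by ring, show τ - 1 + 5 = τ + 4 by ring]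
      · have hr' := hr j (by omega) (by omega)
        rw [tpat_a (j := j + 2) _ hp' (by omega) (by omega)]
        have : ¬ (X (τ - j + 1)).IsL ∧ X (τ - j + 1) ≠ .o := by
          rw [hr']
          rcases (by omega : j = 2 ∨ 2 < j) with rfl | h5
          · rw [tpat_s σ hp (by omega)]; exact ⟨hσ.ne.2.2.2.2.2.2.2, hσ.ne.1⟩
          · rw [tpat_a σ hp (by omega) (by omega)]; simp [Train.IsL]
        exact trainLocal_a (by rw [hpat j h0.le hje, tpat_a σ hp (by omega) (by omega)])
          (hleft (by omega) (by omega)) this.1 this.2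
      · have hr' := hr j (by omega) (by omega)
        rw [tpat_h _ hp' (by omega)]
        have : ¬ (X (τ - j + 1)).IsL ∧ X (τ - j + 1) ≠ .o := by
          rw [hr']
          rcases (by omega : j = 2 ∨ 2 < j) with h5 | h5
          · rw [tpat_s σ hp (by omega)]; exact ⟨hσ.ne.2.2.2.2.2.2.2, hσ.ne.1⟩
          · rw [tpat_a σ hp (by omega) (by omega)]; simp [Train.IsL]
        exact trainLocal_h (by rw [hpat j h0.le hje, tpat_h σ hp (by omega)]) this.1 this.2
    · have w' := tW_of_le (V := V) (φ := φ + 1) (by omega)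
      have s' := tso_of_le (V := V) (φ := φ + 1) (by omega)
      rw [if_neg hV, if_neg (by omega : ¬ φ = 2 * V - 3)] at hk' ⊢
      rw [tshift, if_neg hV, add_zero]
      have hright : tso V φ < j → ¬ (X (τ - j + 1)).IsL ∧ X (τ - j + 1) ≠ .o := by
        intro h4
        rw [hr j (by omega) (by omega)]
        rcases (by omega : j - 1 = tso V φ ∨ tso V φ < j - 1) with h5 | h5
        · rw [tpat_s σ hp h5]; exact ⟨hσ.ne.2.2.2.2.2.2.2, hσ.ne.1⟩
        · rw [tpat_a σ hp (by omega) (by omega)]; simp [Train.IsL]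
      rcases (by omega : j < tso V φ - 1 ∨ j = tso V φ - 1 ∨ j = tso V φ ∨
        (tso V φ < j ∧ j < V) ∨ j = V) with hj1 | hj1 | hj1 | hj1 | hj1
      · rw [tpat_b _ hp' h0 (by omega)]
        exact trainLocal_b (by rw [hpat j h0.le hje, tpat_b σ hp h0 (by omega)])
          (by rw [hl j (by omega) (by omega), tpat_b σ hp (by omega) (by omega)])
      · have hl' : X (τ - j - 1) = σ := by
          rw [hl j (by omega) (by omega), tpat_s σ hp (by omega)]
        rw [tpat_s _ hp' (by omega), ← hl']
        exact trainLocal_b_r (by rw [hpat j h0.le hje, tpat_b σ hp h0 (by omega)])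
          (by rw [hl']; exact hσ)
      · rw [tpat_a _ hp' (by omega) (by omega)]
        refine trainLocal_r (by rw [hpat j h0.le hje, tpat_s σ hp hj1]; exact hσ)
          (hleft (by omega) (by omega)) fun hpush => ?_
        have := hpush.1.1
        rw [hr j (by omega) (by omega), tpat_b σ hp (by omega) (by omega)] at this
        cases this
      · rw [tpat_a _ hp' (by omega) (by omega)]
        exact trainLocal_a (by rw [hpat j h0.le hje, tpat_a σ hp (by omega) (by omega)])
          (hleft (by omega) (by omega)) (hright (by omega)).1 (hright (by omega)).2
      · rw [tpat_h _ hp' (by omega)]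
        exact trainLocal_h (by rw [hpat j h0.le hje, tpat_h σ hp (by omega)])
          (hright (by omega)).1 (hright (by omega)).2
  · -- the signal moves to the left
    have w := tW_of_lt hφ
    have s := tso_of_lt hφ
    have hσ := hk.2 hφ
    rw [if_neg (by omega : ¬ φ + 2 = V)] at hk' ⊢
    rw [tshift, if_neg (by omega : ¬ φ + 2 = V), add_zero]
    -- the case of a cell directly right of the signal
    have hbl : j = tso V φ - 1 → (Dead X Y (τ - tso V φ) ∨ e < tW V φ) ∧
        trainLocal X Y (τ - j) = .d ∨ (¬ Dead X Y (τ - tso V φ) ∧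
          tso V φ + 1 ≤ e) := by
      intro h4
      have h5 : X (τ - j - 1) = σ := by rw [hl j (by omega) (by omega), tpat_s σ hp (by omega)]
      have h6 : X (τ - j) = .b := by rw [hpat j h0.le hje, tpat_b σ hp h0 (by omega)]
      have h7 : τ - j - 1 = τ - tso V φ := by omega
      by_cases hd : Dead X Y (τ - tso V φ)
      · exact Or.inl ⟨Or.inl hd, trainLocal_b_dead h6 (by rw [h5]; exact hσ)
          (Or.inl (by rw [h7]; exact hd))⟩
      · rcases (by omega : e = tso V φ ∨ tso V φ + 1 ≤ e) with h8 | h8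
        · left
          refine ⟨Or.inr (by omega), trainLocal_b_dead h6 (by rw [h5]; exact hσ) (Or.inr ?_)⟩
          rcases hb with hb | hb | hb
          · omega
          · omega
          · rw [h8, ← h7, h5] at hb
            have h9 : ¬ (X (τ - j - 2) = .h ∨ X (τ - j - 2) = .a) := by
              intro h9
              apply hb
              have h10 := hσ.ne
              rw [show τ - j - 1 - 1 = τ - j - 2 by ring]
              exact ⟨fun h => absurd h h10.2.2.2.2.2.2.1, fun h => absurd h h10.2.2.2.2.2.1,
                fun _ => h9⟩
            tauto
        · exact Or.inr ⟨hd, h8⟩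
    have hsg : j = tso V φ → X (τ - j) = σ := fun h4 => by
      rw [hpat j h0.le hje, tpat_s σ hp h4]
    rcases h3.eq_or_lt with hV | hV
    · obtain ⟨e1, e2⟩ := next_of_eq hV
      rw [e1, e2] at hp' hk' ⊢
      have w' := tW_of_le (V := V + 1) (φ := 0) (by omega)
      have s' := tso_of_le (V := V + 1) (φ := 0) (by omega)
      rw [if_pos hV] at hk' ⊢
      rcases (by omega : j < tso V φ - 1 ∨ j = tso V φ - 1 ∨ j = tso V φ) with hj1 | hj1 | hj1
      · left
        rw [tpat_b _ hp' h0 (by omega)]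
        exact trainLocal_b (by rw [hpat j h0.le hje, tpat_b σ hp h0 (by omega)])
          (by rw [hl j (by omega) (by omega), tpat_b σ hp (by omega) (by omega)])
      · rcases hbl hj1 with h4 | ⟨h4, h5⟩
        · exact Or.inr ⟨h4.2, h4.1⟩
        · left
          have h7 : τ - j - 1 = τ - tso V φ := by omega
          have h8 : X (τ - j - 1) = σ := by
            rw [hl j (by omega) (by omega), tpat_s σ hp (by omega)]
          rw [tpat_s _ hp' (by omega), trainLocal_b_h
            (by rw [hpat j h0.le hje, tpat_b σ hp h0 (by omega)]) (by rw [h8]; exact hσ)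
            (by rw [h7]; exact h4)
            (by rw [hl2 j (by omega) (by omega), tpat_h σ hp (by omega)]), h7]
      · by_cases hd : Dead X Y (τ - tso V φ)
        · right
          exact ⟨trainLocal_l_dead (by rw [hsg hj1]; exact hσ) (by rw [hj1]; exact hd), Or.inl hd⟩
        · left
          rw [tpat_h _ hp' (by omega)]
          exact trainLocal_l_h (by rw [hsg hj1]; exact hσ)
            (by rw [hl j (by omega) (by omega), tpat_h σ hp (by omega)]) (by rw [hj1]; exact hd)
    · obtain ⟨e1, e2⟩ := next_of_lt hV
      rw [e1, e2] at hp' hk' ⊢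
      have w' := tW_of_lt (V := V) (φ := φ + 1) (by omega)
      have s' := tso_of_lt (V := V) (φ := φ + 1) (by omega)
      rw [if_neg (by omega : ¬ φ = 2 * V - 3)] at hk' ⊢
      have hright : tso V φ + 1 < j → ¬ (X (τ - j + 1)).IsL ∧ X (τ - j + 1) ≠ .o := by
        intro h4
        rw [hr j (by omega) (by omega), tpat_a σ hp (by omega) (by omega)]
        simp [Train.IsL]
      rcases (by omega : j < tso V φ - 1 ∨ j = tso V φ - 1 ∨ j = tso V φ ∨ j = tso V φ + 1 ∨
        (tso V φ + 1 < j ∧ j < V + 2) ∨ j = V + 2) with hj1 | hj1 | hj1 | hj1 | hj1 | hj1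
      · left
        rw [tpat_b _ hp' h0 (by omega)]
        exact trainLocal_b (by rw [hpat j h0.le hje, tpat_b σ hp h0 (by omega)])
          (by rw [hl j (by omega) (by omega), tpat_b σ hp (by omega) (by omega)])
      · rcases hbl hj1 with h4 | ⟨h4, h5⟩
        · exact Or.inr ⟨h4.2, h4.1⟩
        · left
          have h7 : τ - j - 1 = τ - tso V φ := by omega
          rw [tpat_b _ hp' h0 (by omega)]
          exact trainLocal_b_l (by rw [hpat j h0.le hje, tpat_b σ hp h0 (by omega)])
            (by rw [hl j (by omega) (by omega), tpat_s σ hp (by omega)]; exact hσ)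
            (by rw [h7]; exact h4)
            (by rw [hl2 j (by omega) (by omega), tpat_a σ hp (by omega) (by omega)])
      · by_cases hd : Dead X Y (τ - tso V φ)
        · right
          exact ⟨trainLocal_l_dead (by rw [hsg hj1]; exact hσ) (by rw [hj1]; exact hd), Or.inl hd⟩
        · left
          rw [tpat_b _ hp' h0 (by omega)]
          exact trainLocal_l (by rw [hsg hj1]; exact hσ)
            (by rw [hl j (by omega) (by omega), tpat_a σ hp (by omega) (by omega)])
            (by rw [hj1]; exact hd)
      · have h7 : τ - j + 1 = τ - tso V φ := by omega
        have h8 : X (τ - j + 1) = σ := by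
          rw [hr j (by omega) (by omega), tpat_s σ hp (by omega)]
        have h9 : X (τ - j) = .a := by
          rw [hpat j h0.le hje, tpat_a σ hp (by omega) (by omega)]
        by_cases hd : Dead X Y (τ - tso V φ)
        · right
          exact ⟨trainLocal_a_dead h9 (by rw [h8]; exact hσ) (by rw [h7]; exact hd), Or.inl hd⟩
        · left
          rw [tpat_s _ hp' (by omega), trainLocal_a_l h9 (hleft (by omega) (by omega))
            (by rw [h8]; exact hσ) (by rw [h7]; exact hd), h8]
      · left
        rw [tpat_a _ hp' (by omega) (by omega)]
        exact trainLocal_a (by rw [hpat j h0.le hje, tpat_a σ hp (by omega) (by omega)])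
          (hleft (by omega) (by omega)) (hright (by omega)).1 (hright (by omega)).2
      · left
        rw [tpat_h _ hp' (by omega)]
        exact trainLocal_h (by rw [hpat j h0.le hje, tpat_h σ hp (by omega)])
          (hright (by omega)).1 (hright (by omega)).2


/-! ### One step of a train. -/

section
variable {X : ℤ → Train} {Y : ℤ → Guard} {i : ℤ}

theorem trainRule_cases (X : ℤ → Train) (Y : ℤ → Guard) (i : ℤ) :
    trainRule X Y i = trainPre X Y i ∨
      (trainPre X Y i = .o ∧ trainRule X Y i = .d ∧ Landing Y i) := by
  unfold trainRule
  split_ifs with h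
  · exact Or.inr ⟨h.2.2, rfl, h.1⟩
  · exact Or.inl rfl

theorem trainPre_of_not_overwritten (h : ¬ Overwritten X Y i) :
    trainPre X Y i = trainLocal X Y i := by
  unfold Overwritten at h
  unfold trainPre Overwritten
  rw [if_neg (by tauto), if_neg (by tauto), if_neg (by tauto)]

theorem Push.tip (h : Push X Y i) : X i = .t ∧ (X (i - 1)).IsR := h.1

theorem trainPre_of_push (h : Push X Y (i - 2)) : trainPre X Y i = .t := if_pos h

theorem trainRule_of_push (h : Push X Y (i - 2)) : trainRule X Y i = .t := by
  have := trainPre_of_push h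
  rcases trainRule_cases X Y i with h1 | h1
  · rw [h1, this]
  · rw [this] at h1; exact absurd h1.1 (by decide)

theorem trainRule_of_push' (h : Push X Y (i - 1) ∨ Push X Y i) (h' : ¬ Push X Y (i - 2)) :
    trainRule X Y i = .b := by
  have : trainPre X Y i = .b := by rw [trainPre, if_neg h', if_pos h]
  rcases trainRule_cases X Y i with h1 | h1
  · rw [h1, this]
  · rw [this] at h1; exact absurd h1.1 (by decide)

/-- A cell that is neither a tip nor right of a tip follows the local rule, or becomes unable to
support a train. -/
theorem trainRule_local_or_stop (h1 : X i ≠ .t) (h2 : X (i - 1) ≠ .t) :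
    trainRule X Y i = trainLocal X Y i ∨ (trainRule X Y i).Stop := by
  have hp1 : ¬ Push X Y i := fun h => h1 h.tip.1
  have hp2 : ¬ Push X Y (i - 1) := fun h => h2 h.tip.1
  rcases trainRule_cases X Y i with h | h
  · rw [h]
    unfold trainPre
    rw [if_neg (by tauto : ¬ (Push X Y (i - 1) ∨ Push X Y i))]
    split_ifs
    · exact Or.inr (Or.inr (Or.inr rfl))
    · exact Or.inr (Or.inl rfl)
    · exact Or.inl rfl
  · exact Or.inr (Or.inr (Or.inl h.2.1))

theorem trainRule_local_or_stop' (h1 : X i ≠ .t) :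
    trainRule X Y i = trainLocal X Y i ∨ (trainRule X Y i).Stop ∨
      (trainRule X Y i = .b ∧ Push X Y (i - 1)) := by
  by_cases h2 : X (i - 1) = .t
  · by_cases hp : Push X Y (i - 1)
    · by_cases hp' : Push X Y (i - 2)
      · exact Or.inr (Or.inl (Or.inr (Or.inr (trainRule_of_push hp'))))
      · exact Or.inr (Or.inr ⟨trainRule_of_push' (Or.inl hp) hp', hp⟩)
    · have hp1 : ¬ Push X Y i := fun h => h1 h.tip.1
      rcases trainRule_cases X Y i with h | h
      · rw [h]
        unfold trainPre
        rw [if_neg (by tauto : ¬ (Push X Y (i - 1) ∨ Push X Y i))]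
        split_ifs
        · exact Or.inr (Or.inl (Or.inr (Or.inr rfl)))
        · exact Or.inr (Or.inl (Or.inl rfl))
        · exact Or.inl rfl
      · exact Or.inr (Or.inl (Or.inr (Or.inl h.2.1)))
  · rcases trainRule_local_or_stop h1 h2 with h | h
    · exact Or.inl h
    · exact Or.inr (Or.inl h)

theorem trainRule_eq_pre {c : Train} (hc : c ≠ .d) (h : trainRule X Y i = c) :
    trainPre X Y i = c := by
  rcases trainRule_cases X Y i with h1 | h1
  · rw [← h1, h]
  · rw [h] at h1; exact absurd h1.2.1 hc

/-- A result other than open space, a dead cell, a tip or a trail comes from the local rule. -/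
theorem trainRule_eq_local {c : Train} (hc : c ≠ .d ∧ c ≠ .t ∧ c ≠ .b ∧ c ≠ .o)
    (h : trainRule X Y i = c) : ¬ Overwritten X Y i ∧ trainLocal X Y i = c := by
  have h1 := trainRule_eq_pre hc.1 h
  have h2 : ¬ Overwritten X Y i := by
    intro ho
    unfold trainPre at h1
    split_ifs at h1 <;> subst h1 <;> simp at hc
  rw [trainPre_of_not_overwritten h2] at h1
  exact ⟨h2, h1⟩

/-- A cell that is not overwritten and not opened follows the local rule. -/
theorem trainRule_of_local {c : Train} (ho : ¬ Overwritten X Y i) (h : trainLocal X Y i = c)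
    (hc : c ≠ .o) : trainRule X Y i = c := by
  have h1 := trainPre_of_not_overwritten ho
  rcases trainRule_cases X Y i with h2 | h2
  · rw [h2, h1, h]
  · rw [h1, h] at h2; exact absurd h2.1 hc

theorem trainRule_eq_t (h : trainRule X Y i = .t) : Push X Y (i - 2) ∨
    (¬ Overwritten X Y i ∧ X i = .t ∧ X (i - 1) = .b ∧
      ((X (i - 2)).IsR ∨ X (i - 2) = .b)) := by
  have h1 := trainRule_eq_pre (by decide) h
  by_cases hp : Push X Y (i - 2)
  · exact Or.inl hp
  right
  have h2 : ¬ Overwritten X Y i := by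
    intro ho
    unfold trainPre at h1
    rw [if_neg hp] at h1
    split_ifs at h1
  rw [trainPre_of_not_overwritten h2] at h1
  refine ⟨h2, ?_⟩
  unfold trainLocal at h1
  split at h1 <;> try split_ifs at h1
  all_goals first
    | exact ⟨by assumption, by tauto⟩
    | (rename_i hR hL; exact absurd h1 hL.ne.2.2.2.2.2.2.1)
    | simp_all [Train.IsL]

/-- The cells left of the tip at `τ` look like a train in the state `(V, φ)` with signal `σ`, up to
the offset `e`; the train is complete, or the next cell is a defect, or at least `K` cells are
known. -/
structure TrainAt (X : ℤ → Train) (τ V φ : ℤ) (σ : Train) (e K : ℤ) : Prop where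
  phase : IsPhase V φ
  kind : KindOk V φ σ
  nonneg : 0 ≤ e
  le : e ≤ tW V φ
  pat : ∀ j, 0 ≤ j → j ≤ e → X (τ - j) = tpat V φ σ j
  brk : e = tW V φ ∨ ¬ (X (τ - e)).Accepts (X (τ - e - 1)) ∨ K ≤ e

/-- For the trail that a foreign tip may write over a train: between the signal and the head such a
cell is a defect. -/
theorem not_accepts_b_of_le {V φ j : ℤ} {σ : Train} (hp : IsPhase V φ) (hk : KindOk V φ σ)
    (h : tso V φ ≤ j) (hj : j < tW V φ) : ¬ (tpat V φ σ j).Accepts .b := by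
  intro ⟨_, _, h3⟩
  rcases h.eq_or_lt with rfl | h
  · rw [tpat_s σ hp rfl] at h3
    have : σ.IsR ∨ σ.IsL := by
      rcases le_or_gt (φ + 2) V with h4 | h4
      · exact Or.inl (hk.1 h4)
      · exact Or.inr (hk.2 h4)
    have := h3 (Or.inr this)
    simp at this
  · have := h3 (Or.inl (tpat_a σ hp h hj)); simp at this

/-- The tip of a train after one step comes from a tip before this step, and the train has
evolved like a counter. -/
theorem TrainAt.step {K u : ℤ} (hK : 2 ≤ K) (hu : trainRule X Y u = .t) :
    ∃ v, X v = .t ∧ ((u = v + 2 ∧ Push X Y v) ∨ (u = v ∧ ¬ Overwritten X Y u)) ∧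
      ∀ V φ σ e, TrainAt X v V φ σ e K → u = v + tshift V φ ∧
        ∃ e', TrainAt (trainRule X Y) u (nextV V φ) (nextφ V φ) (nextσ X Y v V φ σ) e' (K - 2) ∧
          (e < tso V φ → e' < tso (nextV V φ) (nextφ V φ)) := by
  have main : ∀ v V φ σ e, TrainAt X v V φ σ e K → 1 ≤ e → u = v + tshift V φ →
      (φ + 2 = V → Push X Y v) → (φ + 2 ≠ V → ¬ Push X Y (v - 2)) →
      ∃ e', TrainAt (trainRule X Y) u (nextV V φ) (nextφ V φ) (nextσ X Y v V φ σ) e' (K - 2) ∧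
          (e < tso V φ → e' < tso (nextV V φ) (nextφ V φ)) := by
    intro v V φ σ e h he hv ht hnt
    have hp := h.phase
    have hk := h.kind
    have hp' := hp.next
    have hk' := kindOk_next (X := X) (Y := Y) (τ := v) hp hk
    obtain ⟨h1, h2, h3⟩ := id hp
    set V' := nextV V φ with hV'
    set φ' := nextφ V φ with hφ'
    set σ' := nextσ X Y v V φ σ with hσ'
    have hso := hp.tso_pos
    have hsW := hp.tso_lt
    have hso' := hp'.tso_pos
    have hsW' := hp'.tso_lt
    set s := tshift V φ with hs
    -- The tip moves by two cells when the signal arrives there, and the head by one cell in the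
    -- last phase; so both the length and the position of the head grow by one per period.
    have sizes : (φ = 2 * V - 3 ∧ s = 0 ∧ φ + 2 ≠ V ∧ tW V φ = V + 2 ∧ tW V' φ' = V + 1 ∧
        tso V φ = V + 1 ∧ tso V' φ' = V) ∨
      (φ < 2 * V - 3 ∧ tW V' φ' = tW V φ + s ∧
        ((φ + 2 = V ∧ s = 2 ∧ tso V φ = 1) ∨ (φ + 2 ≠ V ∧ s = 0 ∧ tso V φ ≤ tso V' φ' + 1))) := by
      rcases h3.eq_or_lt with h4 | h4
      · left
        rw [hV', hφ', (next_of_eq h4).1, (next_of_eq h4).2, hs, tshift, if_neg (by omega),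
          tW_of_lt (by omega), tW_of_le (by omega), tso_of_lt (by omega), tso_of_le (by omega)]
        omega
      · right
        rw [hV', hφ', (next_of_lt h4).1, (next_of_lt h4).2, hs]
        unfold tshift tW tso
        split_ifs <;> omega
    have hs02 : s = 0 ∨ s = 2 := by omega
    have stopped : ∀ k, 0 < k → k ≤ tW V' φ' → (trainRule X Y (u - k)).Stop →
        ¬ (tpat V' φ' σ' (k - 1)).Accepts (trainRule X Y (u - k)) := by
      intro k hk1 hk2 hst
      exact tpat_not_accepts hp' hk' (by omega) (by omega) hst
    have hne : ∀ j, 0 < j → j ≤ e → X (v - j) ≠ .t := by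
      intro j hj hj'
      rw [h.pat j hj.le hj']
      exact tpat_ne_t hk (by omega)
    have h0 : trainRule X Y (u - 0) = tpat V' φ' σ' 0 := by rw [sub_zero, hu, tpat_t]
    -- the cells that are known before the step
    have inside : ∀ k, s < k → k ≤ tW V' φ' →
        (k - s < e ∨ (k - s = e ∧ e = tW V φ ∧ φ ≠ 2 * V - 3)) →
        (k - s + 2 ≤ e ∨ e = tW V φ ∨ ¬ (X (v - e)).Accepts (X (v - e - 1))) →
        trainRule X Y (u - k) = tpat V' φ' σ' k ∨
          ¬ (tpat V' φ' σ' (k - 1)).Accepts (trainRule X Y (u - k)) := by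
      intro k hk1 hkW hk2 hk3
      have hi : u - k = v - (k - s) := by omega
      have hloc := trainLocal_of_pat (Y := Y) hp hk h.le h.pat (j := k - s) (by omega) hk2 hk3 ht
      rw [← hi, ← hs, sub_add_cancel] at hloc
      have hloc' : trainRule X Y (u - k) = trainLocal X Y (u - k) →
          trainRule X Y (u - k) = tpat V' φ' σ' k ∨
          ¬ (tpat V' φ' σ' (k - 1)).Accepts (trainRule X Y (u - k)) := by
        intro h5
        rcases hloc with h6 | h6
        · exact Or.inl (by rw [h5, h6])
        · right
          exact stopped k (by omega) hkW (by rw [h5, h6.1]; exact Or.inr (Or.inl rfl))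
      rcases trainRule_local_or_stop' (X := X) (Y := Y) (i := u - k)
        (by rw [hi]; exact hne _ (by omega) (by omega)) with h5 | h5 | ⟨h5, h6⟩
      · exact hloc' h5
      · exact Or.inr (stopped k (by omega) hkW h5)
      · rcases hk2 with hk2 | hk2
        · exfalso
          apply hne (k - s + 1) (by omega) (by omega)
          rw [show v - (k - s + 1) = u - k - 1 by omega]
          exact h6.tip.1
        · right
          rw [h5]
          exact not_accepts_b_of_le hp' hk' (by omega) (by omega)
    have low : ∀ k, 0 ≤ k → k ≤ s → k ≤ tW V' φ' →
        trainRule X Y (u - k) = tpat V' φ' σ' k ∨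
          ¬ (tpat V' φ' σ' (k - 1)).Accepts (trainRule X Y (u - k)) := by
      intro k hk1 hk2 hkW
      rcases hk1.eq_or_lt with rfl | hk1
      · exact Or.inl h0
      have h5 : φ + 2 = V := by omega
      have hpush := ht h5
      have hso3 : tso V' φ' = 3 := by
        rw [hV', hφ', (next_of_lt (by omega)).1, (next_of_lt (by omega)).2, tso_of_lt (by omega)]
        omega
      rw [tpat_b σ' hp' hk1 (by omega)]
      rcases (by omega : k = 1 ∨ k = 2) with rfl | rfl
      · left
        apply trainRule_of_push' (Or.inl (by rw [show u - 1 - 1 = v by omega]; exact hpush))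
        intro hc
        have := hc.tip.1
        rw [show u - 1 - 2 = v - 1 by omega] at this
        exact hne 1 one_pos he this
      · by_cases hc : Push X Y (u - 2 - 2)
        · exact Or.inr (stopped 2 (by omega) (by omega)
            (by rw [trainRule_of_push hc]; exact Or.inr (Or.inr rfl)))
        · left
          exact trainRule_of_push' (Or.inr (by rw [show u - 2 = v by omega]; exact hpush)) hc
    have finish : ∀ m e', (∀ k, 0 ≤ k → k ≤ e' → trainRule X Y (u - k) = tpat V' φ' σ' k) →
        0 ≤ e' → e' ≤ m → m ≤ tW V' φ' → (e' = m ∨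
          ¬ (tpat V' φ' σ' (e' + 1 - 1)).Accepts (trainRule X Y (u - (e' + 1)))) →
        (e' = m → e' = tW V' φ' ∨ ¬ (trainRule X Y (u - e')).Accepts (trainRule X Y (u - e' - 1)) ∨
          K - 2 ≤ e') →
        TrainAt (trainRule X Y) u V' φ' σ' e' (K - 2) := by
      intro m e' a1 a2 a3 a4 a5 a6
      refine ⟨hp', hk', a2, by omega, a1, ?_⟩
      rcases a5 with a5 | a5
      · exact a6 a5
      · right; left
        rw [a1 e' a2 le_rfl]
        rwa [add_sub_cancel_right, show u - (e' + 1) = u - e' - 1 by ring] at a5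
    rcases h.le.eq_or_lt with heW | heW
    · -- complete
      obtain ⟨e', a1, a2, a3, a4⟩ := exists_defect
        (P := fun k => trainRule X Y (u - k) = tpat V' φ' σ' k)
        (Q := fun k => ¬ (tpat V' φ' σ' (k - 1)).Accepts (trainRule X Y (u - k)))
        (m := tW V' φ') (by omega) h0 (by
          intro k hk1 hk2
          rcases le_or_gt k s with h5 | h5
          · exact low k hk1 h5 hk2
          · exact inside k h5 hk2 (by omega) (Or.inr (Or.inl heW)))
      exact ⟨e', finish _ e' a3 a1 a2 le_rfl a4 (fun h => Or.inl h), fun h5 => by omega⟩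
    -- A defect kills the last known cell. A mere truncation costs two cells, because the cell right
    -- of a signal looks two cells to its left.
    · by_cases hb : ¬ (X (v - e)).Accepts (X (v - e - 1))
      · obtain ⟨e', a1, a2, a3, a4⟩ := exists_defect
          (P := fun k => trainRule X Y (u - k) = tpat V' φ' σ' k)
          (Q := fun k => ¬ (tpat V' φ' σ' (k - 1)).Accepts (trainRule X Y (u - k)))
          (m := e - 1 + s) (by omega) h0 (by
            intro k hk1 hk2
            rcases le_or_gt k s with h5 | h5
            · exact low k hk1 h5 (by omega)
            · exact inside k h5 (by omega) (by omega) (Or.inr (Or.inr hb)))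
        refine ⟨e', finish _ e' a3 a1 a2 (by omega) a4 (fun h5 => ?_), fun h5 => by omega⟩
        right; left
        rw [a3 e' a1 le_rfl]
        have hi : u - e' - 1 = v - e := by omega
        have key : (trainRule X Y (u - e' - 1)).Stop := by
          rw [hi]
          rcases trainRule_local_or_stop' (X := X) (Y := Y) (i := v - e)
            (hne e (by omega) le_rfl) with h6 | h6 | ⟨h6, h7⟩
          · rw [h6, trainLocal_of_not_accepts (hne e (by omega) le_rfl) hb]
            exact Or.inr (Or.inl rfl)
          · exact h6
          · exfalso
            have h8 : trainRule X Y (u - e') = .t := by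
              apply trainRule_of_push
              rw [show u - e' - 2 = v - e - 1 by omega]; exact h7
            rw [a3 e' a1 le_rfl] at h8
            rcases a1.eq_or_lt with h9 | h9
            · apply hnt (by omega)
              rw [show v - 2 = v - e - 1 by omega]; exact h7
            · exact tpat_ne_t hk' (by omega) h8
        exact tpat_not_accepts hp' hk' a1 (by omega) key
      · have hKe : K ≤ e := by
          rcases h.brk with h5 | h5 | h5
          · omega
          · exact absurd h5 hb
          · exact h5
        obtain ⟨e', a1, a2, a3, a4⟩ := exists_defect
          (P := fun k => trainRule X Y (u - k) = tpat V' φ' σ' k)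
          (Q := fun k => ¬ (tpat V' φ' σ' (k - 1)).Accepts (trainRule X Y (u - k)))
          (m := e - 2 + s) (by omega) h0 (by
            intro k hk1 hk2
            rcases le_or_gt k s with h5 | h5
            · exact low k hk1 h5 (by omega)
            · exact inside k h5 (by omega) (by omega) (Or.inl (by omega)))
        exact ⟨e', finish _ e' a3 a1 a2 (by omega) a4 (fun h5 => Or.inr (Or.inr (by omega))),
          fun h5 => by omega⟩
  have one : ∀ v V φ σ e, TrainAt X v V φ σ e K → X v = .t → (X (v - 1) = .b ∨ (X (v - 1)).IsR) →
      1 ≤ e ∧ X (v - 1) = tpat V φ σ 1 := by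
    intro v V φ σ e h hv hacc
    have he : 1 ≤ e := by
      by_contra hc
      have h0 : e = 0 := by have := h.nonneg; omega
      have := h.phase.tso_pos
      have := h.phase.tso_lt
      rcases h.brk with h5 | h5 | h5
      · omega
      · rw [h0, sub_zero, hv] at h5
        exact h5 ⟨fun _ => hacc, fun h => by simp at h, fun h => by simp [Train.IsR, Train.IsL] at h⟩
      · omega
    exact ⟨he, h.pat 1 (by omega) he⟩
  have hone : ∀ V φ σ, IsPhase V φ → KindOk V φ σ →
      (φ + 2 = V ∧ (tpat V φ σ 1).IsR) ∨ (φ + 2 ≠ V ∧ tpat V φ σ 1 = .b) := by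
    intro V φ σ hp hk
    obtain ⟨h1, h2, h3⟩ := id hp
    rcases eq_or_ne (φ + 2) V with h | h
    · left
      rw [tpat_s σ hp (by rw [tso_of_le h.le]; omega)]
      exact ⟨h, hk.1 h.le⟩
    · exact Or.inr ⟨h, tpat_b σ hp one_pos (by unfold tso; split_ifs <;> omega)⟩
  by_cases hpush : Push X Y (u - 2)
  · refine ⟨u - 2, hpush.tip.1, Or.inl ⟨by ring, hpush⟩, fun V φ σ e h => ?_⟩
    obtain ⟨he, h3⟩ := one _ _ _ _ _ h hpush.tip.1 (Or.inr hpush.tip.2)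
    have h4 : φ + 2 = V := by
      rcases hone V φ σ h.phase h.kind with h5 | h5
      · exact h5.1
      · rw [← h3] at h5
        exact absurd h5.2 hpush.tip.2.ne.2.2.2.2.2.1
    have h6 : u = u - 2 + tshift V φ := by rw [tshift, if_pos h4]; ring
    exact ⟨h6, main _ _ _ _ _ h he h6 (fun _ => hpush) (fun h => absurd h4 h)⟩
  · rcases trainRule_eq_t hu with h5 | ⟨h5, h6, h7, h8⟩
    · exact absurd h5 hpush
    refine ⟨u, h6, Or.inr ⟨rfl, h5⟩, fun V φ σ e h => ?_⟩
    obtain ⟨he, h3⟩ := one _ _ _ _ _ h h6 (Or.inl h7)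
    have h4 : φ + 2 ≠ V := by
      rcases hone V φ σ h.phase h.kind with h9 | h9
      · rw [← h3] at h9
        exact absurd h7 h9.2.ne.2.2.2.2.2.1
      · exact h9.1
    have h9 : u = u + tshift V φ := by rw [tshift, if_neg h4]; ring
    exact ⟨h9, main _ _ _ _ _ h he h9 (fun h => absurd h h4) (fun _ => hpush)⟩

end


/-! ### Reading trains. -/

/-- Reading a train from its tip. -/
theorem train_walk (X : ℤ → Train) (τ : ℤ) (ht : X τ = .t)
    (h2 : ¬ (X (τ - 1) = .b ∧ (X (τ - 2)).IsL)) (k : ℤ) (hk : 0 ≤ k) :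
    ∃ e, 0 ≤ e ∧ e ≤ k ∧
      ((((∀ j, 0 < j → j ≤ e → X (τ - j) = .b) ∨
        ∃ q, 0 < q ∧ q ≤ e ∧ (∀ j, 0 < j → j < q → X (τ - j) = .b) ∧
          ((X (τ - q)).IsR ∨ ((X (τ - q)).IsL ∧ 3 ≤ q)) ∧ ∀ j, q < j → j ≤ e → X (τ - j) = .a) ∧
        (e = k ∨ ¬ (X (τ - e)).Accepts (X (τ - e - 1)))) ∨
      ∃ q, 0 < q ∧ q < e ∧ (∀ j, 0 < j → j < q → X (τ - j) = .b) ∧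
          ((X (τ - q)).IsR ∨ ((X (τ - q)).IsL ∧ 3 ≤ q)) ∧ (∀ j, q < j → j < e → X (τ - j) = .a) ∧
          X (τ - e) = .h) := by
  induction k, hk using Int.leInduction with
  | base => exact ⟨0, le_rfl, le_rfl, Or.inl ⟨Or.inl fun j h1 h2 => by omega, Or.inl rfl⟩⟩
  | succ k hk ih =>
    obtain ⟨e, h0, he, h⟩ := ih
    rcases h with ⟨h3, h4⟩ | h3
    swap
    · exact ⟨e, h0, by omega, Or.inr h3⟩
    by_cases hacc : (X (τ - e)).Accepts (X (τ - e - 1))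
    swap
    · exact ⟨e, h0, by omega, Or.inl ⟨h3, Or.inr hacc⟩⟩
    rcases h4 with rfl | h4
    swap
    · exact absurd hacc h4
    rw [show τ - e - 1 = τ - (e + 1) by ring] at hacc
    refine ⟨e + 1, by omega, le_rfl, ?_⟩
    rcases h3 with h3 | ⟨q, hq, hq', h3, h4, h5⟩
    · have hx : X (τ - (e + 1)) = .b ∨ (X (τ - (e + 1))).IsR ∨
          ((X (τ - (e + 1))).IsL ∧ 3 ≤ e + 1) := by
        rcases h0.eq_or_lt with rfl | h0
        · rw [sub_zero] at hacc
          rcases hacc.1 ht with h | h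
          · exact Or.inl h
          · exact Or.inr (Or.inl h)
        · rcases hacc.2.1 (h3 e h0 le_rfl) with h | h | h
          · exact Or.inl h
          · exact Or.inr (Or.inl h)
          · refine Or.inr (Or.inr ⟨h, ?_⟩)
            by_contra hc
            have : e = 1 := by omega
            subst this
            exact h2 ⟨h3 1 one_pos le_rfl, h⟩
      left
      refine ⟨?_, Or.inl rfl⟩
      rcases hx with hx | hx
      · left
        intro j hj hj'
        rcases hj'.eq_or_lt with rfl | hj'
        · exact hx
        · exact h3 j hj (by omega)
      · exact Or.inr ⟨e + 1, by omega, le_rfl, fun j h5 h6 => h3 j h5 (by omega), hx,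
          fun j h5 h6 => by omega⟩
    · have hx : X (τ - (e + 1)) = .h ∨ X (τ - (e + 1)) = .a := by
        apply hacc.2.2
        rcases hq'.eq_or_lt with rfl | hq'
        · rcases h4 with h4 | h4
          · exact Or.inr (Or.inl h4)
          · exact Or.inr (Or.inr h4.1)
        · exact Or.inl (h5 e hq' le_rfl)
      rcases hx with hx | hx
      · right
        exact ⟨q, hq, by omega, h3, h4, fun j h6 h7 => h5 j h6 (by omega), hx⟩
      · left
        refine ⟨Or.inr ⟨q, hq, by omega, h3, h4, fun j h6 h7 => ?_⟩, Or.inl rfl⟩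
        rcases h7.eq_or_lt with rfl | h7
        · exact hx
        · exact h5 j h6 (by omega)

/-- Every tip belongs to a train, of positive age unless it is a complete train of age `0`. -/
theorem exists_trainAt (X : ℤ → Train) (τ : ℤ) (ht : X τ = .t)
    (h2 : ¬ (X (τ - 1) = .b ∧ (X (τ - 2)).IsL)) (K : ℤ) (hK : 0 ≤ K) :
    ∃ V φ σ e, TrainAt X τ V φ σ e K ∧
      (1 ≤ age V φ ∨ ((X (τ - 1)).IsR ∧ X (τ - 2) = .h)) := by
  obtain ⟨e, h0, he, h⟩ := train_walk X τ ht h2 K hK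
  rcases h with ⟨h3, h4⟩ | ⟨q, hq, hq', h3, h4, h5, h6⟩
  · have hbrk : e = K ∨ ¬ (X (τ - e)).Accepts (X (τ - e - 1)) → ∀ W : ℤ, e = W ∨
        ¬ (X (τ - e)).Accepts (X (τ - e - 1)) ∨ K ≤ e := by
      rintro (h | h) W
      · exact Or.inr (Or.inr h.ge)
      · exact Or.inr (Or.inl h)
    rcases h3 with h3 | ⟨q, hq, hq', h3, h5, h6⟩
    -- No signal has been read. In this state it has the offset `e + 3`, beyond the known cells, so
    -- its kind can be chosen at will.
    · have hp : IsPhase (e + 2) (2 * e + 1) := by unfold IsPhase; omega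
      have w := tW_of_lt (V := e + 2) (φ := 2 * e + 1) (by omega)
      have s := tso_of_lt (V := e + 2) (φ := 2 * e + 1) (by omega)
      refine ⟨e + 2, 2 * e + 1, .ln, e, ⟨hp, ⟨fun h => by omega, fun _ => Or.inl rfl⟩, h0, by omega,
        fun j hj hj' => ?_, hbrk h4 _⟩, Or.inl (by unfold age; nlinarith)⟩
      rcases hj.eq_or_lt with rfl | hj
      · rw [sub_zero, ht, tpat_t]
      · rw [h3 j hj hj', tpat_b _ hp hj (by omega)]
    · rcases h5 with h5 | ⟨h5, h7⟩
      · have hp : IsPhase (e + 2) (e + 1 - q) := by unfold IsPhase; omega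
        have w := tW_of_le (V := e + 2) (φ := e + 1 - q) (by omega)
        have s := tso_of_le (V := e + 2) (φ := e + 1 - q) (by omega)
        refine ⟨e + 2, e + 1 - q, X (τ - q), e, ⟨hp, ⟨fun _ => h5, fun h => by omega⟩, h0, by omega,
          fun j hj hj' => ?_, hbrk h4 _⟩, Or.inl (by unfold age; nlinarith)⟩
        rcases hj.eq_or_lt with rfl | hj
        · rw [sub_zero, ht, tpat_t]
        rcases lt_trichotomy j q with h8 | rfl | h8
        · rw [h3 j hj h8, tpat_b _ hp hj (by omega)]
        · rw [tpat_s _ hp (by omega)]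
        · rw [h6 j h8 hj', tpat_a _ hp (by omega) (by omega)]
      · have hp : IsPhase (e + 2) (q + e - 2) := by unfold IsPhase; omega
        have w := tW_of_lt (V := e + 2) (φ := q + e - 2) (by omega)
        have s := tso_of_lt (V := e + 2) (φ := q + e - 2) (by omega)
        refine ⟨e + 2, q + e - 2, X (τ - q), e, ⟨hp, ⟨fun h => by omega, fun _ => h5⟩, h0, by omega,
          fun j hj hj' => ?_, hbrk h4 _⟩, Or.inl (by unfold age; nlinarith)⟩
        rcases hj.eq_or_lt with rfl | hj
        · rw [sub_zero, ht, tpat_t]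
        rcases lt_trichotomy j q with h8 | rfl | h8
        · rw [h3 j hj h8, tpat_b _ hp hj (by omega)]
        · rw [tpat_s _ hp (by omega)]
        · rw [h6 j h8 hj', tpat_a _ hp (by omega) (by omega)]
  · have : ∃ V φ, IsPhase V φ ∧ KindOk V φ (X (τ - q)) ∧ tW V φ = e ∧ tso V φ = q ∧
        (1 ≤ age V φ ∨ ((X (τ - 1)).IsR ∧ X (τ - 2) = .h)) := by
      rcases h4 with h4 | ⟨h4, h7⟩
      · refine ⟨e, e - 1 - q, by unfold IsPhase; omega, ⟨fun _ => h4, fun h => by omega⟩,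
          tW_of_le (by omega), by rw [tso_of_le (by omega)]; ring, ?_⟩
        rcases (by omega : e = 2 ∨ 3 ≤ e) with h8 | h8
        · right
          have : q = 1 := by omega
          subst this; subst h8
          exact ⟨h4, h6⟩
        · left; unfold age; nlinarith
      · refine ⟨e - 2, q + e - 6, by unfold IsPhase; omega, ⟨fun h => by omega, fun _ => h4⟩,
          by rw [tW_of_lt (by omega)]; ring, by rw [tso_of_lt (by omega)]; ring, ?_⟩
        left; unfold age; nlinarith
    obtain ⟨V, φ, hp, hk, w, s, ha⟩ := this
    refine ⟨V, φ, X (τ - q), e, ⟨hp, hk, h0, w.ge, fun j hj hj' => ?_, Or.inl w.symm⟩, ha⟩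
    rcases hj.eq_or_lt with rfl | hj
    · rw [sub_zero, ht, tpat_t]
    rcases hj'.eq_or_lt with rfl | hj'
    · rw [h6, tpat_h _ hp w.symm]
    rcases lt_trichotomy j q with h8 | rfl | h8
    · rw [h3 j hj h8, tpat_b _ hp hj (by omega)]
    · rw [tpat_s _ hp s.symm]
    · rw [h5 j h8 hj', tpat_a _ hp (by omega) (by omega)]

/-! ### Origins of signals and heads, and the configuration left by the seeds. -/

section
variable {X : ℤ → Train} {Y : ℤ → Guard} {i : ℤ}

/-- For tracing a left-moving signal back in time: among all clauses of the rule, only the birth at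
a moving tip and the copy from the right neighbour produce one. -/
theorem trainLocal_isL (h : (trainLocal X Y i).IsL) : (X (i - 1) = .h ∨ X (i - 1) = .a) ∧
    (((X i).IsR ∧ Push X Y (i + 1)) ∨ (X i = .a ∧ X (i + 1) = trainLocal X Y i ∧
      ¬ Dead X Y (i + 1))) := by
  cases hx : X i
  case r =>
    by_cases hp : Push X Y (i + 1) <;> by_cases hl : X (i - 1) = .h ∨ X (i - 1) = .a
    · exact ⟨hl, Or.inl ⟨Or.inl rfl, hp⟩⟩
    all_goals exfalso; simp [trainLocal, hx, hp, hl, Train.IsL] at h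
  case rt =>
    by_cases hp : Push X Y (i + 1) <;> by_cases hl : X (i - 1) = .h ∨ X (i - 1) = .a
    · exact ⟨hl, Or.inl ⟨Or.inr rfl, hp⟩⟩
    all_goals exfalso; simp [trainLocal, hx, hp, hl, Train.IsL] at h
  case a =>
    have := h.ne
    by_cases hl : X (i - 1) = .h ∨ X (i - 1) = .a
    swap
    · exfalso; simp [trainLocal, hx, hl] at this
    refine ⟨hl, Or.inr ?_⟩
    by_cases hL : (X (i + 1)).IsL
    · by_cases hd : Dead X Y (i + 1)
      · exfalso; simp [trainLocal, hx, hl, hL, hd] at this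
      · exact ⟨rfl, (trainLocal_a_l hx hl hL hd).symm, hd⟩
    · exfalso
      by_cases ho : X (i + 1) = .o
      · simp [trainLocal, hx, hl, ho, Train.IsL] at h
      · simp [trainLocal, hx, hl, ho, hL] at this
  case b =>
    exfalso
    simp only [trainLocal, hx] at h
    split_ifs at h with h1 <;> first | exact h1.ne.2.2.2.2.2.2.2 h | simp [Train.IsL] at h
  all_goals
    exfalso
    simp only [trainLocal, hx] at h
    first | (split_ifs at h <;> simp [Train.IsL] at h) | simp [Train.IsL] at h

theorem trainRule_isL (h : (trainRule X Y i).IsL) : ¬ Overwritten X Y i ∧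
    (X (i - 1) = .h ∨ X (i - 1) = .a) ∧
    (((X i).IsR ∧ Push X Y (i + 1)) ∨ (X i = .a ∧ X (i + 1) = trainRule X Y i ∧
      ¬ Dead X Y (i + 1))) := by
  have h1 := h.ne
  obtain ⟨h2, h3⟩ := trainRule_eq_local (X := X) (Y := Y) (i := i)
    ⟨h1.2.1, h1.2.2.2.2.2.2.1, h1.2.2.2.2.2.1, h1.1⟩ rfl
  rw [← h3] at h ⊢
  exact ⟨h2, trainLocal_isL h⟩

theorem trainRule_ne_s : trainRule X Y i ≠ .s := by
  intro h
  obtain ⟨-, h3⟩ := trainRule_eq_local (X := X) (Y := Y) (i := i) (by simp) h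
  cases hx : X i
  case b =>
    simp only [trainLocal, hx] at h3
    split_ifs at h3 with h4
    exact h4.ne.2.2.1 h3
  case a =>
    simp only [trainLocal, hx] at h3
    split_ifs at h3 with h4 h5
    exact h5.ne.2.2.1 h3
  all_goals first
    | (simp only [trainLocal, hx] at h3; split_ifs at h3)
    | (simp [trainLocal, hx] at h3)

/-- A signal to the right comes from such a signal or from a head that has been hit. -/
theorem trainRule_isR (h : (trainRule X Y i).IsR) : ¬ Overwritten X Y i ∧ X i = .b ∧
    (((X (i - 1)).IsR ∧ X (i - 1) = trainRule X Y i) ∨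
      ((X (i - 1)).IsL ∧ X (i - 2) = .h ∧ ¬ Dead X Y (i - 1))) := by
  have h1 := h.ne
  obtain ⟨h2, h3⟩ := trainRule_eq_local (X := X) (Y := Y) (i := i)
    ⟨h1.2.1, h1.2.2.2.2.2.2.1, h1.2.2.2.2.2.1, h1.1⟩ rfl
  refine ⟨h2, ?_⟩
  rw [← h3] at h h1 ⊢
  cases hx : X i
  case b =>
    refine ⟨rfl, ?_⟩
    simp only [trainLocal, hx] at h1 ⊢
    split_ifs at h1 ⊢ <;> simp_all
  case a =>
    exfalso
    simp only [trainLocal, hx] at h1 h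
    split_ifs at h1 h with _ hL _ <;> first | exact hL.ne.2.2.2.2.2.2.2 h | simp at h1
  all_goals
    exfalso
    simp only [trainLocal, hx] at h
    first | (split_ifs at h <;> simp [Train.IsR] at h) | (simp [Train.IsR] at h)

/-- A head comes from a head or a signal. -/
theorem trainRule_h (h : trainRule X Y i = .h) : ¬ Overwritten X Y i ∧ (X i = .h ∨ (X i).IsL) := by
  obtain ⟨h2, h3⟩ := trainRule_eq_local (X := X) (Y := Y) (i := i) (by simp) h
  refine ⟨h2, ?_⟩
  cases hx : X i
  case b =>
    exfalso
    simp only [trainLocal, hx] at h3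
    split_ifs at h3 with h4
    exact h4.ne.2.2.2.1 h3
  case a =>
    exfalso
    simp only [trainLocal, hx] at h3
    split_ifs at h3 with h4 h5
    exact h5.ne.2.2.2.1 h3
  all_goals first
    | exact Or.inl rfl
    | exact Or.inr (Or.inl rfl) | exact Or.inr (Or.inr (Or.inl rfl))
    | exact Or.inr (Or.inr (Or.inr rfl))
    | (exfalso; simp only [trainLocal, hx] at h3; split_ifs at h3)
    | (exfalso; simp [trainLocal, hx] at h3)

theorem wallRule_cases (X : ℤ → Train) (Y : ℤ → Guard) (i : ℤ) :
    wallRule X Y i = guardRule Y i ∨ wallRule X Y i = .n := by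
  unfold wallRule; split_ifs <;> simp


theorem wallRule_eq_e {X : ℤ → Train} (h : wallRule X Y i = .e) : trainRule X Y i ≠ .o ∧
    ¬ (Landing Y i ∧ Killed X Y (i + 1)) ∧ ¬ (¬ Landing Y i ∧ Killed X Y i) := by
  unfold wallRule at h
  split_ifs at h with h1
  tauto

theorem wallRule_eq_guardRule (h1 : trainRule X Y i ≠ .o)
    (h2 : ¬ (Landing Y i ∧ Killed X Y (i + 1))) (h3 : ¬ (¬ Landing Y i ∧ Killed X Y i)) :
    wallRule X Y i = guardRule Y i := if_neg (by tauto)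

theorem guardRule_eq_g (h : guardRule Y i = .g) : Y i = .g := by
  unfold guardRule at h
  split_ifs at h
  revert h
  generalize Y (i - 1) = x
  cases x <;> cases Y i <;> cases Y (i + 1) <;> decide

theorem wallRule_eq_g (h : wallRule X Y i = .g) : Y i = .g := by
  rcases wallRule_cases X Y i with h1 | h1
  · exact guardRule_eq_g (h1 ▸ h)
  · rw [h1] at h; cases h

/-- Before a root, `r` arises only by passing on a signal, and then the cell on its left was not an
end. This prevents the rule from producing guards of age `0`. -/
theorem guardRule_left_g (h : Y (i + 1) = .g) : guardRule Y i ≠ .e ∧ guardRule Y i ≠ .a ∧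
    (guardRule Y i = .r → Y i = .b ∧ Y (i - 1) = .r) := by
  unfold guardRule
  rw [if_neg (fun hc => by rw [hc.1] at h; cases h), h]
  generalize Y (i - 1) = x
  cases x <;> cases Y i <;> decide

theorem Active.near {p : ℤ} (h : Active X p) (k : ℤ) (hk : |k - p| ≤ 16) :
    Active X k ↔ k = p := by
  refine ⟨fun h' => ?_, fun h' => h' ▸ h⟩
  by_contra hc
  apply h.2 (k - p) (by omega) hk
  rw [add_sub_cancel]; exact h'.1

theorem Active.trainNext_eq {p : ℤ} (h : Active X p) (Y : ℤ → Guard) (hi : |i - p| ≤ 8) :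
    trainNext X Y i = if i = p + 1 then .h else if i = p + 2 then .r else
      if i = p + 3 then .t else .d := by
  have hn : NearActive X i := ⟨p - i, by rwa [abs_sub_comm], by rwa [add_sub_cancel]⟩
  rw [abs_le] at hi
  unfold trainNext
  rw [propext (h.near (i - 1) (by rw [abs_le]; omega)),
    propext (h.near (i - 2) (by rw [abs_le]; omega)),
    propext (h.near (i - 3) (by rw [abs_le]; omega)),
    if_pos hn]
  simp only [sub_eq_iff_eq_add]

theorem Active.wallNext_eq {p : ℤ} (h : Active X p) (Y : ℤ → Guard) (hi : |i - p| ≤ 8) :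
    wallNext X Y i = if i = p - 2 then .e else if i = p - 1 then .r else
      if i = p then .g else .n := by
  have hn : NearActive X i := ⟨p - i, by rwa [abs_sub_comm], by rwa [add_sub_cancel]⟩
  rw [abs_le] at hi
  unfold wallNext
  rw [propext (h.near (i + 1) (by rw [abs_le]; omega)),
    propext (h.near (i + 2) (by rw [abs_le]; omega)),
    propext (h.near i (by rw [abs_le]; omega)),
    if_pos hn]
  simp only [eq_sub_iff_add_eq]
  congr

theorem trainNext_eq_trainRule (Y : ℤ → Guard) (h : ¬ NearActive X i) :
    trainNext X Y i = trainRule X Y i := by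
  unfold trainNext
  rw [if_neg fun hc : Active X (i - 1) => h ⟨-1, by norm_num, hc⟩, if_neg fun hc : Active X (i - 2) => h ⟨-2, by norm_num, hc⟩,
    if_neg fun hc : Active X (i - 3) => h ⟨-3, by norm_num, hc⟩, if_neg h]

theorem wallNext_eq_wallRule (Y : ℤ → Guard) (h : ¬ NearActive X i) :
    wallNext X Y i = wallRule X Y i := by
  unfold wallNext
  rw [if_neg fun hc : Active X (i + 2) => h ⟨2, by norm_num, hc⟩, if_neg fun hc : Active X (i + 1) => h ⟨1, by norm_num, hc⟩,
    if_neg fun hc : Active X i => h ⟨0, by norm_num, by rwa [add_zero]⟩, if_neg h]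

/-- Two layers in which trains and guards of age `0` are exactly those around the points of `A`. -/
structure Start (X : ℤ → Train) (Y : ℤ → Guard) (A : Set ℤ) : Prop where
  seedless : ∀ i, X i ≠ .s
  spaced : ∀ p ∈ A, ∀ q ∈ A, p < q → p + 17 ≤ q
  root_left : ∀ i, Y (i + 1) = .g → Y i ≠ .e ∧ Y i ≠ .a
  guard_new : ∀ i, Y i = .e → Y (i + 1) = .r → Y (i + 2) = .g → i + 2 ∈ A
  tip_left : ∀ i, X i = .t → ¬ (X (i - 1) = .b ∧ (X (i - 2)).IsL)
  train_new : ∀ i, X i = .t → (X (i - 1)).IsR → X (i - 2) = .h → i - 3 ∈ A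
  train_eq : ∀ p ∈ A, ∀ i, |i - p| ≤ 8 → X i = if i = p + 1 then .h else if i = p + 2 then .r else
      if i = p + 3 then .t else .d
  guard_eq : ∀ p ∈ A, ∀ i, |i - p| ≤ 8 → Y i = if i = p - 2 then .e else if i = p - 1 then .r else
      if i = p then .g else .n

/-- An active seed has no other seed within `16` cells and clears everything within `8`, so the
emitted shapes are undisturbed. Away from seeds no object of age `0` can arise. For a guard, `r`
before a root comes from `b` preceded by `r`, which leaves no end there. For a train, `r` after a
head comes from a signal hitting the head, which leaves no tip directly behind. -/
theorem start_next (X : ℤ → Train) (Y : ℤ → Guard) :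
    Start (trainNext X Y) (wallNext X Y) {p | Active X p} := by
  have near : ∀ i, NearActive X i → ∃ p, Active X p ∧ |i - p| ≤ 8 := by
    rintro i ⟨k, hk, h⟩
    exact ⟨i + k, h, by rwa [sub_add_cancel_left, abs_neg]⟩
  have far : ∀ i, ¬ NearActive X i → ∀ p, Active X p → ¬ |i - p| ≤ 8 := by
    intro i h p hp hc
    exact h ⟨p - i, by rwa [abs_sub_comm], by rwa [add_sub_cancel]⟩
  have tc : ∀ i, trainNext X Y i = trainRule X Y i ∨ ∃ p, Active X p ∧ |i - p| ≤ 8 := by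
    intro i
    by_cases h : NearActive X i
    · exact Or.inr (near i h)
    · exact Or.inl (trainNext_eq_trainRule Y h)
  refine ⟨?_, ?_, ?_, ?_, ?_, ?_, fun p hp i hi => hp.trainNext_eq Y hi,
    fun p hp i hi => hp.wallNext_eq Y hi⟩
  · intro i
    rcases tc i with h | ⟨p, hp, hi⟩
    · rw [h]; exact trainRule_ne_s
    · rw [hp.trainNext_eq Y hi]; split_ifs <;> simp
  · intro p hp q hq hpq
    by_contra hc
    have := (hp.near q (by rw [abs_le]; omega)).1 hq
    omega
  · intro i h
    by_cases h1 : NearActive X (i + 1)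
    · obtain ⟨p, hp, hi⟩ := near _ h1
      rw [hp.wallNext_eq Y hi] at h
      rw [abs_le] at hi
      have h2 : i + 1 = p := by split_ifs at h; assumption
      rw [hp.wallNext_eq Y (by rw [abs_le]; omega), if_neg (by omega), if_pos (by omega)]
      simp
    · rw [wallNext_eq_wallRule Y h1] at h
      by_cases h2 : NearActive X i
      · obtain ⟨p, hp, hi⟩ := near _ h2
        have := far _ h1 p hp
        rw [abs_le] at this
        rw [hp.wallNext_eq Y hi]
        rw [abs_le] at hi
        rw [if_neg (by omega), if_neg (by omega), if_neg (by omega)]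
        simp
      · rw [wallNext_eq_wallRule Y h2]
        have h3 := guardRule_left_g (wallRule_eq_g h)
        rcases wallRule_cases X Y i with h4 | h4 <;> rw [h4]
        · exact ⟨h3.1, h3.2.1⟩
        · simp
  · intro i he hr hg
    by_cases h2 : NearActive X (i + 2)
    · obtain ⟨p, hp, hi⟩ := near _ h2
      rw [hp.wallNext_eq Y hi] at hg
      have h2 : i + 2 = p := by split_ifs at hg; assumption
      rw [h2]; exact hp
    exfalso
    rw [wallNext_eq_wallRule Y h2] at hg
    have hg' := wallRule_eq_g hg
    by_cases h1 : NearActive X (i + 1)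
    · obtain ⟨p, hp, hi⟩ := near _ h1
      rw [hp.wallNext_eq Y hi] at hr
      split_ifs at hr with _ h3
      exact far _ h2 p hp (by rw [abs_le]; omega)
    rw [wallNext_eq_wallRule Y h1] at hr
    obtain ⟨h3, h4⟩ := (guardRule_left_g (Y := Y) (i := i + 1) (by rwa [add_assoc])).2.2 (by
      rcases wallRule_cases X Y (i + 1) with h4 | h4 <;> rw [h4] at hr
      · exact hr
      · cases hr)
    rw [add_sub_cancel_right] at h4
    by_cases h0 : NearActive X i
    · obtain ⟨p, hp, hi⟩ := near _ h0
      rw [hp.wallNext_eq Y hi] at he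
      split_ifs at he with h3
      exact far _ h2 p hp (by rw [abs_le]; omega)
    rw [wallNext_eq_wallRule Y h0] at he
    have h5 : guardRule Y i = .e := by
      rcases wallRule_cases X Y i with h4 | h4 <;> rw [h4] at he
      · exact he
      · cases he
    rcases guardRule_eq_e h5 with h6 | h6
    · rw [h6.1] at h3; cases h3
    · rw [h6.2.1] at h4; cases h4
  · rintro i ht ⟨h1, h2⟩
    rcases tc i with h0 | ⟨p, hp, hi⟩
    swap
    · rw [hp.trainNext_eq Y hi] at ht
      have h3 : i = p + 3 := by split_ifs at ht; assumption
      rw [hp.trainNext_eq Y (by rw [abs_le]; omega), if_neg (by omega), if_pos (by omega)] at h1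
      cases h1
    by_cases hn : ∃ p, Active X p ∧ |i - p| ≤ 8
    · obtain ⟨p, hp, hi⟩ := hn
      rw [hp.trainNext_eq Y hi] at ht
      have h3 : i = p + 3 := by split_ifs at ht; assumption
      rw [hp.trainNext_eq Y (by rw [abs_le]; omega), if_neg (by omega), if_pos (by omega)] at h1
      cases h1
    rw [h0] at ht
    rcases tc (i - 2) with h3 | ⟨p, hp, hi⟩
    swap
    · have h4 : ¬ |i - p| ≤ 8 := fun hc => hn ⟨p, hp, hc⟩
      rw [hp.trainNext_eq Y hi] at h2
      rw [abs_le] at h4 hi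
      rw [if_neg (by omega), if_neg (by omega), if_neg (by omega)] at h2
      simp [Train.IsL] at h2
    rw [h3] at h2
    obtain ⟨h4, -, h5⟩ := trainRule_isL h2
    rcases trainRule_eq_t ht with h6 | ⟨-, -, h6, h7⟩
    · exact h4 (Or.inr (Or.inr (Or.inl h6)))
    · rcases h5 with ⟨-, h5⟩ | ⟨h5, -⟩
      · have := h5.tip.1
        rw [show i - 2 + 1 = i - 1 by ring, h6] at this
        cases this
      · rw [h5] at h7; simp [Train.IsR] at h7
  · intro i ht h1 h2
    by_cases hn : ∃ p, Active X p ∧ |i - p| ≤ 8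
    · obtain ⟨p, hp, hi⟩ := hn
      rw [hp.trainNext_eq Y hi] at ht
      have h3 : i = p + 3 := by split_ifs at ht; assumption
      rw [h3, add_sub_cancel_right]; exact hp
    exfalso
    rcases tc i with h0 | h0
    swap
    · exact hn h0
    rw [h0] at ht
    rcases tc (i - 1) with h3 | ⟨p, hp, hi⟩
    swap
    · have h4 : ¬ |i - p| ≤ 8 := fun hc => hn ⟨p, hp, hc⟩
      rw [hp.trainNext_eq Y hi] at h1
      rw [abs_le] at h4 hi
      rw [if_neg (by omega), if_neg (by omega), if_neg (by omega)] at h1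
      simp [Train.IsR] at h1
    rw [h3] at h1
    obtain ⟨h4, h5, h6⟩ := trainRule_isR h1
    rw [show i - 1 - 1 = i - 2 by ring] at h6
    rcases tc (i - 2) with h7 | ⟨p, hp, hi⟩
    swap
    · have h4 : ¬ |i - p| ≤ 8 := fun hc => hn ⟨p, hp, hc⟩
      rw [hp.trainNext_eq Y hi] at h2
      rw [abs_le] at h4 hi
      rw [if_neg (by omega), if_neg (by omega), if_neg (by omega)] at h2
      cases h2
    rw [h7] at h2
    obtain ⟨-, h8⟩ := trainRule_h h2
    rcases trainRule_eq_t ht with h9 | ⟨-, -, -, h9⟩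
    · exact h4 (Or.inr (Or.inl (by rwa [show i - 1 - 1 = i - 2 by ring])))
    · rcases h8 with h8 | h8
      · rw [h8] at h9; simp [Train.IsR] at h9
      · rcases h9 with h9 | h9
        · exact h8.ne.2.2.2.2.2.2.2 h9
        · exact h8.ne.2.2.2.2.2.1 h9

theorem not_active_of_seedless {X : ℤ → Train} (h : ∀ i, X i ≠ .s) (i : ℤ) : ¬ NearActive X i :=
  fun ⟨_, _, h'⟩ => h _ h'.1

end


/-! ### Stars, that is, points of `A`: their neighbours, standing guards and running trains. -/

/-- Consecutive points of `A`. -/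
def Pair (A : Set ℤ) (f g : ℤ) : Prop := f ∈ A ∧ g ∈ A ∧ f < g ∧ ∀ p ∈ A, ¬ (f < p ∧ p < g)

theorem exists_pair_right {A : Set ℤ} {f q : ℤ} (hf : f ∈ A) (hq : q ∈ A) (h : f < q) :
    ∃ g, Pair A f g ∧ g ≤ q := by
  obtain ⟨g, ⟨h1, h2⟩, h3⟩ := Int.exists_least_of_bdd (P := fun z => z ∈ A ∧ f < z)
    ⟨f, fun z hz => hz.2.le⟩ ⟨q, hq, h⟩
  refine ⟨g, ⟨hf, h1, h2, fun p hp hpg => ?_⟩, h3 q ⟨hq, h⟩⟩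
  have := h3 p ⟨hp, hpg.1⟩
  omega

theorem Pair.left_unique {A : Set ℤ} {f f' g : ℤ} (h : Pair A f g) (h' : Pair A f' g) : f = f' := by
  rcases lt_trichotomy f f' with h1 | h1 | h1
  · exact absurd ⟨h1, h'.2.2.1⟩ (h.2.2.2 f' h'.1)
  · exact h1
  · exact absurd ⟨h1, h.2.2.1⟩ (h'.2.2.2 f h.1)

theorem Pair.right_unique {A : Set ℤ} {f g g' : ℤ} (h : Pair A f g) (h' : Pair A f g') : g = g' := by
  rcases lt_trichotomy g g' with h1 | h1 | h1
  · exact absurd ⟨h.2.2.1, h1⟩ (h'.2.2.2 g h.2.1)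
  · exact h1
  · exact absurd ⟨h'.2.2.1, h1⟩ (h.2.2.2 g' h'.2.1)

/-- The guard of `g` still stands when the counters have the width `V`. -/
def LeftOpen (A : Set ℤ) (V g : ℤ) : Prop := g ∈ A ∧ ∀ f, Pair A f g → 2 * V + 2 ≤ g - f

/-- The train of `f` still runs when the counters are in the state `(V, φ)`. -/
def RightOpen (A : Set ℤ) (V φ f : ℤ) : Prop :=
  f ∈ A ∧ ∀ g, Pair A f g → 2 * V + 2 ≤ g - f ∨ (2 * V ≤ g - f ∧ φ + 2 ≤ V)

/-- The tip of the train of `f` in the state `(V, φ)`. -/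
def starTip (V φ f : ℤ) : ℤ := f + V - 1 + tW V φ

theorem starTip_of_le {V φ : ℤ} (f : ℤ) (h : φ + 2 ≤ V) : starTip V φ f = f + 2 * V - 1 := by
  rw [starTip, tW_of_le h]; ring

theorem starTip_of_lt {V φ : ℤ} (f : ℤ) (h : V < φ + 2) : starTip V φ f = f + 2 * V + 1 := by
  rw [starTip, tW_of_lt h]; ring

/-- The signal `σ` announces a root at the distance `D` from the tip. -/
def Announces (D : ℤ) (σ : Train) : Prop := (D = 1 ∧ σ = .l1) ∨ (D = 2 ∧ σ = .l2)

theorem Announces.isL {D : ℤ} {σ : Train} (h : Announces D σ) : σ.IsL := by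
  rcases h with ⟨-, rfl⟩ | ⟨-, rfl⟩ <;> simp [Train.IsL]

/-- Both announced distances are handled by one variable. If the root lies `D` cells after the tip,
an end at `i + 1 + D` means that the guard is one cell narrower than the distance from signal to
tip. -/
theorem seen_iff {X : ℤ → Train} {Y : ℤ → Guard} {i : ℤ} :
    Seen X Y i ↔ ∃ D, Announces D (X i) ∧ Y (i + 1 + D) = .e := by
  unfold Seen Announces
  constructor
  · rintro (⟨h1, h2⟩ | ⟨h1, h2⟩)
    · exact ⟨1, Or.inl ⟨rfl, h1⟩, by rwa [add_assoc]⟩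
    · exact ⟨2, Or.inr ⟨rfl, h1⟩, by rwa [add_assoc]⟩
  · rintro ⟨D, ⟨rfl, h1⟩ | ⟨rfl, h1⟩, h2⟩
    · exact Or.inl ⟨h1, by rwa [add_assoc] at h2⟩
    · exact Or.inr ⟨h1, by rwa [add_assoc] at h2⟩

theorem tieHit_iff {X : ℤ → Train} {Y : ℤ → Guard} {i : ℤ} :
    TieHit X Y i ↔ X (i - 1) = .h ∧
      ∃ D, Announces D (X i) ∧ Y (i + 1 + D) = .e ∧ Y (i + 2 + D) = .l := by
  unfold TieHit Announces
  refine and_congr Iff.rfl ⟨?_, ?_⟩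
  · rintro (⟨h1, h2, h3⟩ | ⟨h1, h2, h3⟩)
    · exact ⟨1, Or.inl ⟨rfl, h1⟩, by rwa [add_assoc], by rwa [add_assoc]⟩
    · exact ⟨2, Or.inr ⟨rfl, h1⟩, by rwa [add_assoc], by rwa [add_assoc]⟩
  · rintro ⟨D, ⟨rfl, h1⟩ | ⟨rfl, h1⟩, h2, h3⟩
    · exact Or.inl ⟨h1, by rwa [add_assoc] at h2, by rwa [add_assoc] at h3⟩
    · exact Or.inr ⟨h1, by rwa [add_assoc] at h2, by rwa [add_assoc] at h3⟩

theorem TieHit.seen {X : ℤ → Train} {Y : ℤ → Guard} {i : ℤ} (h : TieHit X Y i) : Seen X Y i := by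
  obtain ⟨-, D, h1, h2, -⟩ := tieHit_iff.1 h
  exact seen_iff.2 ⟨D, h1, h2⟩

theorem tpat_ne_o {V φ j : ℤ} {σ : Train} (hk : KindOk V φ σ) : tpat V φ σ j ≠ .o := by
  have : σ ≠ .o := by
    rcases le_or_gt (φ + 2) V with h4 | h4
    · exact (hk.1 h4).ne.1
    · exact (hk.2 h4).ne.1
  unfold tpat
  split_ifs <;> first | assumption | decide

/-- A left moving signal at a distance `q` from the tip of a train is the signal of that train. -/
theorem TrainAt.signal {X : ℤ → Train} {τ V φ e K q : ℤ} {σ : Train} (h : TrainAt X τ V φ σ e K)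
    (hq : 2 ≤ q) (hK : q + 1 ≤ K) (hb : ∀ j, 0 < j → j < q → X (τ - j) = .b)
    (hl : (X (τ - q)).IsL) : q = tso V φ ∧ V < φ + 2 ∧ q ≤ e ∧ X (τ - q) = σ ∧
      (X (τ - q - 1) = .h → φ = 2 * V - 3) := by
  have hso := h.phase.tso_pos
  have hsW := h.phase.tso_lt
  have ht : X τ = .t := by simpa [tpat_t] using h.pat 0 le_rfl h.nonneg
  have hqe : q ≤ e := by
    by_contra hc
    have h1 : X (τ - e - 1) = .b ∨ ((X (τ - e - 1)).IsL ∧ 1 ≤ e) := by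
      rcases (by omega : e + 1 < q ∨ e + 1 = q) with h2 | h2
      · left; rw [sub_sub]; exact hb _ (by have := h.nonneg; omega) h2
      · right; rw [sub_sub, h2]; exact ⟨hl, by omega⟩
    rcases h.brk with h5 | h5 | h5
    · have := h.pat e h.nonneg le_rfl
      rw [tpat_h σ h.phase h5, hb e (by omega) (by omega)] at this
      cases this
    · apply h5
      rcases h.nonneg.eq_or_lt with h6 | h6
      · rw [← h6] at h1 ⊢
        rw [sub_zero] at h1 ⊢
        rw [ht]
        refine ⟨fun _ => ?_, fun h => by simp at h, fun h => by simp [Train.IsR, Train.IsL] at h⟩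
        rcases h1 with h1 | h1
        · exact Or.inl h1
        · omega
      · rw [hb e h6 (by omega)]
        refine ⟨fun h => by simp at h, fun _ => by tauto,
          fun h => by simp [Train.IsR, Train.IsL] at h⟩
    · omega
  have h1 := h.pat q (by omega) hqe
  have hq' : q = tso V φ := by
    rcases lt_trichotomy q (tso V φ) with h2 | h2 | h2
    · rw [h1, tpat_b σ h.phase (by omega) h2] at hl
      simp [Train.IsL] at hl
    · exact h2
    · rcases (h.le.trans' hqe).eq_or_lt with h3 | h3
      · rw [h1, tpat_h σ h.phase h3] at hl
        simp [Train.IsL] at hl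
      · rw [h1, tpat_a σ h.phase h2 h3] at hl
        simp [Train.IsL] at hl
  rw [tpat_s σ h.phase hq'] at h1
  have hV : V < φ + 2 := by
    by_contra hc
    exact (h.kind.1 (by omega)).ne.2.2.2.2.2.2.2 (h1 ▸ hl)
  refine ⟨hq', hV, hqe, h1, fun hh => ?_⟩
  have hqe' : q + 1 ≤ e := by
    by_contra hc
    have : e = q := by omega
    rcases h.brk with h5 | h5 | h5
    · omega
    · apply h5
      rw [this, hh]
      refine ⟨fun h => absurd h hl.ne.2.2.2.2.2.2.1, fun h => absurd h hl.ne.2.2.2.2.2.1,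
        fun _ => Or.inl rfl⟩
    · omega
  have h2 := h.pat (q + 1) (by omega) hqe'
  rw [← sub_sub, hh] at h2
  rcases (by omega : q + 1 = tW V φ ∨ q + 1 < tW V φ) with h3 | h3
  · rw [tW_of_lt hV, hq', tso_of_lt hV] at h3; omega
  · rw [tpat_a σ h.phase (by omega) h3] at h2; cases h2

/-- The tip of a train does not move while the signal is missing or moves to the left. -/
theorem TrainAt.not_isR {X : ℤ → Train} {τ V φ e K : ℤ} {σ : Train} (h : TrainAt X τ V φ σ e K)
    (hK : 1 ≤ K) (h' : e < tso V φ ∨ V < φ + 2) : ¬ (X (τ - 1)).IsR := by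
  intro hR
  have ht : X τ = .t := by simpa [tpat_t] using h.pat 0 le_rfl h.nonneg
  have hso := h.phase.tso_pos
  have hsW := h.phase.tso_lt
  obtain ⟨h1, h2, h3⟩ := h.phase
  have he : 1 ≤ e := by
    by_contra hc
    have h0 : e = 0 := by have := h.nonneg; omega
    rcases h.brk with h5 | h5 | h5
    · omega
    · rw [h0, sub_zero, ht] at h5
      exact h5 ⟨fun _ => Or.inr hR, fun h => by simp at h,
        fun h => by simp [Train.IsR, Train.IsL] at h⟩
    · omega
  have h4 : 1 < tso V φ := by
    rcases h' with h' | h'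
    · omega
    · rw [tso_of_lt h']; omega
  rw [h.pat 1 (by omega) he, tpat_b σ h.phase one_pos h4] at hR
  simp [Train.IsR] at hR

/-! ### The invariant. -/

/-- The evolution of both layers when all seeds have been used. -/
structure Evolution (A : Set ℤ) (X : ℕ → ℤ → Train) (Y : ℕ → ℤ → Guard) : Prop where
  start : Start (X 0) (Y 0) A
  train : ∀ n, X (n + 1) = trainRule (X n) (Y n)
  wall : ∀ n, Y (n + 1) = wallRule (X n) (Y n)

section
variable {A : Set ℤ} {X : ℕ → ℤ → Train} {Y : ℕ → ℤ → Guard} {n : ℕ}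

theorem Evolution.root (h : Evolution A X Y) {i : ℤ} (hi : Y n i = .g) : Y 0 i = .g := by
  induction n with
  | zero => exact hi
  | succ n ih => exact ih (wallRule_eq_g (by rw [← h.wall]; exact hi))

/-- The cell before a star starts as `r`, and roots are never created. So a root noticed near a star
is the star itself, and the distances `1` and `2` are not confused. -/
theorem Evolution.not_root (h : Evolution A X Y) {g : ℤ} (hg : g ∈ A) : Y n (g - 1) ≠ .g := by
  intro hc
  have := h.root hc
  rw [h.start.guard_eq g hg _ (by rw [abs_le]; omega), if_neg (by omega), if_pos rfl] at this
  cases this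

/-- Every signal to the left is followed by a tip, unless it has moved from the beginning. -/
theorem Evolution.signal (h : Evolution A X Y) (n : ℕ) (s : ℤ) (hs : (X n s).IsL) :
    (∃ q, 3 ≤ q ∧ X n (s + q) = .t ∧ ∀ j, 0 < j → j < q → X n (s + j) = .b) ∨
      ∀ k m : ℕ, k + m = n → (X m (s + k)).IsL := by
  induction n generalizing s with
  | zero =>
    right
    intro k m hkm
    obtain ⟨rfl, rfl⟩ : k = 0 ∧ m = 0 := by omega
    simpa using hs
  | succ n ih =>
    rw [h.train] at hs
    obtain ⟨h1, h2, ⟨h3, h4⟩ | ⟨h3, h4, h5⟩⟩ := trainRule_isL hs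
    · left
      refine ⟨3, le_rfl, ?_, fun j hj hj' => ?_⟩
      · rw [h.train]
        exact trainRule_of_push (by rwa [show s + 3 - 2 = s + 1 by ring])
      · rw [h.train]
        rcases (by omega : j = 1 ∨ j = 2) with rfl | rfl
        · apply trainRule_of_push' (Or.inr h4)
          intro hc
          have := hc.tip.1
          rw [show s + 1 - 2 = s - 1 by ring] at this
          rw [this] at h2; simp at h2
        · apply trainRule_of_push' (Or.inl (by rwa [show s + 2 - 1 = s + 1 by ring]))
          intro hc
          have := hc.tip.1
          rw [add_sub_cancel_right] at this
          exact h3.ne.2.2.2.2.2.2.1 this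
    · rw [← h4] at hs
      rcases ih _ hs with ⟨q, hq, h6, h7⟩ | h6
      · left
        have hno : ∀ k, s - 1 ≤ k → k ≤ s + 1 + q → ¬ Tick (X n) k := by
          intro k h8 h9 hc
          have h10 := hc.1
          rcases (by omega : k = s - 1 ∨ k = s ∨ k = s + 1 ∨ (s + 1 < k ∧ k < s + 1 + q) ∨
            k = s + 1 + q) with rfl | rfl | rfl | h11 | rfl
          · rw [h10] at h2; simp at h2
          · rw [h10] at h3; cases h3
          · exact hs.ne.2.2.2.2.2.2.1 h10
          · have := h7 (k - (s + 1)) (by omega) (by omega)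
            rw [add_sub_cancel, h10] at this; cases this
          · have h12 := h7 (q - 1) (by omega) (by omega)
            have h13 := hc.2
            rw [show s + 1 + q - 1 = s + 1 + (q - 1) by ring, h12] at h13
            simp [Train.IsR] at h13
        have hov : ∀ k, s + 1 ≤ k → k ≤ s + 1 + q → ¬ Overwritten (X n) (Y n) k := by
          intro k h8 h9 hc
          have a0 := hno k (by omega) h9
          have a1 := hno (k - 1) (by omega) (by omega)
          have a2 := hno (k - 2) (by omega) (by omega)
          rcases hc with hc | hc | hc | hc | hc | hc
          · exact a2 hc.1
          · exact a1 hc.1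
          · exact a0 hc.1
          · exact a0 ⟨hc.1, Or.inr hc.2.1⟩
          · exact a1 ⟨hc.1, Or.inr hc.2.1⟩
          · exact a2 ⟨hc.1.1, Or.inr hc.1.2.1⟩
        refine ⟨q + 1, by omega, ?_, fun j hj hj' => ?_⟩
        · rw [h.train]
          apply trainRule_of_local (hov _ (by omega) (by omega)) _ (by simp)
          have h8 := h7 (q - 1) (by omega) (by omega)
          have h9 := h7 (q - 2) (by omega) (by omega)
          rw [show s + 1 + (q - 1) = s + (q + 1) - 1 by ring] at h8
          rw [show s + 1 + (q - 2) = s + (q + 1) - 2 by ring] at h9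
          rw [show s + 1 + q = s + (q + 1) by ring] at h6
          simp [trainLocal, h6, h8, h9]
        · rw [h.train]
          apply trainRule_of_local (hov _ (by omega) (by omega)) _ (by simp)
          rcases (by omega : j = 1 ∨ j = 2 ∨ 3 ≤ j) with rfl | rfl | hj3
          · exact trainLocal_l hs (by rwa [add_sub_cancel_right]) h5
          · have h8 := h7 1 (by omega) (by omega)
            rw [add_assoc, one_add_one_eq_two] at h8
            apply trainLocal_b_l h8
            · rwa [show s + 2 - 1 = s + 1 by ring]
            · rwa [show s + 2 - 1 = s + 1 by ring]
            · rwa [add_sub_cancel_right]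
          · have h8 := h7 (j - 1) (by omega) (by omega)
            have h9 := h7 (j - 2) (by omega) (by omega)
            rw [show s + 1 + (j - 1) = s + j by ring] at h8
            rw [show s + 1 + (j - 2) = s + j - 1 by ring] at h9
            exact trainLocal_b h8 h9
      · right
        intro k m hkm
        rcases k with _ | k
        · obtain rfl : m = n + 1 := by omega
          rw [h.train]
          simpa [h4] using hs
        · have := h6 k m (by omega)
          rwa [show s + 1 + (k : ℤ) = s + (k + 1 : ℕ) by push_cast; ring] at this

/-- Objects of stars have age `n`, all others at least `n + 1`; here this lead becomes a
lexicographic comparison of states, the only form in which it is visible to the automaton. -/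
theorem IsPhase.older {V φ : ℤ} (h : IsPhase V φ) (ha : (n : ℤ) + 1 ≤ age V φ) :
    cV n < V ∨ (cV n = V ∧ cφ n < φ) := by
  have h1 := age_canon n
  rcases (isPhase_canon n).le_of_age_le h (by omega) with h2 | ⟨h2, h3⟩
  · exact Or.inl h2
  · refine Or.inr ⟨h2, ?_⟩
    rcases h3.eq_or_lt with h4 | h4
    · rw [h2, h4] at h1; omega
    · exact h4

/-- The space between `f` and `g` after the train of `f` has opened the guard of `g`. -/
def Opening (X : ℤ → Train) (f g w m : ℤ) : Prop := ∀ i, f < i → i ≤ g →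
  X i = if i < f + w - 1 ∨ m < i then .o else if i = f + w - 1 then .h else .a

/-- What is known about the layers at the time `n`. -/
structure Inv (A : Set ℤ) (X : ℕ → ℤ → Train) (Y : ℕ → ℤ → Guard) (n : ℕ) : Prop where
  -- The clauses on `σ`: an announced root was present when the signal left the tip, at the time
  -- `m`; `rt` occurs exactly after a tie; a neighbouring star in reach has been announced.
  train : ∀ f, RightOpen A (cV n) (cφ n) f → ∃ σ, KindOk (cV n) (cφ n) σ ∧
    (∀ j, 0 ≤ j → j ≤ tW (cV n) (cφ n) →
      X n (starTip (cV n) (cφ n) f - j) = tpat (cV n) (cφ n) σ j) ∧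
    (∀ D, Announces D σ → ∃ m : ℕ, (n : ℤ) = m + tso (cV n) (cφ n) - 2 ∧
      Y m (starTip (cV n) (cφ n) f + D) = .g) ∧
    (σ = .rt ↔ cφ n + 2 ≤ cV n ∧ ∃ g, Pair A f g ∧ g - f ≤ 2 * cV n + 1) ∧
    (∀ D g, Pair A f g → cV n < cφ n + 2 → starTip (cV n) (cφ n) f + D = g → D = 1 ∨ D = 2 →
      Announces D σ)
  zone : ∀ f, RightOpen A (cV n) (cφ n) f → ∀ i, f < i → i < f + cV n - 1 → X n i = .o
  -- Any other tip belongs to an older train. If it stands just before the root of a standing guard,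
  -- its signal is lost, or it has announced this root and the cell it inspects has not yet passed
  -- the end, where it will die.
  tip : ∀ τ, X n τ = .t → (∃ f, RightOpen A (cV n) (cφ n) f ∧ τ = starTip (cV n) (cφ n) f) ∨
    ∀ K, ∃ V φ σ e, TrainAt (X n) τ V φ σ e K ∧ (n : ℤ) + 1 ≤ age V φ ∧
      ∀ g D, LeftOpen A (cV n) g → τ + D = g → D = 1 ∨ D = 2 → e < tso V φ ∨
        (V < φ + 2 ∧ Announces D σ ∧ g - cV n ≤ τ - tso V φ + 1 + D)
  guard : ∀ g, LeftOpen A (cV n) g → ∀ j, 0 ≤ j → j ≤ cV n →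
    Y n (g - cV n + j) = gpat (cV n) (cφ n) j
  -- All earlier times are included in order to exclude signals that have been moving since the
  -- beginning.
  fixed : ∀ g, LeftOpen A (cV n) g → ∀ m ≤ n, X m g = .d
  closed : ∀ g, LeftOpen A (cV n) g → ∀ i, g - cV n ≤ i → i ≤ g → X n i ≠ .o
  -- The clause on `m`: no guard extends beyond a root seen ahead of its end, even a root of the
  -- past; `n - m` bounds how far the end has moved since then. The clause on `f`: ends stay ahead
  -- of the head, and one directly at the head is not due to move before the head is.
  wall : ∀ u, Y n u = .e → ∀ K, ∃ V φ e, GuardAt (Y n) u V φ e K ∧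
    ((n : ℤ) + 1 ≤ age V φ ∨
      ∃ g, LeftOpen A (cV n) g ∧ u = g - cV n ∧ V = cV n ∧ φ = cφ n) ∧
    (∀ m : ℕ, m ≤ n → ∀ g, Y m g = .g → u + (n - m) < g → u + V ≤ g) ∧
    ∀ f, RightOpen A (cV n) (cφ n) f → f < u → f + cV n + 1 ≤ u ∨
      (u = f + cV n ∧ 2 * cV n - 2 - cφ n ≤ 2 * V - 2 - φ)
  free : ∀ f g, Pair A f g → g - f ≤ 2 * cV n + 1 → ∀ u, f < u → u ≤ g → Y n u ≠ .e
  -- Between the destruction of the end of `g` and the arrival of `rt`, the root has to survive in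
  -- order to be recognised by the tip.
  middle : ∀ f g, Pair A f g → RightOpen A (cV n) (cφ n) f → g - f ≤ 2 * cV n + 1 →
    X n g = .d ∧ Y n g = .g
  -- The remnant of the train ends at `m`, which retreats by one cell per step, so it has vanished
  -- by the second step at the width `w + 1`.
  opened : ∀ f g w, Pair A f g → ¬ RightOpen A (cV n) (cφ n) f → w = (g - f) / 2 →
    ∃ m, Opening (X n) f g w m ∧ ((cV n = w ∧ m + cφ n ≤ f + 3 * w - 3) ∨
      (cV n = w + 1 ∧ m + cφ n ≤ f + w - 1) ∨ (w + 2 ≤ cV n ∧ m ≤ f + w - 2))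

end


/-! ### Trains and guards under the invariant. -/

section
variable {A : Set ℤ} {X : ℕ → ℤ → Train} {Y : ℕ → ℤ → Guard} {n : ℕ}

/-- While the train of `f` runs, its right neighbour is at least `2 * V` away; by the spacing of
stars any other star is out of its reach. -/
theorem Start.gap {X : ℤ → Train} {Y : ℤ → Guard} (h : Start X Y A) {V φ f g : ℤ}
    (hf : RightOpen A V φ f) (hg : g ∈ A) (hfg : f < g) : Pair A f g ∨ 2 * V + 17 ≤ g - f := by
  obtain ⟨g', h1, h2⟩ := exists_pair_right hf.1 hg hfg
  rcases h2.eq_or_lt with rfl | h2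
  · exact Or.inl h1
  · have := h.spaced g' h1.2.1 g hg h2
    have := hf.2 g' h1
    right; omega

theorem leftOpen_or {V g : ℤ} (hg : g ∈ A) :
    LeftOpen A V g ∨ ∃ f, Pair A f g ∧ g - f ≤ 2 * V + 1 := by
  by_cases h : LeftOpen A V g
  · exact Or.inl h
  · right
    by_contra hc
    push Not at hc
    exact h ⟨hg, fun f hf => by have := hc f hf; omega⟩

theorem rightOpen_or {V φ f : ℤ} (hf : f ∈ A) :
    RightOpen A V φ f ∨ ∃ g, Pair A f g ∧ g - f ≤ 2 * V + 1 := by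
  by_cases h : RightOpen A V φ f
  · exact Or.inl h
  · right
    by_contra hc
    push Not at hc
    exact h ⟨hf, fun g hg => by have := hc g hg; omega⟩

theorem Inv.wall_right (hI : Inv A X Y n) {g : ℤ} (hg : g ∈ A) : Y n (g + 1) ≠ .e := by
  intro he
  have hV := (isPhase_canon n).1
  rcases rightOpen_or (V := cV n) (φ := cφ n) hg with h | ⟨g', h1, h2⟩
  · obtain ⟨V, φ, e, -, -, -, h4⟩ := hI.wall _ he 0
    have := h4 g h (by omega)
    omega
  · exact hI.free g g' h1 h2 (g + 1) (by omega) h1.2.2.1 he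

theorem Inv.tip_data (hI : Inv A X Y n) {τ : ℤ} (hτ : X n τ = .t) (K : ℤ) :
    ∃ V φ σ e, TrainAt (X n) τ V φ σ e K ∧
      ((∃ f, RightOpen A (cV n) (cφ n) f ∧ τ = starTip (cV n) (cφ n) f ∧ V = cV n ∧ φ = cφ n) ∨
      ((n : ℤ) + 1 ≤ age V φ ∧
      ∀ g D, LeftOpen A (cV n) g → τ + D = g → D = 1 ∨ D = 2 → e < tso V φ ∨
        (V < φ + 2 ∧ Announces D σ ∧ g - cV n ≤ τ - tso V φ + 1 + D))) := by
  rcases hI.tip τ hτ with ⟨f, h1, h2⟩ | h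
  · obtain ⟨σ, h3, h4, -⟩ := hI.train f h1
    have hp := isPhase_canon n
    have := hp.tso_pos
    have := hp.tso_lt
    refine ⟨cV n, cφ n, σ, tW (cV n) (cφ n), ⟨hp, h3, by omega, le_rfl, ?_, Or.inl rfl⟩,
      Or.inl ⟨f, h1, h2, rfl, rfl⟩⟩
    rw [h2]; exact h4
  · obtain ⟨V, φ, σ, e, h1, h2, h3⟩ := h K
    exact ⟨V, φ, σ, e, h1, Or.inr ⟨h2, h3⟩⟩

/-- A train of a star with a right-moving signal and its tip this near would contradict `LeftOpen`.
A foreign train has lost its signal or has it on the way back. -/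
theorem Inv.not_tick (hE : Evolution A X Y) (hI : Inv A X Y n) {g D : ℤ}
    (hg : LeftOpen A (cV n) g) (hD : D = 1 ∨ D = 2) : ¬ Tick (X n) (g - D) := by
  rintro ⟨ht, hR⟩
  have hV := (isPhase_canon n).1
  obtain ⟨V, φ, σ, e, h1, ⟨f, h2, h3, rfl, rfl⟩ | ⟨h2, h3⟩⟩ := hI.tip_data ht 1
  · refine h1.not_isR le_rfl (Or.inr ?_) hR
    by_contra hc
    rw [starTip_of_le f (by omega)] at h3
    rcases hE.start.gap h2 hg.1 (by omega) with h4 | h4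
    · have := hg.2 f h4
      omega
    · omega
  · rcases h3 g D hg (by ring) hD with h4 | h4
    · exact h1.not_isR le_rfl (Or.inl h4) hR
    · exact h1.not_isR le_rfl (Or.inr h4.1) hR

theorem RightOpen.of_le {V φ f g : ℤ} (hf : RightOpen A V φ f) (h : Pair A f g)
    (h2 : g - f ≤ 2 * V + 1) : φ + 2 ≤ V ∧ 2 * V ≤ g - f := by
  have := hf.2 g h
  omega

/-- The tip of `f` is one of the two cells before `g`, so the pattern there is known, and a tip
ticks only when `cφ n + 2 = cV n`. -/
theorem Inv.not_tick' (hI : Inv A X Y n) {f g D : ℤ}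
    (h : Pair A f g) (hf : RightOpen A (cV n) (cφ n) f) (h2 : g - f ≤ 2 * cV n + 1)
    (hD : D = 1 ∨ D = 2) (hφ : cφ n + 2 ≠ cV n) : ¬ Tick (X n) (g - D) := by
  rintro ⟨ht, hR⟩
  have hp := isPhase_canon n
  have hV := hp.1
  have hφ0 := hp.2.1
  obtain ⟨h3, h4⟩ := hf.of_le h h2
  obtain ⟨σ, h5, h6, -⟩ := hI.train f hf
  have hso := tso_of_le h3
  have hW := tW_of_le h3
  rw [starTip_of_le f h3] at h6
  have hb := h6 1 (by omega) (by omega)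
  rw [tpat_b σ hp one_pos (by omega)] at hb
  have ht0 := h6 0 (by omega) (by omega)
  rw [tpat_t, sub_zero] at ht0
  rcases (by omega : g - D = f + 2 * cV n - 1 - 1 ∨ g - D = f + 2 * cV n - 1 ∨
    g - D - 1 = f + 2 * cV n - 1) with h7 | h7 | h7
  · rw [h7, hb] at ht; cases ht
  · rw [h7, hb] at hR; simp [Train.IsR] at hR
  · rw [h7, ht0] at hR; simp [Train.IsR] at hR

/-- A star is a barrier for tips in each stage of its life: while its guard stands, while it waits
for `rt`, and after the opening. -/
theorem Inv.star (hE : Evolution A X Y) (hI : Inv A X Y n) {g : ℤ} (hg : g ∈ A) :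
    X n g ≠ .t ∧ ¬ Push (X n) (Y n) (g - 1) ∧ ¬ (Tie (X n) (Y n) (g - 1) ∧ Y n g ≠ .g) := by
  have hp := isPhase_canon n
  rcases leftOpen_or (V := cV n) hg with h | ⟨f, h1, h2⟩
  · have h3 := hI.not_tick hE h (Or.inl rfl)
    refine ⟨by rw [hI.fixed g h n le_rfl]; decide, fun hc => h3 hc.1,
      fun hc => h3 ⟨hc.1.1, Or.inr hc.1.2.1⟩⟩
  by_cases hf : RightOpen A (cV n) (cφ n) f
  · obtain ⟨h3, h4⟩ := hI.middle f g h1 hf h2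
    refine ⟨by rw [h3]; decide, ?_, fun hc => hc.2 h4⟩
    by_cases hφ : cφ n + 2 = cV n
    · intro hc
      obtain ⟨h5, h6⟩ := hf.of_le h1 h2
      obtain ⟨σ, h7, h8, -, h9, -⟩ := hI.train f hf
      have hso := tso_of_le h5
      have hW := tW_of_le h5
      have hV := hp.1
      rw [starTip_of_le f h5] at h8
      have hb := h8 1 (by omega) (by omega)
      rw [tpat_s σ hp (by omega), h9.2 ⟨h5, g, h1, h2⟩] at hb
      have ht0 := h8 0 (by omega) (by omega)
      rw [tpat_t, sub_zero] at ht0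
      rcases (by omega : g - 1 = f + 2 * cV n - 1 ∨ g - 1 - 1 = f + 2 * cV n - 1) with h10 | h10
      · apply hc.2
        exact ⟨hc.1.1, by rw [h10]; exact hb, Or.inl (by rwa [sub_add_cancel])⟩
      · have := hc.1.2
        rw [h10, ht0] at this; simp [Train.IsR] at this
    · exact fun hc => hI.not_tick' h1 hf h2 (Or.inl rfl) hφ hc.1
  · obtain ⟨m, hm, -⟩ := hI.opened f g _ h1 hf rfl
    have key : ∀ i, f < i → i ≤ g → X n i ≠ .t := by
      intro i h3 h4
      rw [hm i h3 h4]; split_ifs <;> decide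
    have hfg := h1.2.2.1
    have := hE.start.spaced f h1.1 g hg hfg
    refine ⟨key g hfg le_rfl, fun hc => key (g - 1) (by omega) (by omega) hc.tip.1,
      fun hc => key (g - 1) (by omega) (by omega) hc.1.1⟩

/-- The influence of tips to the left of a star does not reach beyond the star. -/
theorem Inv.not_overwritten (hE : Evolution A X Y) (hI : Inv A X Y n) {g i : ℤ} (hg : g ∈ A)
    (hi : g < i) (h : ∀ k, g < k → i - 2 ≤ k → k ≤ i → ¬ Tick (X n) k) :
    ¬ Overwritten (X n) (Y n) i := by
  obtain ⟨h1, h2, h3⟩ := hI.star hE hg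
  have hg' : ¬ Tick (X n) g := fun hc => h1 hc.1
  have h' : ∀ k, g ≤ k → i - 2 ≤ k → k ≤ i → ¬ Tick (X n) k := by
    intro k h4 h5 h6
    rcases h4.eq_or_lt with rfl | h4
    · exact hg'
    · exact h k h4 h5 h6
  have tt : ∀ k, Tie (X n) (Y n) k → Tick (X n) k := fun k hc => ⟨hc.1, Or.inr hc.2.1⟩
  rintro (hc | hc | hc | hc | hc | hc)
  · rcases (by omega : i - 2 = g - 1 ∨ g ≤ i - 2) with h4 | h4
    · rw [h4] at hc; exact h2 hc
    · exact h' _ h4 (by omega) (by omega) hc.1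
  · exact h' _ (by omega) (by omega) (by omega) hc.1
  · exact h' _ (by omega) (by omega) (by omega) hc.1
  · exact h' _ (by omega) (by omega) (by omega) (tt _ hc)
  · exact h' _ (by omega) (by omega) (by omega) (tt _ hc)
  · rcases (by omega : i - 2 = g - 1 ∨ g ≤ i - 2) with h4 | h4
    · rw [h4, show i - 1 = g by omega] at hc; exact h3 hc
    · exact h' _ h4 (by omega) (by omega) (tt _ hc.1)

/-- The train of a star only meets the end of a guard that is as old as itself. -/
theorem Inv.tieHit_of_seen (hE : Evolution A X Y) (hI : Inv A X Y n) {f : ℤ}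
    (hf : RightOpen A (cV n) (cφ n) f)
    (hs : Seen (X n) (Y n) (starTip (cV n) (cφ n) f - tso (cV n) (cφ n))) :
    TieHit (X n) (Y n) (starTip (cV n) (cφ n) f - tso (cV n) (cφ n)) ∧
      cφ n = 2 * cV n - 3 ∧
      ∃ g, Pair A f g ∧ g - f ≤ 2 * cV n + 3 := by
  have hp := isPhase_canon n
  obtain ⟨hV, hφ0, hφ1⟩ := id hp
  have hso := hp.tso_pos
  have hsW := hp.tso_lt
  obtain ⟨σ, h1, h2, h3, -⟩ := hI.train f hf
  obtain ⟨D, h4, h5⟩ := seen_iff.1 hs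
  have h4' := h4
  rw [h2 _ hso.le hsW.le, tpat_s σ hp rfl] at h4'
  have hVφ : cV n < cφ n + 2 := by
    by_contra hc
    exact (h1.1 (by omega)).ne.2.2.2.2.2.2.2 h4'.isL
  obtain ⟨m, hm, hY⟩ := h3 D h4'
  obtain ⟨V, φ, e, h6, h7, h8, h9⟩ := hI.wall _ h5 0
  have hT := starTip_of_lt f hVφ
  have hso' := tso_of_lt hVφ
  have hW := tW_of_lt hVφ
  have hD : D = 1 ∨ D = 2 := by rcases h4 with h4 | h4 <;> omega
  -- The announced root bounds the width of the guard by `tso - 1 = cφ n + 3 - cV n`, at most `cV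
  -- n`. A strictly older guard would be too wide or in a phase that does not exist. The clause
  -- applies at `m` with nothing to spare: the end plus `n - m` is one less than the root.
  have h10 := h8 m (by omega) _ hY (by omega)
  rcases h7 with h7 | ⟨g, hg, h11, rfl, rfl⟩
  · have := h6.phase.2
    rcases h6.phase.older h7 with h12 | h12 <;> omega
  have hφ : cφ n = 2 * cV n - 3 := by omega
  have hgT : g = f + 2 * cV n + 1 + D := by omega
  refine ⟨tieHit_iff.2 ⟨?_, D, h4, h5, ?_⟩, hφ, g, ?_, by omega⟩
  · rw [sub_sub, h2 _ (by omega) (by omega), tpat_h σ hp (by omega)]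
  · rcases gpat_one hp with h12 | h12
    · rw [← h12.2, ← hI.guard g hg 1 (by omega) (by omega)]
      congr 1; omega
    · omega
  · rcases hE.start.gap hf hg.1 (by omega) with h12 | h12
    · exact h12
    · omega

theorem cV_le (n : ℕ) : cV n ≤ n + 2 := by
  have h1 := isPhase_canon n
  have h2 := age_canon n
  obtain ⟨h3, h4, h5⟩ := h1
  unfold age at h2
  nlinarith

/-- Signals near a guard that stands belong to trains whose tip is on the left of its root. -/
theorem Inv.signal_tip (hE : Evolution A X Y) (hI : Inv A X Y n) {g i : ℤ}
    (hg : LeftOpen A (cV n) g) (h1 : g - cV n - 3 ≤ i) (h2 : i ≤ g) (hl : (X n i).IsL) :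
    ∃ q, 3 ≤ q ∧ X n (i + q) = .t ∧ (∀ j, 0 < j → j < q → X n (i + j) = .b) ∧ i + q < g := by
  have hfix := hI.fixed g hg
  have hne : i ≠ g := by
    rintro rfl
    rw [hfix n le_rfl] at hl; simp [Train.IsL] at hl
  rcases hE.signal n i hl with ⟨q, h3, h4, h5⟩ | h3
  · refine ⟨q, h3, h4, h5, ?_⟩
    by_contra hc
    have h6 := hfix n le_rfl
    rcases (by omega : i + q = g ∨ g - i < q) with h7 | h7
    · rw [h7, h6] at h4; cases h4
    · have := h5 (g - i) (by omega) h7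
      rw [add_sub_cancel, h6] at this; cases this
  -- A signal moving since the beginning has either crossed `g`, which was always dead, or, by
  -- `cV_le`, started in the cleared neighbourhood of `g`.
  · exfalso
    rcases le_or_gt (g - i) n with h4 | h4
    · have := h3 (g - i).toNat (n - (g - i).toNat) (by omega)
      rw [show i + ((g - i).toNat : ℤ) = g by omega, hfix _ (by omega)] at this
      simp [Train.IsL] at this
    · have := h3 n 0 (by omega)
      have hc := cV_le n
      rw [hE.start.train_eq g hg.1 _ (by rw [abs_le]; omega), if_neg (by omega), if_neg (by omega),
        if_neg (by omega)] at this
      simp [Train.IsL] at this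

/-- The trains whose head is hit near a guard that stands. -/
theorem Inv.head_tip (hE : Evolution A X Y) (hI : Inv A X Y n) {g i : ℤ}
    (hg : LeftOpen A (cV n) g) (h1 : g - cV n - 3 ≤ i) (h2 : i ≤ g) (hl : (X n i).IsL)
    (hh : X n (i - 1) = .h) :
    ∃ V φ σ e, TrainAt (X n) (i + (V + 1)) V φ σ e (V + 1 + 1) ∧ cV n ≤ V ∧ i + (V + 1) < g ∧
      φ = 2 * V - 3 ∧ tso V φ = V + 1 ∧ V + 1 ≤ e ∧ X n i = σ ∧
      ((∃ f, RightOpen A (cV n) (cφ n) f ∧ i + (V + 1) = starTip (cV n) (cφ n) f ∧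
        V = cV n ∧ φ = cφ n) ∨
      ((n : ℤ) + 1 ≤ age V φ ∧
      ∀ g D, LeftOpen A (cV n) g → i + (V + 1) + D = g → D = 1 ∨ D = 2 → e < tso V φ ∨
        (V < φ + 2 ∧ Announces D σ ∧ g - cV n ≤ i + (V + 1) - tso V φ + 1 + D))) := by
  obtain ⟨q, h3, h4, h5, h6⟩ := hI.signal_tip hE hg h1 h2 hl
  obtain ⟨V, φ, σ, e, h7, h8⟩ := hI.tip_data h4 (q + 1)
  obtain ⟨h9, h10, h11, h12, h13⟩ := h7.signal (q := q) (by omega) le_rfl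
    (fun j hj hj' => by
      rw [show i + q - j = i + (q - j) by ring]; exact h5 _ (by omega) (by omega))
    (by rwa [add_sub_cancel_right])
  rw [add_sub_cancel_right] at h12 h13
  have h14 := h13 hh
  have h15 := tso_of_lt h10
  have h16 : q = V + 1 := by omega
  subst h16
  refine ⟨V, φ, σ, e, h7, ?_, h6, h14, h9.symm, h11, h12, h8⟩
  rcases h8 with ⟨_, _, _, h8, _⟩ | ⟨h8, -⟩
  · exact h8.ge
  · rcases h7.phase.older h8 with h | h
    · exact h.le
    · exact h.1.le

/-- The train being hit would be at least as wide as the guard and have its tip before `g`, which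
puts its head too far left. -/
theorem Inv.not_hit (hE : Evolution A X Y) (hI : Inv A X Y n) {g i : ℤ}
    (hg : LeftOpen A (cV n) g) (h1 : g - cV n - 1 ≤ i) (h2 : i ≤ g) :
    ¬ Hit (X n) (Y n) i := by
  rintro ⟨h3, h4, -⟩
  obtain ⟨V, φ, σ, e, -, h5, h6, -⟩ := hI.head_tip hE hg (by omega) h2 h4 h3
  omega

/-- A guard that stands is not destroyed before its time. -/
theorem Inv.not_killed (hE : Evolution A X Y) (hI : Inv A X Y n) {g : ℤ}
    (hg : LeftOpen A (cV n) g) (hg' : LeftOpen A (cV (n + 1)) g) :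
    ¬ Killed (X n) (Y n) (g - cV n) := by
  have hp := isPhase_canon n
  have hV := hp.1
  have hgap : ∀ f, RightOpen A (cV n) (cφ n) f → cφ n = 2 * cV n - 3 → f < g →
      2 * cV n + 4 ≤ g - f := by
    intro f hf hφ hfg
    rcases hE.start.gap hf hg.1 hfg with h | h
    · have := hg'.2 f h
      rw [cV_succ, (next_of_eq hφ).1] at this
      omega
    · omega
  rintro ⟨-, hk⟩
  rcases hk with h | h | ⟨h, hx⟩ | ⟨h, hx⟩
  · exact hI.not_hit hE hg (by omega) (by omega) h
  · exact hI.not_hit hE hg (by omega) (by omega) h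
  · obtain ⟨hh, D, hD, h1, h2⟩ := tieHit_iff.1 h
    obtain rfl : D = 1 := by rcases hD with hD | hD <;> simp_all
    obtain ⟨V, φ, σ, e, h3, h4, h5, h6, h7, h8, h9, h10⟩ :=
      hI.head_tip hE (i := g - cV n - 2) hg (by omega) (by omega) hD.isL hh
    have hφ : cφ n = 2 * cV n - 3 := by
      have h11 := hI.guard g hg 1 (by omega) (by omega)
      rw [show g - cV n + 1 = g - cV n - 2 + 2 + 1 by ring, h2] at h11
      rcases gpat_one hp with h12 | h12
      · exact h12.1
      · rcases h12.2 with h13 | h13 <;> rw [h13] at h11 <;> cases h11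
    have : V = cV n := by omega
    subst this
    rcases h10 with ⟨f, h11, h12, -, -⟩ | ⟨h11, -⟩
    · rw [starTip_of_lt f (by omega)] at h12
      have := hgap f h11 hφ (by omega)
      omega
    · rcases h3.phase.older h11 with h | h <;> omega
  · obtain ⟨hh, D, hD, h1, h2⟩ := tieHit_iff.1 h
    obtain rfl : D = 2 := by rcases hD with hD | hD <;> simp_all
    obtain ⟨V, φ, σ, e, h3, h4, h5, h6, h7, h8, h9, h10⟩ :=
      hI.head_tip hE (i := g - cV n - 3) hg (by omega) (by omega) hD.isL hh
    have hφ : cφ n = 2 * cV n - 3 := by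
      have h11 := hI.guard g hg 1 (by omega) (by omega)
      rw [show g - cV n + 1 = g - cV n - 3 + 2 + 2 by ring, h2] at h11
      rcases gpat_one hp with h12 | h12
      · exact h12.1
      · rcases h12.2 with h13 | h13 <;> rw [h13] at h11 <;> cases h11
    rcases h10 with ⟨f, h11, h12, h13, -⟩ | ⟨h11, h12⟩
    · rw [starTip_of_lt f (by omega)] at h12
      have := hgap f h11 hφ (by omega)
      omega
    · rcases h3.phase.older h11 with h | h
      -- The tip would be one cell before `g`, so its signal would announce the distance `1` and not
      -- `2`.
      · have hV' : V = cV n + 1 := by omega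
        rcases h12 g 1 hg (by omega) (Or.inl rfl) with h13 | ⟨-, h13, -⟩
        · omega
        · rw [← h9, hx] at h13
          rcases h13 with h13 | h13
          · cases h13.2
          · omega
      · omega

end


theorem TrainAt.mono {X : ℤ → Train} {τ V φ e K K' : ℤ} {σ : Train} (h : TrainAt X τ V φ σ e K')
    (hK : K ≤ K') : TrainAt X τ V φ σ e K :=
  ⟨h.phase, h.kind, h.nonneg, h.le, h.pat, h.brk.imp_right (Or.imp_right hK.trans)⟩

theorem GuardAt.mono {Y : ℤ → Guard} {u V φ e K K' : ℤ} (h : GuardAt Y u V φ e K')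
    (hK : K ≤ K') : GuardAt Y u V φ e K :=
  ⟨h.phase, h.nonneg, h.le, h.pat, h.brk.imp_right (Or.imp_right hK.trans)⟩

theorem trainLocal_eq_o {X : ℤ → Train} {Y : ℤ → Guard} {i : ℤ} (h : trainLocal X Y i = .o) :
    X i = .o ∨ ((X i = .a ∨ X i = .h) ∧ X (i + 1) = .o) ∨ (X i = .h ∧ Hit X Y (i + 1)) := by
  cases hx : X i
  case o => exact Or.inl rfl
  case a =>
    right; left
    simp only [trainLocal, hx] at h
    split_ifs at h with h1 h2 h3 h4
    · exact absurd h h2.ne.1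
    · exact ⟨Or.inl rfl, h4⟩
  case h =>
    right
    simp only [trainLocal, hx] at h
    split_ifs at h with h1
    tauto
  case b =>
    exfalso
    simp only [trainLocal, hx] at h
    split_ifs at h with h1
    exact h1.ne.1 h
  all_goals
    exfalso
    simp only [trainLocal, hx] at h
    first | (split_ifs at h) | cases h

theorem trainPre_eq_o {X : ℤ → Train} {Y : ℤ → Guard} {i : ℤ} (h : trainPre X Y i = .o) :
    (∃ k, i - 2 ≤ k ∧ k ≤ i ∧ Tie X Y k ∧ ∃ p, i ≤ p ∧ p ≤ k + 2 ∧ Y p = .g) ∨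
      trainLocal X Y i = .o := by
  unfold trainPre at h
  split_ifs at h with h1 h2 h3
  · left
    rcases h3 with h3 | h3 | h3 | h3 | h3 | ⟨h3, h4⟩
    · exact absurd h3 h1
    · exact absurd (Or.inl h3) h2
    · exact absurd (Or.inr h3) h2
    · refine ⟨i, by omega, le_rfl, h3, ?_⟩
      rcases h3.2.2 with h5 | h5
      · exact ⟨i + 1, by omega, by omega, h5⟩
      · exact ⟨i + 2, by omega, by omega, h5⟩
    · refine ⟨i - 1, by omega, by omega, h3, ?_⟩
      rcases h3.2.2 with h5 | h5
      · exact ⟨i - 1 + 1, by omega, by omega, h5⟩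
      · exact ⟨i - 1 + 2, by omega, by omega, h5⟩
    · refine ⟨i - 2, by omega, by omega, h3, ?_⟩
      rcases h3.2.2 with h5 | h5
      · rw [show i - 2 + 1 = i - 1 by ring] at h5; exact absurd h5 h4
      · exact ⟨i - 2 + 2, by omega, by omega, h5⟩
  · exact Or.inr h

theorem canon_next (n : ℕ) :
    (cφ n = 2 * cV n - 3 ∧ cV (n + 1) = cV n + 1 ∧ cφ (n + 1) = 0) ∨
    (cφ n < 2 * cV n - 3 ∧ cV (n + 1) = cV n ∧ cφ (n + 1) = cφ n + 1) := by
  rw [cV_succ, cφ_succ]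
  rcases (isPhase_canon n).2.2.eq_or_lt with h | h
  · exact Or.inl ⟨h, next_of_eq h⟩
  · exact Or.inr ⟨h, next_of_lt h⟩

theorem LeftOpen.mono {A : Set ℤ} {V V' g : ℤ} (h : LeftOpen A V' g) (hV : V ≤ V') :
    LeftOpen A V g := ⟨h.1, fun f hf => by have := h.2 f hf; omega⟩

theorem LeftOpen.pred {A : Set ℤ} {n : ℕ} {g : ℤ} (h : LeftOpen A (cV (n + 1)) g) :
    LeftOpen A (cV n) g := h.mono (by have := canon_next n; omega)

theorem RightOpen.pred {A : Set ℤ} {n : ℕ} {f : ℤ} (h : RightOpen A (cV (n + 1)) (cφ (n + 1)) f) :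
    RightOpen A (cV n) (cφ n) f :=
  ⟨h.1, fun g hg => by have := h.2 g hg; have := canon_next n; omega⟩

/-! ### The invariant at the beginning, and its preservation for standing guards. -/

section
variable {A : Set ℤ} {X : ℕ → ℤ → Train} {Y : ℕ → ℤ → Guard} {n : ℕ}

/-- Stars are too far apart to interact yet, and by `Start` every train or guard of age `0` is that
of a star, so all others have a positive age. -/
theorem Evolution.inv_zero (h : Evolution A X Y) : Inv A X Y 0 := by
  have hs := h.start
  have far : ∀ f g, Pair A f g → f + 17 ≤ g := fun f g hp => hs.spaced f hp.1 g hp.2.1 hp.2.2.1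
  have hT : ∀ f, starTip 2 0 f = f + 3 := fun f => by rw [starTip_of_le f (by norm_num)]; ring
  have hR : ∀ f ∈ A, RightOpen A 2 0 f := fun f hf => ⟨hf, fun g hg => by
    have := far f g hg; omega⟩
  have hL : ∀ g ∈ A, LeftOpen A 2 g := fun g hg => ⟨hg, fun f hf => by
    have := far f g hf; omega⟩
  have hp : IsPhase 2 0 := by unfold IsPhase; omega
  constructor <;> simp only [cV_zero, cφ_zero, hT]
  · intro f hf
    have key := hs.train_eq f hf.1
    refine ⟨.r, ⟨fun _ => Or.inl rfl, fun h => by omega⟩, fun j h0 hj => ?_, ?_, ?_, ?_⟩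
    · rw [tW_of_le (by norm_num)] at hj
      rcases (by omega : j = 0 ∨ j = 1 ∨ j = 2) with rfl | rfl | rfl
      · rw [key _ (by rw [abs_le]; omega), if_neg (by omega), if_neg (by omega),
          if_pos (by omega), tpat_t]
      · rw [key _ (by rw [abs_le]; omega), if_neg (by omega), if_pos (by omega),
          tpat_s _ hp (by rw [tso_of_le (by norm_num)]; norm_num)]
      · rw [key _ (by rw [abs_le]; omega), if_pos (by omega),
          tpat_h _ hp (by rw [tW_of_le (by norm_num)])]
    · intro D hD; rcases hD with ⟨-, h⟩ | ⟨-, h⟩ <;> cases h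
    · refine ⟨fun h => (by cases h), ?_⟩
      rintro ⟨-, g, h1, h2⟩
      have := far f g h1; omega
    · intro D g _ h; omega
  · intro f _ i h1 h2; omega
  · intro τ hτ
    by_cases hc : (X 0 (τ - 1)).IsR ∧ X 0 (τ - 2) = .h
    · left
      have := hs.train_new τ hτ hc.1 hc.2
      exact ⟨τ - 3, hR _ this, by ring⟩
    · right
      intro K
      obtain ⟨V, φ, σ, e, h1, h2⟩ := exists_trainAt (X 0) τ hτ (hs.tip_left τ hτ) (max K 0)
        (le_max_right _ _)
      refine ⟨V, φ, σ, e, h1.mono (le_max_left _ _), by push_cast; have := h2.resolve_right hc; omega,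
        ?_⟩
      intro g D hg h3 h4
      exfalso
      rw [hs.train_eq g hg.1 τ (by rw [abs_le]; omega), if_neg (by omega), if_neg (by omega),
        if_neg (by omega)] at hτ
      cases hτ
  · intro g hg j h0 hj
    have key := hs.guard_eq g hg.1
    rcases (by omega : j = 0 ∨ j = 1 ∨ j = 2) with rfl | rfl | rfl
    · rw [key _ (by rw [abs_le]; omega), if_pos (by omega), gpat_zero]
    · rw [key _ (by rw [abs_le]; omega), if_neg (by omega), if_pos (by omega),
        gpat_r hp (by norm_num) (by norm_num)]
    · rw [key _ (by rw [abs_le]; omega), if_neg (by omega), if_neg (by omega), if_pos (by omega),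
        gpat_root le_rfl]
  · intro g hg m hm
    obtain rfl : m = 0 := by omega
    rw [hs.train_eq g hg.1 _ (by rw [abs_le]; omega), if_neg (by omega), if_neg (by omega),
      if_neg (by omega)]
  · intro g hg i h1 h2
    rw [hs.train_eq g hg.1 _ (by rw [abs_le]; omega), if_neg (by omega), if_neg (by omega),
      if_neg (by omega)]
    decide
  · intro u hu K
    obtain ⟨V, φ, e, h1, h2⟩ := exists_guardAt (Y 0) u hu (max K 0) (le_max_right _ _)
    refine ⟨V, φ, e, h1.mono (le_max_left _ _), ?_, ?_, ?_⟩
    · by_cases ha : 1 ≤ age V φ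
      · left; push_cast; omega
      · right
        have he : e = V := by
          rcases h2 with h2 | h2
          · exact h2
          · exact absurd h2.2.1 ha
        have h0 := h1.phase.age_nonneg
        obtain ⟨rfl, rfl⟩ := h1.phase.eq_of_age_eq hp (by rw [show age 2 0 = 0 by rfl]; omega)
        have p0 := h1.pat 0 le_rfl (by omega)
        have p1 := h1.pat 1 (by omega) (by omega)
        have p2 := h1.pat 2 (by omega) (by omega)
        rw [gpat_r hp (by norm_num) (by norm_num)] at p1
        rw [gpat_root le_rfl] at p2
        exact ⟨u + 2, hL _ (hs.guard_new u hu p1 p2), by ring, rfl, rfl⟩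
    · intro m hm g hg hug
      obtain rfl : m = 0 := by omega
      exact h1.add_le h2 hs.root_left hg (by push_cast at hug; omega)
    · intro f hf hfu
      left
      by_contra hc
      rw [hs.guard_eq f hf.1 u (by rw [abs_le]; omega), if_neg (by omega), if_neg (by omega),
        if_neg (by omega)] at hu
      cases hu
  · intro f g hfg h1
    have := far f g hfg; omega
  · intro f g hfg _ h1
    have := far f g hfg; omega
  · intro f g w hfg h1
    exact absurd (hR f hfg.1) h1

/-- A cell whose right neighbours are stable keeps a root. -/
theorem Inv.guardRule_root (hI : Inv A X Y n) {g : ℤ} (hg : g ∈ A) (hY : Y n g = .g) :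
    guardRule (Y n) g = .g := by
  rcases guardRule_of_g hY with h | h
  · exact h
  · exfalso
    rcases guardRule_eq_e h with h1 | h1
    · exact hI.wall_right hg h1.1
    · rw [hY] at h1; cases h1.2.1

theorem Inv.wallRule_root (hI : Inv A X Y n) {g : ℤ} (hg : g ∈ A) (hY : Y n g = .g)
    (ho : trainRule (X n) (Y n) g ≠ .o) : wallRule (X n) (Y n) g = .g := by
  rw [wallRule_eq_guardRule ho, hI.guardRule_root hg hY]
  · exact fun hc => hI.wall_right hg hc.1.1
  · intro hc; have := hc.2.1; rw [hY] at this; cases this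

theorem trainRule_dead_cell {X : ℤ → Train} {Y : ℤ → Guard} {g : ℤ} (hx : X g = .d)
    (h1 : ¬ Tick X (g - 1)) (h2 : ¬ Tick X (g - 2)) : trainRule X Y g = .d := by
  have h0 : ¬ Tick X g := fun hc => by have := hc.1; rw [hx] at this; cases this
  have tt : ∀ k, Tie X Y k → Tick X k := fun k hc => ⟨hc.1, Or.inr hc.2.1⟩
  apply trainRule_of_local _ _ (by simp)
  · rintro (hc | hc | hc | hc | hc | hc)
    · exact h2 hc.1
    · exact h1 hc.1
    · exact h0 hc.1
    · exact h0 (tt _ hc)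
    · exact h1 (tt _ hc)
    · exact h2 (tt _ hc.1)
  · simp [trainLocal, hx]

theorem Inv.fixed_step (hE : Evolution A X Y) (hI : Inv A X Y n) {g : ℤ}
    (hg : LeftOpen A (cV n) g) : trainRule (X n) (Y n) g = .d :=
  trainRule_dead_cell (hI.fixed g hg n le_rfl) (hI.not_tick hE hg (Or.inl rfl))
    (hI.not_tick hE hg (Or.inr rfl))

/-- Open space arises at a tie, next to open space, or at a hit head. A tie here would need a tip
ticking just before `g`, and hits are excluded by `Inv.not_hit`. The cell on which the end lands is
closed by the rule itself. -/
theorem Inv.closed_step (hE : Evolution A X Y) (hI : Inv A X Y n) {g i : ℤ}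
    (hg : LeftOpen A (cV (n + 1)) g) (h1 : g - cV (n + 1) ≤ i) (h2 : i ≤ g) :
    trainRule (X n) (Y n) i ≠ .o := by
  have hg' := hg.pred
  have hp := isPhase_canon n
  have hV := hp.1
  have hd := hI.fixed g hg' n le_rfl
  intro ho
  have hpre := trainRule_eq_pre (by decide) ho
  rcases lt_or_ge i (g - cV n) with h3 | h3
  · have hn := canon_next n
    obtain rfl : i = g - cV n - 1 := by omega
    have g0 := hI.guard g hg' 0 le_rfl (by omega)
    have g1 := hI.guard g hg' 1 (by omega) (by omega)
    rw [gpat_zero, add_zero] at g0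
    rw [gpat_l hp (by omega) (by omega)] at g1
    rw [trainRule, if_pos] at ho
    · cases ho
    · refine ⟨⟨by rwa [sub_add_cancel], by rwa [show g - cV n - 1 + 2 = g - cV n + 1 by ring]⟩, ?_, hpre⟩
      rw [sub_add_cancel]
      exact hI.not_killed hE hg' hg
  · rcases trainPre_eq_o hpre with ⟨k, h4, h5, h6, p, h7, h8, h9⟩ | h4
    · have htick : Tick (X n) k := ⟨h6.1, Or.inr h6.2.1⟩
      have hk : k ≠ g - 1 := by rintro rfl; exact hI.not_tick hE hg' (Or.inl rfl) htick
      have hk' : k ≠ g - 2 := by rintro rfl; exact hI.not_tick hE hg' (Or.inr rfl) htick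
      have hk'' : k ≠ g := by rintro rfl; have := htick.1; rw [hd] at this; cases this
      have := hI.guard g hg' (p - (g - cV n)) (by omega) (by omega)
      rw [add_sub_cancel, h9] at this
      exact gpat_ne_g (by omega) this.symm
    · rcases trainLocal_eq_o h4 with h5 | ⟨h5, h6⟩ | ⟨h5, h6⟩
      · exact hI.closed g hg' i h3 h2 h5
      · rcases h2.eq_or_lt with rfl | h2
        · rw [hd] at h5; simp at h5
        · exact hI.closed g hg' (i + 1) (by omega) h2 h6
      · rcases h2.eq_or_lt with rfl | h2
        · rw [hd] at h5; cases h5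
        · exact hI.not_hit hE hg' (by omega) h2 h6

theorem Inv.guard_step (hE : Evolution A X Y) (hI : Inv A X Y n) {g j : ℤ}
    (hg : LeftOpen A (cV (n + 1)) g) (h1 : 0 ≤ j) (h2 : j ≤ cV (n + 1)) :
    wallRule (X n) (Y n) (g - cV (n + 1) + j) = gpat (cV (n + 1)) (cφ (n + 1)) j := by
  have hg' := hg.pred
  have hp := isPhase_canon n
  have hV := hp.1
  have hn := canon_next n
  have ho := hI.closed_step hE hg (i := g - cV (n + 1) + j) (by omega) (by omega)
  have hkill : ∀ k, g - cV n ≤ k → k ≤ g + 1 → ¬ Killed (X n) (Y n) k := by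
    intro k h3 h4 h5
    rcases h3.eq_or_lt with rfl | h3
    · exact hI.not_killed hE hg' hg h5
    rcases h4.eq_or_lt with rfl | h4
    · exact hI.wall_right hg.1 h5.1
    have := hI.guard g hg' (k - (g - cV n)) (by omega) (by omega)
    rw [add_sub_cancel, h5.1] at this
    exact gpat_ne_e (by omega) this.symm
  rcases h2.eq_or_lt with rfl | h2
  · rw [gpat_root (by omega)]
    rw [sub_add_cancel] at ho ⊢
    apply hI.wallRule_root hg.1 _ ho
    have := hI.guard g hg' (cV n) (by omega) le_rfl
    rwa [sub_add_cancel, gpat_root hV] at this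
  by_cases hj : j < cV (n + 1) - cV n
  · obtain rfl : j = 0 := by omega
    have g0 := hI.guard g hg' 0 le_rfl (by omega)
    have g1 := hI.guard g hg' 1 (by omega) (by omega)
    rw [gpat_zero, add_zero] at g0
    rw [gpat_l hp (by omega) (by omega)] at g1
    have hland : Landing (Y n) (g - cV (n + 1) + 0) :=
      ⟨by rw [show g - cV (n + 1) + 0 + 1 = g - cV n by omega]; exact g0,
        by rw [show g - cV (n + 1) + 0 + 2 = g - cV n + 1 by omega]; exact g1⟩
    rw [wallRule_eq_guardRule ho (fun hc => hkill _ (by omega) (by omega) hc.2)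
      (fun hc => hc.1 hland), gpat_zero, guardRule, if_pos hland]
  · have e1 : g - cV (n + 1) + j = g - cV n + (j - (cV (n + 1) - cV n)) := by ring
    rw [wallRule_eq_guardRule ho (fun hc => hkill _ (by omega) (by omega) hc.2)
      (fun hc => hkill _ (by omega) (by omega) hc.2), e1,
      guardRule_of_pat hp le_rfl (hI.guard g hg') (by omega) (by omega), ← cV_succ, ← cφ_succ]
    congr 1; ring

end


/-! ### Preservation of the invariant when a train meets a guard. -/

section
variable {A : Set ℤ} {X : ℕ → ℤ → Train} {Y : ℕ → ℤ → Guard} {n : ℕ}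

/-- The head of the train of a star is hit at the end of its period. -/
theorem Inv.star_hit (hE : Evolution A X Y) (hI : Inv A X Y n) {f : ℤ}
    (hf : RightOpen A (cV n) (cφ n) f) (hφ : cφ n = 2 * cV n - 3) :
    X n (f + cV n - 1) = .h ∧ Hit (X n) (Y n) (f + cV n) ∧
      f + cV n = starTip (cV n) (cφ n) f - tso (cV n) (cφ n) := by
  have hp := isPhase_canon n
  have hV := hp.1
  have hso := tso_of_lt (V := cV n) (φ := cφ n) (by omega)
  have hW := tW_of_lt (V := cV n) (φ := cφ n) (by omega)
  have hT := starTip_of_lt (V := cV n) (φ := cφ n) f (by omega)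
  obtain ⟨σ, h1, h2, -⟩ := hI.train f hf
  have h3 := h2 (tW (cV n) (cφ n)) (by omega) le_rfl
  rw [tpat_h σ hp rfl, hT, hW, show f + 2 * cV n + 1 - (cV n + 2) = f + cV n - 1 by ring] at h3
  have h4 := h2 (tso (cV n) (cφ n)) (by omega) (by omega)
  rw [tpat_s σ hp rfl, hT, hso,
    show f + 2 * cV n + 1 - (cφ n + 4 - cV n) = f + cV n by omega] at h4
  have h5 : f + cV n = starTip (cV n) (cφ n) f - tso (cV n) (cφ n) := by omega
  refine ⟨h3, ⟨h3, by rw [h4]; exact h1.2 (by omega), fun hc => hc.2 ?_⟩, h5⟩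
  rw [h5]
  exact (hI.tieHit_of_seen hE hf (by rw [← h5]; exact hc.1)).1

/-- The train of a star destroys the end of the guard of the next star at the right moment. -/
theorem Inv.tie_kills (hE : Evolution A X Y) (hI : Inv A X Y n) {f g : ℤ} (h : Pair A f g)
    (h1 : 2 * cV n + 2 ≤ g - f) (h2 : g - f ≤ 2 * cV (n + 1) + 1) :
    cφ n = 2 * cV n - 3 ∧ RightOpen A (cV n) (cφ n) f ∧ LeftOpen A (cV n) g ∧
      Hit (X n) (Y n) (f + cV n) ∧ TieHit (X n) (Y n) (f + cV n) ∧
      Killed (X n) (Y n) (g - cV n) := by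
  have hp := isPhase_canon n
  have hV := hp.1
  have hn := canon_next n
  have hφ : cφ n = 2 * cV n - 3 := by omega
  have hf : RightOpen A (cV n) (cφ n) f := ⟨h.1, fun g' hg' => by
    have := h.right_unique hg'; omega⟩
  have hg : LeftOpen A (cV n) g := ⟨h.2.1, fun f' hf' => by
    have := h.left_unique hf'; omega⟩
  have hso := tso_of_lt (V := cV n) (φ := cφ n) (by omega)
  have hT := starTip_of_lt (V := cV n) (φ := cφ n) f (by omega)
  obtain ⟨k1, k2, k3⟩ := hI.star_hit hE hf hφ
  obtain ⟨σ, -, h4, -, -, h5⟩ := hI.train f hf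
  have hA := h5 (g - f - 2 * cV n - 1) g h (by omega) (by omega) (by omega)
  have hX := h4 (tso (cV n) (cφ n)) (by omega) (by have := hp.tso_lt; omega)
  rw [tpat_s σ hp rfl, ← k3] at hX
  rw [← hX] at hA
  have g0 := hI.guard g hg 0 le_rfl (by omega)
  have g1 := hI.guard g hg 1 (by omega) (by omega)
  rw [gpat_zero, add_zero] at g0
  rw [gpat_l hp (by omega) (by omega)] at g1
  have hth : TieHit (X n) (Y n) (f + cV n) := tieHit_iff.2 ⟨k1, _, hA, by
    rw [show f + cV n + 1 + (g - f - 2 * cV n - 1) = g - cV n by ring]; exact g0, by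
    rw [show f + cV n + 2 + (g - f - 2 * cV n - 1) = g - cV n + 1 by ring]; exact g1⟩
  refine ⟨hφ, hf, hg, k2, hth, g0, Or.inr (Or.inr ?_)⟩
  rcases hA with ⟨hD, hA⟩ | ⟨hD, hA⟩
  · left
    rw [show g - cV n - 2 = f + cV n by omega]
    exact ⟨hth, hA⟩
  · right
    rw [show g - cV n - 3 = f + cV n by omega]
    exact ⟨hth, hA⟩

/-- When the end of `g` is destroyed, any other end between the stars has a guard at least as wide
with no root beyond `g`, hence lies left of the destroyed one. The two cells at the head are hit,
and the only cell that may remain is followed directly by an end, so it cannot survive. -/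
theorem Inv.free_step (hE : Evolution A X Y) (hI : Inv A X Y n) {f g u : ℤ} (h : Pair A f g)
    (h2 : g - f ≤ 2 * cV (n + 1) + 1) (hu1 : f < u) (hu2 : u ≤ g) :
    wallRule (X n) (Y n) u ≠ .e := by
  intro he
  have hp := isPhase_canon n
  have hn := canon_next n
  have hV := hp.1
  obtain ⟨v, hv, hvu, -⟩ := GuardAt.step (wallRule_cases (X n) (Y n)) (K := 1) le_rfl he
  obtain ⟨-, k1, k2⟩ := wallRule_eq_e he
  have hkill : ¬ Killed (X n) (Y n) v := by
    rcases hvu with ⟨rfl, h3, -⟩ | ⟨rfl, h3⟩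
    · exact fun hc => k2 ⟨h3, hc⟩
    · exact fun hc => k1 ⟨h3, hc⟩
  have hvu' : v = u ∨ v = u + 1 := by tauto
  have hvg : v ≠ g + 1 := by rintro rfl; exact hI.wall_right h.2.1 hv
  rcases le_or_gt (g - f) (2 * cV n + 1) with h3 | h3
  · exact hI.free f g h h3 v (by omega) (by omega) hv
  obtain ⟨hφ, hf, hg, hhit, hth, hkg⟩ := hI.tie_kills hE h (by omega) h2
  have hroot := hI.guard g hg (cV n) (by omega) le_rfl
  rw [sub_add_cancel, gpat_root hV] at hroot
  have hvg' : v ≠ g := by rintro rfl; rw [hv] at hroot; cases hroot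
  obtain ⟨V, φ, e, h4, h5, h6, h7⟩ := hI.wall v hv 0
  have h8 := h6 n le_rfl g hroot (by omega)
  have h9 : cV n ≤ V := by
    rcases h5 with h5 | ⟨_, _, _, h5, _⟩
    · rcases h4.phase.older h5 with h | h
      · exact h.le
      · exact h.1.le
    · exact h5.ge
  have h10 := h7 f hf (by omega)
  have k3 : v ≠ f + cV n := by rintro rfl; exact hkill ⟨hv, Or.inl hhit⟩
  have k4 : v ≠ f + cV n + 1 := by
    rintro rfl
    exact hkill ⟨hv, Or.inr (Or.inl (by rwa [add_sub_cancel_right]))⟩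
  have k5 : v ≠ g - cV n := by rintro rfl; exact hkill hkg
  have k6 : Y n (v + 1) = .e := by rw [show v + 1 = g - cV n by omega]; exact hkg.1
  rcases hvu with ⟨rfl, -, h11⟩ | ⟨rfl, h11⟩
  · rw [k6] at h11; simp at h11
  · have := h11.2
    rw [show u + 2 = u + 1 + 1 by ring, k6] at this; cases this

theorem Inv.middle_step (hE : Evolution A X Y) (hI : Inv A X Y n) {f g : ℤ} (h : Pair A f g)
    (hf : RightOpen A (cV (n + 1)) (cφ (n + 1)) f) (h2 : g - f ≤ 2 * cV (n + 1) + 1) :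
    trainRule (X n) (Y n) g = .d ∧ wallRule (X n) (Y n) g = .g := by
  have hn := canon_next n
  have hp := isPhase_canon n
  have hV := hp.1
  have key : trainRule (X n) (Y n) g = .d ∧ Y n g = .g := by
    rcases le_or_gt (g - f) (2 * cV n + 1) with h3 | h3
    · have h4 := hf.of_le h h2
      obtain ⟨h5, h6⟩ := hI.middle f g h hf.pred h3
      exact ⟨trainRule_dead_cell h5 (hI.not_tick' h hf.pred h3 (Or.inl rfl) (by omega))
        (hI.not_tick' h hf.pred h3 (Or.inr rfl) (by omega)), h6⟩
    · have hg : LeftOpen A (cV n) g := ⟨h.2.1, fun f' hf' => by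
        have := h.left_unique hf'; omega⟩
      refine ⟨hI.fixed_step hE hg, ?_⟩
      have hroot := hI.guard g hg (cV n) (by omega) le_rfl
      rwa [sub_add_cancel, gpat_root hV] at hroot
  exact ⟨key.1, hI.wallRule_root h.2.1 key.2 (by rw [key.1]; decide)⟩

/-- The position of the alleged root and the lead in age are conserved by `GuardAt.step`. When a
head advances, ends on the two cells it hits are destroyed, so the remaining ones keep their
distance. -/
theorem Inv.wall_step (hE : Evolution A X Y) (hI : Inv A X Y n) {u : ℤ}
    (he : wallRule (X n) (Y n) u = .e) (K : ℤ) :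
    ∃ V φ e, GuardAt (wallRule (X n) (Y n)) u V φ e K ∧
    (((n + 1 : ℕ) : ℤ) + 1 ≤ age V φ ∨
      ∃ g, LeftOpen A (cV (n + 1)) g ∧ u = g - cV (n + 1) ∧ V = cV (n + 1) ∧ φ = cφ (n + 1)) ∧
    (∀ m : ℕ, m ≤ n + 1 → ∀ g, Y m g = .g → u + ((n + 1 : ℕ) - m) < g → u + V ≤ g) ∧
    ∀ f, RightOpen A (cV (n + 1)) (cφ (n + 1)) f → f < u → f + cV (n + 1) + 1 ≤ u ∨
      (u = f + cV (n + 1) ∧ 2 * cV (n + 1) - 2 - cφ (n + 1) ≤ 2 * V - 2 - φ) := by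
  have hp := isPhase_canon n
  have hn := canon_next n
  have hV := hp.1
  obtain ⟨v, hv, hvu, hstep⟩ := GuardAt.step (wallRule_cases (X n) (Y n)) (K := max K 0 + 1)
    (by have := le_max_right K 0; omega) he
  obtain ⟨-, k1, k2⟩ := wallRule_eq_e he
  have hkill : ¬ Killed (X n) (Y n) v := by
    rcases hvu with ⟨rfl, h3, -⟩ | ⟨rfl, h3⟩
    · exact fun hc => k2 ⟨h3, hc⟩
    · exact fun hc => k1 ⟨h3, hc⟩
  replace hvu : v = u ∨ v = u + 1 := by tauto
  obtain ⟨V, φ, e, h1, h2, h3, h4⟩ := hI.wall v hv (max K 0 + 1)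
  obtain ⟨h5, e', h6⟩ := hstep V φ e h1
  rw [add_sub_cancel_right] at h6
  have hnext : (φ = 2 * V - 3 ∧ nextV V φ = V + 1 ∧ nextφ V φ = 0) ∨
      (φ < 2 * V - 3 ∧ nextV V φ = V ∧ nextφ V φ = φ + 1) := by
    rcases h1.phase.2.2.eq_or_lt with h | h
    · exact Or.inl ⟨h, next_of_eq h⟩
    · exact Or.inr ⟨h, next_of_lt h⟩
  have hVV : cV n ≤ V := by
    rcases h2 with h2 | ⟨_, _, _, h2, _⟩
    · rcases h1.phase.older h2 with h | h
      · exact h.le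
      · exact h.1.le
    · exact h2.ge
  refine ⟨_, _, e', h6.mono (le_max_left _ _), ?_, ?_, ?_⟩
  · rcases h2 with h2 | ⟨g, h2, h7, rfl, rfl⟩
    · left; rw [age_next]; push_cast; omega
    · right
      rw [← cV_succ] at h5 ⊢
      rw [← cφ_succ]
      refine ⟨g, ?_, by omega, rfl, rfl⟩
      by_contra hg
      rcases (leftOpen_or (V := cV (n + 1)) h2.1).resolve_left hg with ⟨f, h8, h9⟩
      have h10 := (hI.tie_kills hE h8 (h2.2 f h8) h9).2.2.2.2.2
      rw [← h7] at h10
      exact hkill h10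
  · intro m hm g hg hug
    rcases hm.eq_or_lt with rfl | hm
    · rw [hE.wall] at hg
      have hg' := wallRule_eq_g hg
      have : v ≠ g := by rintro rfl; rw [hv] at hg'; cases hg'
      have := h3 n le_rfl g hg' (by omega)
      omega
    · have := h3 m (by omega) g hg (by push_cast at hug; omega)
      omega
  · intro f hf hfu
    have hφ0 := hp.2.1
    have h7 := h4 f hf.pred (by omega)
    rcases hn with ⟨hφ, hn1, hn2⟩ | ⟨hφ, hn1, hn2⟩
    · obtain ⟨-, hhit, -⟩ := hI.star_hit hE hf.pred hφ
      have k3 : v ≠ f + cV n := by rintro rfl; exact hkill ⟨hv, Or.inl hhit⟩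
      have k4 : v ≠ f + cV n + 1 := by
        rintro rfl
        exact hkill ⟨hv, Or.inr (Or.inl (by rwa [add_sub_cancel_right]))⟩
      omega
    · omega

end


theorem trainRule_eq_trainLocal {X : ℤ → Train} {Y : ℤ → Guard} {i : ℤ}
    (ho : ¬ Overwritten X Y i) (hl : ¬ Landing Y i) : trainRule X Y i = trainLocal X Y i := by
  rw [trainRule, if_neg (fun hc => hl hc.1), trainPre_of_not_overwritten ho]

/-! ### Preservation of the invariant for trains of stars. -/

section
variable {A : Set ℤ} {X : ℕ → ℤ → Train} {Y : ℕ → ℤ → Guard} {n : ℕ}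

theorem IsPhase.starTip_next {V φ : ℤ} (h : IsPhase V φ) (f : ℤ) :
    starTip (nextV V φ) (nextφ V φ) f = starTip V φ f + tshift V φ := by
  obtain ⟨h1, h2, h3⟩ := h
  unfold tshift starTip tW
  rcases h3.eq_or_lt with h4 | h4
  · rw [(next_of_eq h4).1, (next_of_eq h4).2]; split_ifs <;> omega
  · rw [(next_of_lt h4).1, (next_of_lt h4).2]; split_ifs <;> omega

theorem starTip_next (n : ℕ) (f : ℤ) :
    starTip (cV (n + 1)) (cφ (n + 1)) f = starTip (cV n) (cφ n) f + tshift (cV n) (cφ n) :=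
  (isPhase_canon n).starTip_next f

theorem Inv.not_tip (hI : Inv A X Y n) {f k : ℤ} (hf : RightOpen A (cV n) (cφ n) f) (h1 : f < k)
    (h2 : k < starTip (cV n) (cφ n) f) : X n k ≠ .t := by
  rcases lt_or_ge k (f + cV n - 1) with h3 | h3
  · rw [hI.zone f hf k h1 h3]; decide
  · obtain ⟨σ, h4, h5, -⟩ := hI.train f hf
    have := h5 (starTip (cV n) (cφ n) f - k) (by omega) (by unfold starTip; omega)
    rw [sub_sub_cancel] at this
    rw [this]
    exact tpat_ne_t h4 (by omega)

theorem Inv.train_not_overwritten (hE : Evolution A X Y) (hI : Inv A X Y n) {f k : ℤ}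
    (hf : RightOpen A (cV n) (cφ n) f) (h1 : f < k) (h2 : k < starTip (cV n) (cφ n) f) :
    ¬ Overwritten (X n) (Y n) k :=
  hI.not_overwritten hE hf.1 h1 fun _ h3 _ h4 hc => hI.not_tip hf h3 (by omega) hc.1

/-- The last moment of the train of a star. -/
theorem Inv.tie_of_last (hI : Inv A X Y n) {f : ℤ} (hf : RightOpen A (cV n) (cφ n) f)
    (hf' : ¬ RightOpen A (cV (n + 1)) (cφ (n + 1)) f) :
    cφ n + 2 = cV n ∧ Tie (X n) (Y n) (starTip (cV n) (cφ n) f) ∧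
      ∃ g, Pair A f g ∧ 2 * cV n ≤ g - f ∧ g - f ≤ 2 * cV n + 1 := by
  have hp := isPhase_canon n
  have hV := hp.1
  have hn := canon_next n
  have : ∃ g, Pair A f g ∧ ¬ (2 * cV (n + 1) + 2 ≤ g - f ∨
      (2 * cV (n + 1) ≤ g - f ∧ cφ (n + 1) + 2 ≤ cV (n + 1))) := by
    by_contra hc
    push Not at hc
    exact hf' ⟨hf.1, fun g hg => by
      by_contra hc'; have := hc g hg; push Not at hc'; omega⟩
  obtain ⟨g, hg, h1⟩ := this
  have h2 := hf.2 g hg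
  have hφ : cφ n + 2 = cV n := by omega
  have hQ : 2 * cV n ≤ g - f ∧ g - f ≤ 2 * cV n + 1 := by omega
  refine ⟨hφ, ?_, g, hg, hQ⟩
  obtain ⟨σ, h3, h4, -, h5, -⟩ := hI.train f hf
  have hso := tso_of_le hφ.le
  have hW := tW_of_le hφ.le
  have hT := starTip_of_le f hφ.le
  have ht0 := h4 0 le_rfl (by omega)
  have ht1 := h4 1 (by omega) (by omega)
  rw [tpat_t, sub_zero] at ht0
  rw [tpat_s σ hp (by omega), h5.2 ⟨hφ.le, g, hg, hQ.2⟩] at ht1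
  have hr := (hI.middle f g hg hf hQ.2).2
  refine ⟨ht0, ht1, ?_⟩
  rcases (by omega : g - f = 2 * cV n ∨ g - f = 2 * cV n + 1) with h6 | h6
  · left; rwa [show starTip (cV n) (cφ n) f + 1 = g by omega]
  · right; rwa [show starTip (cV n) (cφ n) f + 2 = g by omega]

/-- A tie would need the signal `rt`, hence a star within `2 * cV n + 1` cells, and the train would
stop running at this step. -/
theorem Inv.star_push (hI : Inv A X Y n) {f : ℤ}
    (hf' : RightOpen A (cV (n + 1)) (cφ (n + 1)) f) (hφ : cφ n + 2 = cV n) :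
    Push (X n) (Y n) (starTip (cV n) (cφ n) f) := by
  have hp := isPhase_canon n
  have hV := hp.1
  have hn := canon_next n
  obtain ⟨σ, h3, h4, -, h5, -⟩ := hI.train f hf'.pred
  have hso := tso_of_le hφ.le
  have hW := tW_of_le hφ.le
  have ht0 := h4 0 le_rfl (by omega)
  have ht1 := h4 1 (by omega) (by omega)
  rw [tpat_t, sub_zero] at ht0
  rw [tpat_s σ hp (by omega)] at ht1
  refine ⟨⟨ht0, by rw [ht1]; exact h3.1 hφ.le⟩, fun hc => ?_⟩
  have hσ := hc.2.1
  rw [ht1, h5] at hσ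
  clear h5
  obtain ⟨-, g, hg, h6⟩ := hσ
  have := hf'.2 g hg
  omega

/-- The shape of the train of a star after one step. -/
theorem Inv.train_pat_step (hE : Evolution A X Y) (hI : Inv A X Y n) {f : ℤ} {σ : Train}
    (hf' : RightOpen A (cV (n + 1)) (cφ (n + 1)) f) (hk : KindOk (cV n) (cφ n) σ)
    (hpat : ∀ j, 0 ≤ j → j ≤ tW (cV n) (cφ n) →
      X n (starTip (cV n) (cφ n) f - j) = tpat (cV n) (cφ n) σ j) {k : ℤ} (h0 : 0 ≤ k)
    (hkW : k ≤ tW (cV (n + 1)) (cφ (n + 1))) :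
    trainRule (X n) (Y n) (starTip (cV (n + 1)) (cφ (n + 1)) f - k) =
      tpat (cV (n + 1)) (cφ (n + 1))
        (nextσ (X n) (Y n) (starTip (cV n) (cφ n) f) (cV n) (cφ n) σ) k := by
  have hf := hf'.pred
  have hp := isPhase_canon n
  have hp' := isPhase_canon (n + 1)
  have hn := canon_next n
  obtain ⟨hV, hφ0, hφ1⟩ := id hp
  have hso := hp.tso_pos
  have hsW := hp.tso_lt
  have hk' := kindOk_next (X := X n) (Y := Y n) (τ := starTip (cV n) (cφ n) f) hp hk
  rw [← cV_succ, ← cφ_succ] at hk'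
  rw [starTip_next]
  set T := starTip (cV n) (cφ n) f with hT
  have hTf : T = f + cV n - 1 + tW (cV n) (cφ n) := rfl
  set s := tshift (cV n) (cφ n) with hs
  have hs' : (cφ n + 2 = cV n ∧ s = 2) ∨ (cφ n + 2 ≠ cV n ∧ s = 0) := by
    rw [hs]; unfold tshift; split_ifs <;> simp_all
  have sizes : (cφ n = 2 * cV n - 3 ∧ s = 0 ∧
        tW (cV (n + 1)) (cφ (n + 1)) + 1 = tW (cV n) (cφ n)) ∨
      (cφ n < 2 * cV n - 3 ∧ tW (cV (n + 1)) (cφ (n + 1)) = tW (cV n) (cφ n) + s) := by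
    rcases hn with ⟨a, b, c⟩ | ⟨a, b, c⟩
    · left
      rw [b, c, tW_of_le (by omega), tW_of_lt (by omega)]; omega
    · right
      rw [b, c]
      refine ⟨a, ?_⟩
      unfold tW
      split_ifs <;> omega
  have hW2 : 2 ≤ tW (cV n) (cφ n) := by unfold tW; split_ifs <;> omega
  rcases le_or_gt k s with hks | hks
  · rcases hs' with ⟨hφ, hs'⟩ | ⟨hφ, hs'⟩
    · have hpush := hI.star_push hf' hφ
      rw [← hT] at hpush
      have hso' : tso (cV (n + 1)) (cφ (n + 1)) = 3 := by
        rw [tso_of_lt (by omega)]; omega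
      have hn1 : ¬ Push (X n) (Y n) (T - 1) := fun hc =>
        hI.not_tip hf (by omega) (by omega) hc.tip.1
      have hn2 : ¬ Push (X n) (Y n) (T - 2) := fun hc =>
        hI.not_tip hf (by omega) (by omega) hc.tip.1
      rcases (by omega : k = 0 ∨ k = 1 ∨ k = 2) with rfl | rfl | rfl
      · rw [tpat_t]
        exact trainRule_of_push (by rwa [show T + s - 0 - 2 = T by omega])
      · rw [tpat_b _ hp' (by omega) (by omega)]
        exact trainRule_of_push' (Or.inl (by rwa [show T + s - 1 - 1 = T by omega]))
          (by rwa [show T + s - 1 - 2 = T - 1 by omega])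
      · rw [tpat_b _ hp' (by omega) (by omega)]
        exact trainRule_of_push' (Or.inr (by rwa [show T + s - 2 = T by omega]))
          (by rwa [show T + s - 2 - 2 = T - 2 by omega])
    · obtain rfl : k = 0 := by omega
      have h1 := hpat 0 le_rfl (by omega)
      have h2 := hpat 1 (by omega) (by omega)
      have h3 := hpat 2 (by omega) (by omega)
      have htso : 2 ≤ tso (cV n) (cφ n) := by unfold tso; split_ifs <;> omega
      have hsok : tso (cV n) (cφ n) = 2 → σ.IsR := by
        intro h
        apply hk.1
        by_contra hc
        rw [tso_of_lt (by omega)] at h; omega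
      rw [tpat_t, sub_zero] at h1
      rw [tpat_b _ hp one_pos (by omega)] at h2
      have h4 : (X n (T - 2)).IsR ∨ X n (T - 2) = .b := by
        rw [h3]
        rcases htso.eq_or_lt with h5 | h5
        · rw [tpat_s _ hp h5]; exact Or.inl (hsok h5.symm)
        · exact Or.inr (tpat_b _ hp (by omega) h5)
      rw [tpat_t, hs', add_zero, sub_zero]
      apply trainRule_of_local _ _ (by decide)
      · apply hI.not_overwritten hE hf.1 (by omega)
        intro k' h5 _ h7 hc
        rcases h7.eq_or_lt with rfl | h7
        · have := hc.2; rw [h2] at this; simp [Train.IsR] at this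
        · exact hI.not_tip hf h5 h7 hc.1
      · simp [trainLocal, h1, h2, h4]
  · rw [show T + s - k = T - (k - s) by ring]
    apply trainRule_of_local (hI.train_not_overwritten hE hf (by omega) (by omega)) _ (tpat_ne_o hk')
    rcases trainLocal_of_pat (X := X n) (Y := Y n) (j := k - s) hp hk le_rfl hpat (by omega)
      (by omega) (Or.inr (Or.inl rfl)) (fun h => hI.star_push hf' h) with h1 | ⟨h1, h2⟩
    · rw [h1, ← cV_succ, ← cφ_succ, ← hs, sub_add_cancel]
    -- The signal of a star never dies, since whatever it sees is a tie.
    · exfalso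
      rcases h2 with h2 | h2
      · exact h2.2 (hI.tieHit_of_seen hE hf h2.1).1
      · omega

/-- Announcements are made when the tip moves and then carried unchanged, which fixes the time `m`.
The signal `rt` is born when the head is hit in a tie, which happens exactly if the next star comes
into the range of the new width. -/
theorem Inv.train_step (hE : Evolution A X Y) (hI : Inv A X Y n) {f : ℤ}
    (hf' : RightOpen A (cV (n + 1)) (cφ (n + 1)) f) :
    ∃ σ, KindOk (cV (n + 1)) (cφ (n + 1)) σ ∧
    (∀ j, 0 ≤ j → j ≤ tW (cV (n + 1)) (cφ (n + 1)) →
      trainRule (X n) (Y n) (starTip (cV (n + 1)) (cφ (n + 1)) f - j) =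
        tpat (cV (n + 1)) (cφ (n + 1)) σ j) ∧
    (∀ D, Announces D σ → ∃ m : ℕ, ((n + 1 : ℕ) : ℤ) = m + tso (cV (n + 1)) (cφ (n + 1)) - 2 ∧
      Y m (starTip (cV (n + 1)) (cφ (n + 1)) f + D) = .g) ∧
    (σ = .rt ↔ cφ (n + 1) + 2 ≤ cV (n + 1) ∧ ∃ g, Pair A f g ∧ g - f ≤ 2 * cV (n + 1) + 1) ∧
    (∀ D g, Pair A f g → cV (n + 1) < cφ (n + 1) + 2 →
      starTip (cV (n + 1)) (cφ (n + 1)) f + D = g → D = 1 ∨ D = 2 → Announces D σ) := by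
  have hf := hf'.pred
  have hp := isPhase_canon n
  have hn := canon_next n
  obtain ⟨hV, hφ0, hφ1⟩ := id hp
  obtain ⟨σ, hk, hpat, h1, h2, h3⟩ := hI.train f hf
  have hk' := kindOk_next (X := X n) (Y := Y n) (τ := starTip (cV n) (cφ n) f) hp hk
  rw [← cV_succ, ← cφ_succ] at hk'
  refine ⟨_, hk', fun j h4 h5 => hI.train_pat_step hE hf' hk hpat h4 h5, ?_, ?_, ?_⟩
  · clear h2
    intro D hD
    unfold nextσ at hD
    rw [starTip_next]
    split_ifs at hD with h4 h5 h6 h5 h6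
    · refine ⟨n, by rw [tso_of_lt (by omega)]; push_cast; omega, ?_⟩
      obtain rfl : D = 1 := by rcases hD with hD | hD <;> simp_all
      rw [tshift, if_pos h4, add_assoc]; exact h5
    · refine ⟨n, by rw [tso_of_lt (by omega)]; push_cast; omega, ?_⟩
      obtain rfl : D = 2 := by rcases hD with hD | hD <;> simp_all
      rw [tshift, if_pos h4, add_assoc]; exact h6
    · rcases hD with hD | hD <;> cases hD.2
    · rcases hD with hD | hD <;> cases hD.2
    · rcases hD with hD | hD <;> cases hD.2
    · obtain ⟨m, h6, h7⟩ := h1 D hD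
      have h8 : cV n < cφ n + 2 := by
        by_contra hc
        exact (hk.1 (by omega)).ne.2.2.2.2.2.2.2 hD.isL
      rw [tso_of_lt h8] at h6
      refine ⟨m, by rw [tso_of_lt (by omega)]; push_cast; omega, ?_⟩
      rw [tshift, if_neg h4, add_zero]; exact h7
  · unfold nextσ
    split_ifs with h4 h5 h6 h5 h6
    · simp; omega
    · simp; omega
    · simp; omega
    · refine ⟨fun _ => ⟨by omega, ?_⟩, fun _ => rfl⟩
      obtain ⟨-, -, g, h7, h8⟩ := hI.tieHit_of_seen hE hf h6.seen
      exact ⟨g, h7, by omega⟩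
    · refine ⟨fun h => by simp at h, ?_⟩
      rintro ⟨h7, g, h8, h9⟩
      exfalso
      have h10 := hf.2 g h8
      obtain ⟨-, -, -, -, h11, -⟩ := hI.tie_kills hE h8 (by omega) h9
      apply h6
      rwa [← (hI.star_hit hE hf h5).2.2]
    · rw [h2]
      clear h2
      refine and_congr (by omega) ?_
      rw [(by omega : cV (n + 1) = cV n)]
  · clear h2
    intro D g h4 h5 h6 hD
    rw [starTip_next] at h6
    unfold nextσ
    split_ifs with h7 h8 h9 h8 h9
    all_goals first | rw [tshift, if_pos h7] at h6 | rw [tshift, if_neg h7] at h6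
    · rcases hD with rfl | rfl
      · exact Or.inl ⟨rfl, rfl⟩
      · exfalso
        apply hE.not_root h4.2.1 (n := n)
        rwa [show g - 1 = starTip (cV n) (cφ n) f + 3 by omega]
    · rcases hD with rfl | rfl
      · exfalso
        apply h8
        have h10 := hf'.2 g h4
        have hg : LeftOpen A (cV n) g := ⟨h4.2.1, fun f' hf' => by
          have := h4.left_unique hf'; omega⟩
        have hroot := hI.guard g hg (cV n) (by omega) le_rfl
        rw [sub_add_cancel, gpat_root hV] at hroot
        rwa [show starTip (cV n) (cφ n) f + 3 = g by omega]
      · exact Or.inr ⟨rfl, rfl⟩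
    · exfalso
      have h10 := hf'.2 g h4
      have hg : LeftOpen A (cV n) g := ⟨h4.2.1, fun f' hf' => by
        have := h4.left_unique hf'; omega⟩
      have hroot := hI.guard g hg (cV n) (by omega) le_rfl
      rw [sub_add_cancel, gpat_root hV] at hroot
      rcases hD with rfl | rfl
      · exact h8 (by rwa [show starTip (cV n) (cφ n) f + 3 = g by omega])
      · exact h9 (by rwa [show starTip (cV n) (cφ n) f + 4 = g by omega])
    · omega
    · omega
    · exact h3 D g h4 (by omega) (by omega) hD

/-- No end can close this space again: ends stay at or beyond `f + cV n`, and one about to land on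
the cell freed by the head is destroyed by the hit. -/
theorem Inv.zone_step (hE : Evolution A X Y) (hI : Inv A X Y n) {f i : ℤ}
    (hf' : RightOpen A (cV (n + 1)) (cφ (n + 1)) f) (h1 : f < i) (h2 : i < f + cV (n + 1) - 1) :
    trainRule (X n) (Y n) i = .o := by
  have hf := hf'.pred
  have hp := isPhase_canon n
  have hn := canon_next n
  have hV := hp.1
  have hW2 : 2 ≤ tW (cV n) (cφ n) := by unfold tW; split_ifs <;> omega
  have ho := hI.train_not_overwritten hE hf h1 (by unfold starTip; omega)
  rcases lt_or_ge i (f + cV n - 1) with h3 | h3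
  · rw [trainRule_eq_trainLocal ho]
    · simp [trainLocal, hI.zone f hf i h1 h3]
    · intro hl
      obtain ⟨V, φ, e, -, -, -, h4⟩ := hI.wall _ hl.1 0
      have := h4 f hf (by omega)
      omega
  · obtain ⟨h4, h5, -⟩ := hI.star_hit hE hf (by omega)
    obtain rfl : i = f + cV n - 1 := by omega
    have hloc : trainLocal (X n) (Y n) (f + cV n - 1) = .o := by
      simp [trainLocal, h4, h5]
    rw [trainRule, if_neg, trainPre_of_not_overwritten ho, hloc]
    rintro ⟨hl, hk, -⟩
    apply hk
    have := hl.1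
    rw [sub_add_cancel] at this ⊢
    exact ⟨this, Or.inl h5⟩

end


/-! ### Opened space, foreign trains, and the induction. -/

section
variable {A : Set ℤ} {X : ℕ → ℤ → Train} {Y : ℕ → ℤ → Guard} {n : ℕ}

theorem Inv.not_landing (hI : Inv A X Y n) {f g i : ℤ} (h : Pair A f g)
    (h2 : g - f ≤ 2 * cV n + 1) (h3 : f ≤ i) (h4 : i ≤ g) : ¬ Landing (Y n) i := by
  intro hl
  rcases h4.eq_or_lt with rfl | h4
  · exact hI.wall_right h.2.1 hl.1
  · exact hI.free f g h h2 (i + 1) (by omega) h4 hl.1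

/-- Right after the tie the remnant consists of the head and the cells `a` up to `f + 2 * w - 2`.
From then on the open space at its right end consumes one cell per step. -/
theorem Inv.opened_step (hE : Evolution A X Y) (hI : Inv A X Y n) {f g w : ℤ} (h : Pair A f g)
    (hf' : ¬ RightOpen A (cV (n + 1)) (cφ (n + 1)) f) (hw : w = (g - f) / 2) :
    ∃ m, Opening (trainRule (X n) (Y n)) f g w m ∧
      ((cV (n + 1) = w ∧ m + cφ (n + 1) ≤ f + 3 * w - 3) ∨
      (cV (n + 1) = w + 1 ∧ m + cφ (n + 1) ≤ f + w - 1) ∨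
      (w + 2 ≤ cV (n + 1) ∧ m ≤ f + w - 2)) := by
  have hp := isPhase_canon n
  have hn := canon_next n
  obtain ⟨hV, hφ0, hφ1⟩ := id hp
  have hfar := hE.start.spaced f h.1 g h.2.1 h.2.2.1
  by_cases hf : RightOpen A (cV n) (cφ n) f
  · obtain ⟨hφ, htie, g', hg', h1, h2⟩ := hI.tie_of_last hf hf'
    obtain rfl := hg'.right_unique h
    obtain rfl : w = cV n := by omega
    obtain ⟨σ, hk, hpat, -⟩ := hI.train f hf
    have hso := tso_of_le hφ.le
    have hW := tW_of_le hφ.le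
    have hT := starTip_of_le f hφ.le
    rw [hT] at hpat htie
    have hnot := fun k => hI.not_tip (k := k) hf
    rw [hT] at hnot
    have hlow : ∀ i, f < i → i < f + 2 * cV n - 1 →
        trainRule (X n) (Y n) i = trainLocal (X n) (Y n) i := by
      intro i h3 h4
      exact trainRule_eq_trainLocal (hI.train_not_overwritten hE hf h3 (by omega))
        (hI.not_landing h h2 (by omega) (by omega))
    have cell : ∀ i, f + cV n - 1 ≤ i → i ≤ f + 2 * cV n - 1 →
        X n i = tpat (cV n) (cφ n) σ (f + 2 * cV n - 1 - i) := by
      intro i h3 h4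
      rw [← hpat _ (by omega) (by omega), sub_sub_cancel]
    have right : ∀ i, f + cV n - 1 < i → i < f + 2 * cV n - 1 →
        X n i = .a ∨ (i = f + 2 * cV n - 2 ∧ (X n i).IsR) := by
      intro i h3 h4
      rw [cell i h3.le h4.le]
      rcases (by omega : i = f + 2 * cV n - 2 ∨ i < f + 2 * cV n - 2) with h5 | h5
      · right
        refine ⟨h5, ?_⟩
        rw [tpat_s σ hp (by omega)]
        exact hk.1 hφ.le
      · exact Or.inl (tpat_a σ hp (by omega) (by omega))
    have hhead : X n (f + cV n - 1) = .h := by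
      rw [cell _ le_rfl (by omega), tpat_h σ hp (by omega)]
    refine ⟨f + 2 * cV n - 2, ?_, Or.inl ⟨by omega, by omega⟩⟩
    intro i h3 h4
    rcases lt_trichotomy i (f + cV n - 1) with h5 | h5 | h5
    · rw [if_pos (Or.inl h5), hlow i h3 (by omega)]
      simp [trainLocal, hI.zone f hf i h3 h5]
    · rw [if_neg (by omega), if_pos h5, hlow i h3 (by omega)]
      rw [← h5] at hhead
      have h6 : ¬ (X n (i + 1)).IsL ∧ X n (i + 1) ≠ .o := by
        rcases right (i + 1) (by omega) (by omega) with h6 | ⟨-, h6⟩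
        · rw [h6]; simp [Train.IsL]
        · exact ⟨h6.ne.2.2.2.2.2.2.2, h6.ne.1⟩
      exact trainLocal_h hhead h6.1 h6.2
    rcases lt_or_ge i (f + 2 * cV n - 1) with h6 | h6
    · rw [if_neg (by omega), if_neg (by omega), hlow i h3 h6]
      have hl : X n (i - 1) = .h ∨ X n (i - 1) = .a := by
        rcases (by omega : i - 1 = f + cV n - 1 ∨ f + cV n - 1 < i - 1) with h7 | h7
        · rw [h7]; exact Or.inl hhead
        · rcases right (i - 1) h7 (by omega) with h8 | h8
          · exact Or.inr h8
          · omega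
      rcases right i h5 h6 with h7 | ⟨h7, h8⟩
      · have h9 : ¬ (X n (i + 1)).IsL ∧ X n (i + 1) ≠ .o := by
          rcases (by omega : i + 1 < f + 2 * cV n - 1 ∨ i + 1 = f + 2 * cV n - 1) with h9 | h9
          · rcases right (i + 1) (by omega) h9 with h6 | ⟨-, h6⟩
            · rw [h6]; simp [Train.IsL]
            · exact ⟨h6.ne.2.2.2.2.2.2.2, h6.ne.1⟩
          · rw [h9, htie.1]; simp [Train.IsL]
        exact trainLocal_a h7 hl h9.1 h9.2
      · apply trainLocal_r h8 hl
        rw [show i + 1 = f + 2 * cV n - 1 by omega]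
        exact fun hc => hc.2 htie
    · rw [if_pos (Or.inr (by omega))]
      have hg := (hI.middle f g' h hf h2).1
      have np : ∀ k, f + 2 * cV n - 3 ≤ k → k ≤ g' → ¬ Push (X n) (Y n) k := by
        intro k h7 h8 hc
        rcases h8.eq_or_lt with rfl | h8
        · have := hc.tip.1; rw [hg] at this; cases this
        rcases lt_trichotomy k (f + 2 * cV n - 1) with h9 | rfl | h9
        · exact hnot k (by omega) h9 hc.tip.1
        · exact hc.2 htie
        · have := hc.tip.2
          rw [show k - 1 = f + 2 * cV n - 1 by omega, htie.1] at this
          simp [Train.IsR] at this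
      have hov : Overwritten (X n) (Y n) i := by
        rcases (by omega : i = f + 2 * cV n - 1 ∨ i - 1 = f + 2 * cV n - 1 ∨
          (i - 2 = f + 2 * cV n - 1 ∧ i = g')) with h7 | h7 | ⟨h7, h8⟩
        · exact Or.inr (Or.inr (Or.inr (Or.inl (h7 ▸ htie))))
        · exact Or.inr (Or.inr (Or.inr (Or.inr (Or.inl (h7 ▸ htie)))))
        · refine Or.inr (Or.inr (Or.inr (Or.inr (Or.inr ⟨h7 ▸ htie, ?_⟩))))
          rw [h8]; exact hE.not_root h.2.1
      rw [trainRule, if_neg (fun hc => hI.not_landing h h2 (by omega) h4 hc.1), trainPre,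
        if_neg (np _ (by omega) (by omega)), if_neg, if_pos hov]
      rintro (hc | hc)
      · exact np _ (by omega) (by omega) hc
      · exact np _ (by omega) (by omega) hc
  · obtain ⟨m, hm, hb⟩ := hI.opened f g w h hf hw
    have h1 : ¬ (2 * cV n + 2 ≤ g - f ∨ (2 * cV n ≤ g - f ∧ cφ n + 2 ≤ cV n)) := fun hc =>
      hf ⟨h.1, fun g' hg' => by rw [← h.right_unique hg']; exact hc⟩
    refine ⟨m - 1, ?_, by omega⟩
    intro i h3 h4
    have hnt : ∀ k, f < k → k ≤ g → X n k ≠ .t := by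
      intro k h5 h6
      rw [hm k h5 h6]; split_ifs <;> decide
    rw [trainRule_eq_trainLocal (hI.not_overwritten hE h.1 h3
      fun k h5 _ h6 hc => hnt k h5 (by omega) hc.1) (hI.not_landing h (by omega) (by omega) h4)]
    have hi := hm i h3 h4
    by_cases h5 : i < f + w - 1 ∨ m < i
    · rw [if_pos h5] at hi
      rw [if_pos (by omega)]
      simp [trainLocal, hi]
    rw [if_neg h5] at hi
    have hr := hm (i + 1) (by omega) (by omega)
    have hl : f + w - 1 < i → X n (i - 1) = .h ∨ X n (i - 1) = .a := by
      intro h6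
      rw [hm (i - 1) (by omega) (by omega), if_neg (by omega)]
      split_ifs <;> simp
    rcases (by omega : i = m ∨ i < m) with rfl | h6
    · rw [if_pos (Or.inr (by omega))] at hr
      rw [if_pos (Or.inr (by omega))]
      split_ifs at hi with h7
      · simp [trainLocal, hi, hr]
      · simp [trainLocal, hi, hr, hl (by omega), Train.IsL]
    · rw [if_neg (by omega), if_neg (by omega)] at hr
      rw [if_neg (by omega)]
      split_ifs at hi ⊢ with h7
      · exact trainLocal_h hi (by rw [hr]; simp [Train.IsL]) (by rw [hr]; decide)
      · exact trainLocal_a hi (hl (by omega)) (by rw [hr]; simp [Train.IsL]) (by rw [hr]; decide)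

/-- The point is the death of a foreign train before a standing guard: being strictly older, its
returning signal meets the end no later than the head, and not in a tie. -/
theorem Inv.tip_step (hE : Evolution A X Y) (hI : Inv A X Y n) {u : ℤ}
    (hu : trainRule (X n) (Y n) u = .t) :
    (∃ f, RightOpen A (cV (n + 1)) (cφ (n + 1)) f ∧ u = starTip (cV (n + 1)) (cφ (n + 1)) f) ∨
    ∀ K, ∃ V φ σ e, TrainAt (trainRule (X n) (Y n)) u V φ σ e K ∧
      ((n + 1 : ℕ) : ℤ) + 1 ≤ age V φ ∧
      ∀ g D, LeftOpen A (cV (n + 1)) g → u + D = g → D = 1 ∨ D = 2 → e < tso V φ ∨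
        (V < φ + 2 ∧ Announces D σ ∧ g - cV (n + 1) ≤ u - tso V φ + 1 + D) := by
  have hp := isPhase_canon n
  have hn := canon_next n
  obtain ⟨hV, hφ0, hφ1⟩ := id hp
  by_cases hgen : ∃ f, RightOpen A (cV (n + 1)) (cφ (n + 1)) f ∧
    u = starTip (cV (n + 1)) (cφ (n + 1)) f
  · exact Or.inl hgen
  right
  intro K
  -- Two cells are lost in the step; the rest reaches beyond any signal that has not yet passed the
  -- end of a guard of width `cV n`.
  set K' := max K (cV n + 10) + 2 with hK'
  have hK1 := le_max_left K (cV n + 10)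
  have hK2 := le_max_right K (cV n + 10)
  obtain ⟨v, hv, hvu, hstep⟩ := TrainAt.step (X := X n) (Y := Y n) (K := K') (by omega) hu
  obtain ⟨V, φ, σ, e, h1, ⟨f, h2, h3, rfl, rfl⟩ | ⟨h2, h3⟩⟩ := hI.tip_data hv K'
  · exfalso
    obtain ⟨h4, -⟩ := hstep _ _ _ _ h1
    by_cases hf' : RightOpen A (cV (n + 1)) (cφ (n + 1)) f
    · exact hgen ⟨f, hf', by rw [starTip_next, h4, h3]⟩
    · obtain ⟨-, h5, -⟩ := hI.tie_of_last h2 hf'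
      rw [← h3] at h5
      rcases hvu with ⟨-, h6⟩ | ⟨h6, h7⟩
      · exact h6.2 h5
      · rw [h6] at h7
        exact h7 (Or.inr (Or.inr (Or.inr (Or.inl h5))))
  obtain ⟨h4, e', h5, h6⟩ := hstep _ _ _ _ h1
  refine ⟨_, _, _, e', h5.mono (by omega), by rw [age_next]; push_cast; omega, ?_⟩
  intro g D hg hug hD
  have hg' := hg.pred
  by_cases he : e < tso V φ
  · exact Or.inl (h6 he)
  by_cases he' : e' < tso (nextV V φ) (nextφ V φ)
  · exact Or.inl he'
  right
  have hso := h1.phase.tso_pos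
  have hsW := h1.phase.tso_lt
  obtain ⟨hV2, hφ2, hφ3⟩ := id h1.phase
  have hXs : X n (v - tso V φ) = σ := by
    rw [h1.pat _ hso.le (by omega), tpat_s σ h1.phase rfl]
  have hso' := h5.phase.tso_pos
  have hXs' : trainRule (X n) (Y n) (u - tso (nextV V φ) (nextφ V φ)) =
      nextσ (X n) (Y n) v V φ σ := by
    rw [h5.pat _ hso'.le (by omega), tpat_s _ h5.phase rfl]
  have hroot := hI.guard g hg' (cV n) (by omega) le_rfl
  rw [sub_add_cancel, gpat_root hV] at hroot
  have g0 := hI.guard g hg' 0 le_rfl (by omega)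
  rw [gpat_zero, add_zero] at g0
  by_cases hc1 : φ + 2 = V
  · rw [tshift, if_pos hc1] at h4
    obtain ⟨hn1, hn2⟩ := next_of_lt (V := V) (φ := φ) (by omega)
    rw [hn1, hn2]
    refine ⟨by omega, ?_, by rw [tso_of_lt (by omega)]; omega⟩
    rw [nextσ, if_pos hc1]
    rcases hD with rfl | rfl
    · rw [if_pos (by rwa [show v + 3 = g by omega])]
      exact Or.inl ⟨rfl, rfl⟩
    · rw [if_neg, if_pos (by rwa [show v + 4 = g by omega])]
      · exact Or.inr ⟨rfl, rfl⟩
      · rw [show v + 3 = g - 1 by omega]; exact hE.not_root hg.1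
  rw [tshift, if_neg hc1, add_zero] at h4
  subst h4
  obtain ⟨k1, k2, k3⟩ := (h3 g D hg' hug hD).resolve_left he
  have hσL : (X n (u - tso V φ)).IsL := by rw [hXs]; exact k2.isL
  have hdead : u - tso V φ + 1 + D = g - cV n → ¬ TieHit (X n) (Y n) (u - tso V φ) →
      Dead (X n) (Y n) (u - tso V φ) := by
    intro h7 h8
    exact ⟨seen_iff.2 ⟨D, by rw [hXs]; exact k2, by rw [h7]; exact g0⟩, h8⟩
  -- In its last phase the foreign train would have the width `cV n`, and its signal would be at the
  -- end of the guard. As `cφ n < φ`, this end is not about to move, so there is no tie and the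
  -- signal dies.
  by_cases hc2 : φ = 2 * V - 3
  · exfalso
    have ht := tso_of_lt k1
    obtain ⟨hn1, hn2⟩ := next_of_eq hc2
    have hV3 : V = cV n ∧ cφ n < φ := by
      rcases h1.phase.older h2 with h | h <;> omega
    have hd := hdead (by omega) (by
      intro hc
      obtain ⟨-, D', h7, h8, h9⟩ := tieHit_iff.1 hc
      have hDD : D' = D := by
        rw [hXs] at h7
        rcases h7 with ⟨a, b⟩ | ⟨a, b⟩ <;> rcases k2 with ⟨c, d⟩ | ⟨c, d⟩ <;> simp_all
      rw [hDD] at h9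
      have g1 := hI.guard g hg' 1 (by omega) (by omega)
      rw [show g - cV n + 1 = u - tso V φ + 2 + D by omega, h9] at g1
      rcases gpat_one hp with h10 | ⟨-, h10 | h10⟩
      · omega
      · rw [h10] at g1; cases g1
      · rw [h10] at g1; cases g1)
    rw [hn1, hn2, tso_of_le (by omega)] at hXs'
    have hR : (nextσ (X n) (Y n) u V φ σ).IsR := h5.kind.1 (by omega)
    rw [← hXs'] at hR
    obtain ⟨-, -, h7⟩ := trainRule_isR hR
    rw [show u - (V + 1 - 0 - 1) - 1 = u - tso V φ by omega] at h7
    rcases h7 with h7 | h7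
    · exact hσL.ne.2.2.2.2.2.2.2 h7.1
    · exact h7.2.2 hd
  · obtain ⟨hn1, hn2⟩ := next_of_lt (V := V) (φ := φ) (by omega)
    have ht := tso_of_lt k1
    rw [nextσ, if_neg hc1, if_neg hc2] at hXs' ⊢
    rw [hn1, hn2, tso_of_lt (by omega)] at hXs' ⊢
    refine ⟨by omega, k2, ?_⟩
    by_contra hlt
    have heq : u - tso V φ + 1 + D = g - cV n := by omega
    have hd := hdead heq (by
      intro hc
      have hh := hc.1
      have he1 : tso V φ + 1 ≤ e := by
        by_contra hc'
        have hee : e = tso V φ := by omega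
        rcases h1.brk with h7 | h7 | h7
        · omega
        · apply h7
          rw [hee, hh]
          exact ⟨fun h => absurd h hσL.ne.2.2.2.2.2.2.1, fun h => absurd h hσL.ne.2.2.2.2.2.1,
            fun _ => Or.inl rfl⟩
        · omega
      have h8 := h1.pat (tso V φ + 1) (by omega) he1
      rw [← sub_sub, hh, tpat_a σ h1.phase (by omega) (by rw [tW_of_lt k1]; omega)] at h8
      cases h8)
    have hL : (trainRule (X n) (Y n) (u - (φ + 1 + 4 - V))).IsL := by rw [hXs']; exact k2.isL
    obtain ⟨-, -, h7 | h7⟩ := trainRule_isL hL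
    · have := h7.2.tip.1
      rw [show u - (φ + 1 + 4 - V) + 1 = u - tso V φ by omega] at this
      exact hσL.ne.2.2.2.2.2.2.1 this
    · apply h7.2.2
      rwa [show u - (φ + 1 + 4 - V) + 1 = u - tso V φ by omega]

theorem Inv.succ (hE : Evolution A X Y) (hI : Inv A X Y n) : Inv A X Y (n + 1) := by
  have hX := hE.train n
  have hY := hE.wall n
  refine ⟨?_, ?_, ?_, ?_, ?_, ?_, ?_, ?_, ?_, ?_⟩
  · intro f hf; rw [hX]; exact hI.train_step hE hf
  · intro f hf i h1 h2; rw [hX]; exact hI.zone_step hE hf h1 h2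
  · intro u hu; rw [hX] at hu ⊢; exact hI.tip_step hE hu
  · intro g hg j h1 h2; rw [hY]; exact hI.guard_step hE hg h1 h2
  · intro g hg m hm
    rcases hm.eq_or_lt with rfl | hm
    · rw [hX]; exact hI.fixed_step hE hg.pred
    · exact hI.fixed g hg.pred m (by omega)
  · intro g hg i h1 h2; rw [hX]; exact hI.closed_step hE hg h1 h2
  · intro u hu K; rw [hY] at hu ⊢; exact hI.wall_step hE hu K
  · intro f g h h2 u h3 h4; rw [hY]; exact hI.free_step hE h h2 h3 h4
  · intro f g h hf h2; rw [hX, hY]; exact hI.middle_step hE h hf h2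
  · intro f g w h hf hw; rw [hX]; exact hI.opened_step hE h hf hw

theorem Evolution.inv (hE : Evolution A X Y) (n : ℕ) : Inv A X Y n := by
  induction n with
  | zero => exact hE.inv_zero
  | succ n ih => exact ih.succ hE

/-- The space on the right of a star is open. -/
theorem Evolution.open_right (hE : Evolution A X Y) (n : ℕ) {f i : ℤ} (hf : f ∈ A) (h1 : f < i)
    (h2 : i < f + cV n - 2) : X n i = .o := by
  have hI := hE.inv n
  -- Induction on the distance to the star: if the next star lies before `i`, it replaces `f`;
  -- otherwise `i` lies in the interval opened between the two.
  obtain ⟨k, hk⟩ : ∃ k : ℕ, i - f = k := ⟨(i - f).toNat, by omega⟩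
  induction k using Nat.strong_induction_on generalizing f with
  | _ k ih =>
    by_cases hr : RightOpen A (cV n) (cφ n) f
    · exact hI.zone f hr i h1 (by omega)
    have : ∃ g, Pair A f g ∧ ¬ (2 * cV n + 2 ≤ g - f ∨ (2 * cV n ≤ g - f ∧ cφ n + 2 ≤ cV n)) := by
      by_contra hc
      push Not at hc
      exact hr ⟨hf, fun g hg => by
        by_contra hc'; have := hc g hg; push Not at hc'; omega⟩
    obtain ⟨g, hg, h3⟩ := this
    have hfg := hg.2.2.1
    rcases le_or_gt i g with h4 | h4
    · obtain ⟨m, hm, h5⟩ := hI.opened f g _ hg hr rfl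
      rw [hm i h1 h4, if_pos (by omega)]
    · exact ih (i - g).toNat (by omega) hg.2.1 h4 (by omega) (by omega)

end


/-! ### Equicontinuity of the opening automaton. -/

theorem IsCellularAutomaton.exists_radius {A : Type} {F : Config A → Config A}
    (hF : IsCellularAutomaton F) : ∃ r : ℕ, ∀ (n m : ℕ) (x y : Config A),
      AgreeOn x y (m + n * r) → AgreeOn (F^[n] x) (F^[n] y) m := by
  obtain ⟨U, f, hf⟩ := hF
  refine ⟨∑ u ∈ U, u.natAbs, fun n => ?_⟩
  induction n with
  | zero => intro m x y h; simpa using h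
  | succ n ih =>
    intro m x y h
    rw [Function.iterate_succ_apply, Function.iterate_succ_apply]
    apply ih
    intro i hi
    rw [hf, hf]
    congr 1
    funext u
    apply h
    have h1 : (u : ℤ).natAbs ≤ ∑ u ∈ U, u.natAbs :=
      Finset.single_le_sum (f := fun u : ℤ => u.natAbs) (fun _ _ => Nat.zero_le _) u.2
    have h2 := abs_add_le i (u : ℤ)
    rw [Int.abs_eq_natAbs (u : ℤ)] at h2
    generalize ∑ u ∈ U, u.natAbs = R at *
    have h3 : ((u : ℤ).natAbs : ℤ) ≤ R := by exact_mod_cast h1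
    simp only [Nat.cast_add, Nat.cast_mul, Nat.cast_one] at hi ⊢
    linarith

/-- Seeds last for one step only, so the layers are indexed from time `1` on, and the stars are the
seeds that were active at time `0`. -/
theorem evolution_openMap (y : Config (Train × Guard × Bool)) :
    Evolution {p | Active (fun j => (y j).1) p} (fun n i => (openMap^[n + 1] y i).1)
      (fun n i => (openMap^[n + 1] y i).2.1) := by
  have hs : Start (fun i => (openMap^[0 + 1] y i).1) (fun i => (openMap^[0 + 1] y i).2.1)
      {p | Active (fun j => (y j).1) p} := start_next _ _
  have seedless : ∀ n i, (openMap^[n + 1] y i).1 ≠ .s := by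
    intro n
    induction n with
    | zero => exact hs.seedless
    | succ n ih =>
      intro i
      rw [Function.iterate_succ_apply']
      change trainNext _ _ i ≠ _
      rw [trainNext_eq_trainRule _ (not_active_of_seedless ih i)]
      exact trainRule_ne_s
  refine ⟨hs, fun n => ?_, fun n => ?_⟩
  · funext i
    rw [Function.iterate_succ_apply']
    exact trainNext_eq_trainRule _ (not_active_of_seedless (seedless n) i)
  · funext i
    rw [Function.iterate_succ_apply']
    exact wallNext_eq_wallRule _ (not_active_of_seedless (seedless n) i)

/-- The guard is erased and the colour is reset, so an open cell carries no information. -/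
theorem openMap_of_open {z : Config (Train × Guard × Bool)} {i : ℤ} (h : (openMap z i).1 = .o) :
    openMap z i = (.o, .n, false) := by
  have h1 : trainNext (fun j => (z j).1) (fun j => (z j).2.1) i = .o := h
  have hn : ¬ NearActive (fun j => (z j).1) i := by
    intro hc
    unfold trainNext at h1
    split_ifs at h1
  have h2 : wallNext (fun j => (z j).1) (fun j => (z j).2.1) i = .n := by
    rw [wallNext_eq_wallRule _ hn, wallRule, if_pos]
    left
    rw [← h1, trainNext_eq_trainRule _ hn]
  simp only [openMap, h1, h2, if_true]

/-- Seeds at all multiples of `40`. -/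
def seedLattice : Config (Train × Guard × Bool) := fun i => (if (40 : ℤ) ∣ i then .s else .d, .n, false)

/-- The margin `16` makes the seeds from `40 * a` to `40 * b` active. From the width `43` on, the
open space of a star covers all cells up to the next seed, so `i` is served by the last of these
seeds before it. -/
theorem open_of_agreeOn_seedLattice {y : Config (Train × Guard × Bool)} {m : ℕ}
    (hy : AgreeOn seedLattice y m) {a b i : ℤ} {n : ℕ} (hab : a ≤ b) (ha : -m ≤ 40 * a - 16)
    (hb : 40 * b + 16 ≤ m) (hn : 43 ≤ cV n) (h1 : 40 * a < i) (h2 : i < 40 * b + cV n - 2) :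
    openMap^[n + 1] y i = (.o, .n, false) := by
  rw [Function.iterate_succ_apply']
  apply openMap_of_open
  rw [← Function.iterate_succ_apply' openMap]
  have hA : ∀ j, a ≤ j → j ≤ b → Active (fun j => (y j).1) (40 * j) := by
    intro j h3 h4
    constructor
    · simp only
      rw [← hy (40 * j) (by rw [abs_le]; omega)]
      simp [seedLattice]
    · intro k hk hk'
      rw [abs_le] at hk'
      simp only
      rw [← hy (40 * j + k) (by rw [abs_le]; omega), seedLattice]
      simp only
      rw [if_neg (by omega)]
      decide
  have := (evolution_openMap y).open_right n (f := 40 * min b ((i - 1) / 40)) (i := i)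
    (hA _ (by omega) (by omega)) (by omega) (by omega)
  exact this

theorem openMap_equicontinuousAt {h : ℕ → ℤ} (h₀ : Below (fun _ => 0) h)
    (h₁ : Below h parabola) : EquicontinuousAt openMap h seedLattice := by
  obtain ⟨M, hM, H⟩ := h₀
  obtain ⟨N, hN, K⟩ := h₁
  lift M to ℕ using hM.le
  lift N to ℕ using hN.le
  obtain ⟨r, hr⟩ := isCellularAutomaton_openMap.exists_radius
  intro k
  -- Since `43 * 44 ≤ 2000`, the space near the curve is open from time `2000` on if enough seeds
  -- are seen. For earlier times the radius `r` of the rule suffices.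
  set m : ℕ := (k + M + N + 2000) * 40 + 2000 * r with hm
  have key : ∀ y, AgreeOn seedLattice y m → ∀ (t : ℕ) (i : ℤ), 2000 ≤ t → |i| ≤ k →
      openMap^[t] y (i + h t) = (.o, .n, false) := by
    intro y hy t i ht hi
    obtain ⟨n, rfl⟩ : ∃ n, t = n + 1 := ⟨t - 1, by omega⟩
    have h1 := H (n + 1)
    have h2 := K (n + 1)
    have h3 := parabola_succ_le n
    have h4 := parabola_le_cV n
    have h5 := (le_parabola_iff n 43).2 (by omega)
    rw [abs_le] at hi
    simp only at h1
    push_cast at h5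
    apply open_of_agreeOn_seedLattice hy (a := -(k + M + 1)) (b := k + N + 5) <;> omega
  refine ⟨m, fun y hy t i hi => ?_⟩
  rcases le_or_gt 2000 t with ht | ht
  · rw [key y hy t i ht hi, key _ (fun _ _ => rfl) t i ht hi]
  · have h4 : k + M + N + 2000 + t * r ≤ m := by
      have : t * r ≤ 2000 * r := Nat.mul_le_mul_right _ ht.le
      omega
    apply hr t (k + M + N + 2000) seedLattice y
      (fun j hj => hy j (hj.trans (by exact_mod_cast h4)))
    have h1 := H t
    have h2 := K t
    have h3 := parabola_le t
    simp only at h1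
    rw [abs_le] at hi ⊢
    push_cast
    omega

/-! ### Sensitivity of the opening automaton. -/

section
variable {A : Set ℤ} {X : ℕ → ℤ → Train} {Y : ℕ → ℤ → Guard}

/-- `z` is the fictitious star from which the train would have come; it is constant in time, since
`starTip` follows the movement of the tip. The last inequality expresses that the tip was not beyond
`b` at the beginning. -/
theorem Evolution.tip_growth (hE : Evolution A X Y) {b : ℤ} (hb : ∀ i, b < i → X 0 i = .d) (n : ℕ)
    {τ : ℤ} (hτ : X n τ = .t) (K : ℤ) : ∃ V φ σ e V₀ φ₀ z, TrainAt (X n) τ V φ σ e K ∧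
      IsPhase V₀ φ₀ ∧ age V φ = age V₀ φ₀ + n ∧ τ = starTip V φ z ∧ z + 2 * V₀ - 1 ≤ b := by
  induction n generalizing τ K with
  | zero =>
    obtain ⟨V, φ, σ, e, h1, -⟩ := exists_trainAt (X 0) τ hτ (hE.start.tip_left τ hτ) (max K 0)
      (le_max_right _ _)
    refine ⟨V, φ, σ, e, V, φ, τ - (V - 1 + tW V φ), h1.mono (le_max_left _ _), h1.phase, by simp,
      by unfold starTip; ring, ?_⟩
    have : τ ≤ b := by
      by_contra hc
      rw [hb τ (by omega)] at hτ; cases hτ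
    have hV : V ≤ tW V φ := by unfold tW; split_ifs <;> omega
    omega
  | succ n ih =>
    rw [hE.train] at hτ ⊢
    obtain ⟨v, hv, -, hstep⟩ := TrainAt.step (X := X n) (Y := Y n) (K := max K 0 + 2)
      (by have := le_max_right K 0; omega) hτ
    obtain ⟨V, φ, σ, e, V₀, φ₀, z, h1, h2, h3, h4, h5⟩ := ih hv (max K 0 + 2)
    obtain ⟨h6, e', h7, -⟩ := hstep _ _ _ _ h1
    refine ⟨_, _, _, e', V₀, φ₀, z, h7.mono (by have := le_max_left K 0; omega), h2, ?_, ?_, h5⟩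
    · rw [age_next, h3]; push_cast; ring
    · rw [h1.phase.starTip_next, h6, h4]

/-- Open space spreads to the right at most like the parabola. -/
theorem Evolution.not_open (hE : Evolution A X Y) {b : ℤ} (hb : ∀ i, b < i → X 0 i = .d)
    (hg : ∀ i, Y 0 i = .g → i ≤ b) (n : ℕ) {i : ℤ} (hi : b + parabola n < i) : X n i ≠ .o := by
  induction n generalizing i with
  | zero =>
    have := parabola_nonneg 0
    rw [hb i (by omega)]; decide
  | succ n ih =>
    have hm := parabola_mono (Nat.le_succ n)
    have h0 := parabola_nonneg n
    rw [Nat.succ_eq_add_one] at hm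
    rw [hE.train]
    intro ho
    rcases trainPre_eq_o (trainRule_eq_pre (by decide) ho) with ⟨k, -, -, -, p, h1, -, h2⟩ | h1
    · have := hg p (hE.root h2)
      omega
    rcases trainLocal_eq_o h1 with h2 | ⟨-, h2⟩ | ⟨h2, h3, h4, -⟩
    · exact ih (by omega) h2
    · exact ih (by omega) h2
    -- New open space at a hit head: the head is at `z + V - 1`, where `V ≤ V₀ + parabola n + 2` and
    -- `z ≤ b + 1 - 2 * V₀`. As `2 ≤ V₀`, this is at most `b + parabola n`.
    · rcases hE.signal n (i + 1) h4 with ⟨q, h5, h6, h7⟩ | h5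
      · obtain ⟨V, φ, σ, e, V₀, φ₀, z, h8, h9, h10, h11, h12⟩ := hE.tip_growth hb n h6 (q + 1)
        obtain ⟨h13, h14, -, -, h15⟩ := h8.signal (q := q) (by omega) le_rfl
          (fun j hj hj' => by
            rw [show i + 1 + q - j = i + 1 + (q - j) by ring]; exact h7 _ (by omega) (by omega))
          (by rwa [add_sub_cancel_right])
        have h16 := h15 (by rwa [add_sub_cancel_right, add_sub_cancel_right])
        rw [starTip_of_lt z h14] at h11
        rw [tso_of_lt h14] at h13
        have h17 := h8.phase.growth h9 h10
        have h18 := h9.1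
        omega
      · have := h5 n 0 (by omega)
        rw [hb _ (by omega)] at this
        simp [Train.IsL] at this

end

/-- Outside `[-m, m]` everything is made inert, with the colour opposite to the one that `x` shows
on the curve at the time `n`. Open space has not arrived there by then, so this colour is still
visible. -/
theorem openMap_uniformlySensitive {h : ℕ → ℤ} (hh : ¬ Below h parabola) :
    UniformlySensitive openMap h := by
  intro x m
  obtain ⟨n, hn⟩ : ∃ n : ℕ, parabola n + (m + 3) < h n := by
    by_contra hc
    push Not at hc
    exact hh ⟨m + 3, by omega, hc⟩
  set c : Bool := !(openMap^[n] x (h n)).2.2 with hc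
  set y : Config (Train × Guard × Bool) := fun i => if |i| ≤ m then x i else (.d, .n, c) with hy
  have hout : ∀ i : ℤ, (m : ℤ) < i → y i = (.d, .n, c) := by
    intro i hi
    rw [hy]; simp only; rw [if_neg (by rw [abs_le]; omega)]
  have hact : ∀ p : ℤ, Active (fun j => (y j).1) p → p ≤ m := by
    intro p hp
    by_contra hc
    have := hp.1
    simp only [hout p (by omega)] at this
    cases this
  have hE := evolution_openMap y
  -- The `3` is the distance from a seed to the tip that it emits in the first step.
  have hb : ∀ i : ℤ, (m : ℤ) + 3 < i → (openMap^[0 + 1] y i).1 = .d := by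
    intro i hi
    change trainNext _ _ i = _
    by_cases hn : NearActive (fun j => (y j).1) i
    · unfold trainNext
      rw [if_neg, if_neg, if_neg, if_pos hn]
      · intro hc; have := hact _ hc; omega
      · intro hc; have := hact _ hc; omega
      · intro hc; have := hact _ hc; omega
    · rw [trainNext_eq_trainRule _ hn]
      apply trainRule_dead_cell
      · simp only [hout i (by omega)]
      · intro hc; have := hc.1; simp only [hout (i - 1) (by omega)] at this; cases this
      · intro hc; have := hc.1; simp only [hout (i - 2) (by omega)] at this; cases this
  have hg : ∀ i : ℤ, (openMap^[0 + 1] y i).2.1 = .g → i ≤ (m : ℤ) + 3 := by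
    intro i hi
    change wallNext _ _ i = _ at hi
    by_contra hc
    unfold wallNext at hi
    split_ifs at hi with _ _ h1
    · have := hact _ h1; omega
    · have := wallRule_eq_g hi
      simp only [hout i (by omega)] at this
      cases this
  have key : ∀ t (i : ℤ), (m : ℤ) + 3 + parabola t < i → (openMap^[t] y i).2.2 = c := by
    intro t
    induction t with
    | zero =>
      intro i hi
      have := parabola_nonneg 0
      rw [Function.iterate_zero_apply, hout i (by omega)]
    | succ t ih =>
      intro i hi
      have hm := parabola_mono (Nat.le_succ t)
      rw [Nat.succ_eq_add_one] at hm
      have h1 := hE.not_open hb hg t (i := i) (by omega)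
      simp only [Function.iterate_succ_apply'] at h1 ⊢
      have h2 : trainNext (fun j => (openMap^[t] y j).1) (fun j => (openMap^[t] y j).2.1) i ≠ .o := h1
      simp only [openMap, if_neg h2]
      exact ih i (by omega)
  refine ⟨y, fun i hi => ?_, n, fun hc' => ?_⟩
  · rw [hy]; simp only; rw [if_pos hi]
  · have h1 := key n (h n) (by omega)
    rw [← hc', hc] at h1
    revert h1
    cases (openMap^[n] x (h n)).2.2 <;> decide


/-! ### Assembly of the factors. -/

theorem equicontinuousCurves_eq {A : Type} {F : Config A → Config A} {P : (ℕ → ℤ) → Prop}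
    (x : Config A) (h₁ : ∀ h, P h → EquicontinuousAt F h x)
    (h₂ : ∀ h, ¬ P h → UniformlySensitive F h) :
    equicontinuousCurves F = {h | h ∈ curves ∧ P h} := by
  ext h
  constructor
  · rintro ⟨hc, hn⟩
    refine ⟨hc, ?_⟩
    by_contra hP
    exact (h₂ h hP).not_nonempty hn
  · rintro ⟨hc, hP⟩
    exact ⟨hc, x, (h₁ h hP).mem⟩

theorem parMap_prod_uniformlySensitive {h : ℕ → ℤ}
    (hh : ¬ (Below parabola h ∧ Below h (fun n => (n : ℤ)))) :
    UniformlySensitive (prodMap parMap andMap) h := by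
  by_cases hp : Below parabola h
  · exact (andMap_uniformlySensitive fun hc => hh ⟨hp, hc.2⟩).prodMap_right
  · exact (parMap_uniformlySensitive hp).prodMap_left

theorem openMap_prod_uniformlySensitive {h : ℕ → ℤ}
    (hh : ¬ (Below (fun _ => 0) h ∧ Below h parabola)) :
    UniformlySensitive (prodMap openMap andMap) h := by
  by_cases hp : Below h parabola
  · exact (andMap_uniformlySensitive fun hc => hh ⟨hc.1, hp⟩).prodMap_right
  · exact (openMap_uniformlySensitive hp).prodMap_left

theorem parMap_prod_equicontinuousAt {h : ℕ → ℤ}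
    (hh : Below parabola h ∧ Below h (fun n => (n : ℤ))) :
    EquicontinuousAt (prodMap parMap andMap) h (fun _ => (.n, false)) :=
  (parMap_equicontinuousAt hh.1 hh.2).prodMap
    (andMap_equicontinuousAt (below_zero_parabola.trans hh.1) hh.2)

theorem openMap_prod_equicontinuousAt {h : ℕ → ℤ}
    (hh : Below (fun _ => 0) h ∧ Below h parabola) :
    EquicontinuousAt (prodMap openMap andMap) h (fun i => (seedLattice i, false)) :=
  (openMap_equicontinuousAt hh.1 hh.2).prodMap
    (andMap_equicontinuousAt hh.1 (hh.2.trans below_parabola_id))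

theorem prodMap_uniformlySensitive {h : ℕ → ℤ} (hh : ¬ Equivalent h parabola) :
    UniformlySensitive (prodMap (prodMap parMap andMap) (prodMap openMap andMap)) h := by
  rw [equivalent_iff] at hh
  by_cases hp : Below parabola h
  · exact (openMap_prod_uniformlySensitive fun hc => hh ⟨hp, hc.2⟩).prodMap_right
  · exact (parMap_prod_uniformlySensitive fun hc => hp hc.1).prodMap_left

theorem prodMap_equicontinuousAt {h : ℕ → ℤ} (hh : Equivalent h parabola) :
    EquicontinuousAt (prodMap (prodMap parMap andMap) (prodMap openMap andMap)) h
      (fun i => ((.n, false), (seedLattice i, false))) := by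
  rw [equivalent_iff] at hh
  exact (parMap_prod_equicontinuousAt ⟨hh.1, hh.2.trans below_parabola_id⟩).prodMap
    (openMap_prod_equicontinuousAt ⟨below_zero_parabola.trans hh.1, hh.2⟩)

theorem isCellularAutomaton_parMap_prod : IsCellularAutomaton (prodMap parMap andMap) :=
  isCellularAutomaton_prodMap isCellularAutomaton_parMap isCellularAutomaton_andMap

theorem isCellularAutomaton_openMap_prod : IsCellularAutomaton (prodMap openMap andMap) :=
  isCellularAutomaton_prodMap isCellularAutomaton_openMap isCellularAutomaton_andMap

theorem prodMap_sensitiveAlong_linearCurve (α : ℝ) :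
    SensitiveAlong (prodMap (prodMap parMap andMap) (prodMap openMap andMap)) (linearCurve α) :=
  (prodMap_uniformlySensitive fun hc => not_equivalent_parabola_linearCurve α
    (equivalent_iff.2 (equivalent_iff.1 hc).symm)).sensitiveAlong

end DirectionalCA

theorem mainTheorem1 :
    ∃ (A B : Type) (FP : DirectionalCA.Config A → DirectionalCA.Config A)
      (FC : DirectionalCA.Config B → DirectionalCA.Config B),
      Finite A ∧ Finite B ∧
      DirectionalCA.IsCellularAutomaton FP ∧
      DirectionalCA.IsCellularAutomaton FC ∧
      DirectionalCA.equicontinuousCurves FP =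
        {h | h ∈ DirectionalCA.curves ∧ DirectionalCA.Below DirectionalCA.parabola h ∧
          DirectionalCA.Below h (fun n => (n : ℤ))} ∧
      DirectionalCA.equicontinuousCurves FC =
        {h | h ∈ DirectionalCA.curves ∧ DirectionalCA.Below (fun _ => 0) h ∧
          DirectionalCA.Below h DirectionalCA.parabola} ∧
      DirectionalCA.IsCellularAutomaton (DirectionalCA.prodMap FP FC) ∧
      DirectionalCA.parabola ∈ DirectionalCA.curves ∧
      DirectionalCA.equicontinuousCurves (DirectionalCA.prodMap FP FC) =
        {h | h ∈ DirectionalCA.curves ∧ DirectionalCA.Equivalent h DirectionalCA.parabola} ∧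
      (∀ α : ℝ, ¬ DirectionalCA.Equivalent DirectionalCA.parabola
        (DirectionalCA.linearCurve α)) ∧
      (∀ α : ℝ, DirectionalCA.SensitiveAlong (DirectionalCA.prodMap FP FC)
        (DirectionalCA.linearCurve α)) := by
  refine ⟨_, _, DirectionalCA.prodMap DirectionalCA.parMap DirectionalCA.andMap,
    DirectionalCA.prodMap DirectionalCA.openMap DirectionalCA.andMap,
    inferInstance, inferInstance, DirectionalCA.isCellularAutomaton_parMap_prod,
    DirectionalCA.isCellularAutomaton_openMap_prod, ?_, ?_,
    DirectionalCA.isCellularAutomaton_prodMap DirectionalCA.isCellularAutomaton_parMap_prod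
      DirectionalCA.isCellularAutomaton_openMap_prod,
    DirectionalCA.parabola_mem_curves, ?_,
    DirectionalCA.not_equivalent_parabola_linearCurve,
    DirectionalCA.prodMap_sensitiveAlong_linearCurve⟩
  · exact DirectionalCA.equicontinuousCurves_eq _
      (fun _ => DirectionalCA.parMap_prod_equicontinuousAt)
      (fun _ => DirectionalCA.parMap_prod_uniformlySensitive)
  · exact DirectionalCA.equicontinuousCurves_eq _
      (fun _ => DirectionalCA.openMap_prod_equicontinuousAt)
      (fun _ => DirectionalCA.openMap_prod_uniformlySensitive)
  · exact DirectionalCA.equicontinuousCurves_eq _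
      (fun _ => DirectionalCA.prodMap_equicontinuousAt)
      (fun _ => DirectionalCA.prodMap_uniformlySensitive)
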